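/- **Setting.** Let $D$ be either the flat torus $\mathbb R^2/(2\pi\mathbb Z)^2$ (periodic boundary conditions) or a bounded domain in $\mathbb R^2$ with $C^2$ boundary (Neumann boundary conditions), and let $\Delta$ be the corresponding Laplacian on $L^2=L^2(D)$. Write $f(u)=u-u^3$, $C^0=C^0(\overline D)$, $H^{-1}=(H^1)'$, $A_\varepsilon=(1-\varepsilon-\varepsilon\Delta)\Delta$, and let $V_\varepsilon$ be the space of functions in $H^2$ satisfying the boundary condition, with norm $\|\varphi\|_{V_\varepsilon}^2=\|\varphi\|_{L^2}^2-\langle A_\varepsilon\varphi,\varphi\rangle$. For $T>0$, $\varepsilon\in(0,1)$ and $\sigma_\varepsilon\in\mathbb R$, let $W$ be a standard cylindrical Wiener process on $L^2$ and $$Z_\varepsilon(t)=\int_0^t e^{(t-s)A_\varepsilon}\sigma_\varepsilon\,dW(s),\qquad t\in[0,T],$$ the stochastic convolution, assumed to have paths in $C^0([0,T],C^0)$ almost surely. A process $u_\varepsilon$ is a solution of the Cahn–Hilliard/Allen–Cahn homotopy $$\partial_t u_\varepsilon=(1-\varepsilon-\varepsilon\Delta)(\Delta u_\varepsilon+f(u_\varepsilon))+\sigma_\varepsilon\,\partial_tW$$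 on $[0,T]$ if almost surely $v_\varepsilon=u_\varepsilon-Z_\varepsilon$ belongs to $L^2([0,T],V_\varepsilon)\cap C^0([0,T],C^0)$ and is a weak solution, with test functions in $V_\varepsilon$, of $\partial_tv_\varepsilon=(1-\varepsilon-\varepsilon\Delta)(\Delta v_\varepsilon+f(v_\varepsilon+Z_\varepsilon))$. **Theorem.** For every such $D$ there are $\varepsilon_0\in(0,1)$ and $p_0>2$ such that the following holds. Let $C_0\in\mathbb R$, $T>0$, and let $u\in C^0([0,T],H^1)\cap L^2([0,T],H^2)$ be a weak solution (with test functions in $H^1$) of $$\partial_tu=\Delta u+f(u)-3C_0u .$$ Then for every $p\ge p_0$ there is a constant $\tilde K>0$, depending only on $D,C_0,T,u,p$, such that for all $\varepsilon\in(0,\varepsilon_0)$, all $\sigma_\varepsilon$, $W$, $Z_\varepsilon$, $u_\varepsilon$ as above and all $\gamma\ge\varepsilon^{1/2}$, $$\begin{aligned} \mathbb P\Big(\sup_{[0,T]}\|u_\varepsilon-u-Z_\varepsilon\|_{L^2}^2>\tilde K\gamma\Big) \le{}&\mathbb P\Big(\varepsilon^{1/4}\sup_{[0,T]}\|Z_\varepsilon\|_{C^0}>\tfrac12\Big)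 +\mathbb P\big(\|u(0)-u_\varepsilon(0)\|_{L^2}^2>\gamma\big)\\ &+\mathbb P\big(\|Z_\varepsilon^2-C_0\|_{L^p([0,T],H^{-1})}^2>\gamma\big) +\mathbb P\big(\|Z_\varepsilon\|_{L^p([0,T],H^{-1})}^2>\gamma\big)\\ &+\mathbb P\big(\|Z_\varepsilon^3\|_{L^2([0,T],H^{-1})}^2>\gamma\big) +\mathbb P\big(\varepsilon^{1/2}\|Z_\varepsilon\|_{L^6([0,T],L^6)}^6>\gamma\big). \end{aligned}$$ -/

import Mathlib

open MeasureTheory ProbabilityTheory Set Filter Topology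
open scoped ENNReal NNReal

/-! ### Spatial domains: the flat torus, or a bounded planar domain with Neumann conditions -/

/-- The Euclidean plane. -/
abbrev Plane : Type := EuclideanSpace ℝ (Fin 2)

/-- The `i`-th classical partial derivative. -/
noncomputable def partialDeriv (φ : Plane → ℝ) (i : Fin 2) (x : Plane) : ℝ :=
  fderiv ℝ φ x (EuclideanSpace.single i 1)

/-- `2π`-periodicity in both coordinates: functions on `ℝ² / (2πℤ)²`. -/
def IsPeriodic (φ : Plane → ℝ) : Prop :=
  ∀ (x : Plane) (i : Fin 2), φ (x + EuclideanSpace.single i (2 * Real.pi)) = φ x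

/-- Bounded domains (open connected sets) in the plane with `C²` boundary: near each boundary
point the set is a sublevel set of a `C²` function with non-vanishing differential. -/
structure IsC2Domain (U : Set Plane) : Prop where
  isOpen : IsOpen U
  isConnected : IsConnected U
  isBounded : Bornology.IsBounded U
  boundary : ∀ x ∈ frontier U, ∃ ρ : Plane → ℝ, ∃ N ∈ 𝓝 x,
    ContDiff ℝ 2 ρ ∧ fderiv ℝ ρ x ≠ 0 ∧ ∀ y ∈ N, (y ∈ U ↔ ρ y < 0)

/-- The two settings: periodic boundary conditions on the torus `ℝ² / (2πℤ)²`, or Neumann boundary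
conditions on a bounded domain with `C²` boundary. -/
inductive SpatialDomain : Type
  | torus : SpatialDomain
  | neumann (U : Set Plane) (hU : IsC2Domain U) : SpatialDomain

namespace SpatialDomain

/-- The region over which one integrates. For the torus this is the open periodicity cell. -/
def carrier : SpatialDomain → Set Plane
  | torus => {x | ∀ i, x i ∈ Ioo 0 (2 * Real.pi)}
  | neumann U _ => U

/-- Smooth test functions for weak derivatives: smooth functions on the torus, respectively
smooth functions with compact support in the domain. -/
def IsTest : SpatialDomain → (Plane → ℝ) → Prop
  | torus, φ => ContDiff ℝ (⊤ : ℕ∞) φ ∧ IsPeriodic φ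
  | neumann U _, φ => ContDiff ℝ (⊤ : ℕ∞) φ ∧ HasCompactSupport φ ∧ tsupport φ ⊆ U

/-- `w ∈ C⁰([0,T], C⁰)`, where `C⁰` are the continuous functions on the torus, respectively on the
closure of the domain, with the supremum norm; by compactness this is joint continuity. -/
def ContTime : SpatialDomain → ℝ → (ℝ → Plane → ℝ) → Prop
  | torus, T, w => ContinuousOn (fun q : ℝ × Plane => w q.1 q.2) (Icc 0 T ×ˢ univ) ∧
      ∀ t ∈ Icc 0 T, IsPeriodic (w t)
  | neumann U _, T, w => ContinuousOn (fun q : ℝ × Plane => w q.1 q.2) (Icc 0 T ×ˢ closure U)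

variable (D : SpatialDomain)

/-- Lebesgue measure on the region. -/
noncomputable abbrev vol : Measure Plane := volume.restrict D.carrier

/-- The Hilbert space `L²`. -/
abbrev L2 : Type := Lp ℝ 2 D.vol

/-! ### Sobolev spaces and the Laplacian -/

/-- `w ∈ H¹` with weak gradient `g`. -/
def HasWeakGrad (w : D.L2) (g : Fin 2 → D.L2) : Prop :=
  ∀ φ : Plane → ℝ, D.IsTest φ → ∀ i,
    ∫ x, w x * partialDeriv φ i x ∂D.vol = -∫ x, g i x * φ x ∂D.vol

/-- `w ∈ H²` with weak gradient `g` and weak second derivatives `h`. -/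
def HasHess (w : D.L2) (g : Fin 2 → D.L2) (h : Fin 2 → Fin 2 → D.L2) : Prop :=
  D.HasWeakGrad w g ∧ ∀ i, D.HasWeakGrad (g i) (h i)

/-- `w` is in the domain of the periodic, respectively Neumann, Laplacian on `L²` and `Δ w = l`:
`w ∈ H¹` and `⟨∇w, ∇φ⟩ = -⟨l, φ⟩` for all `φ ∈ H¹`. In the Neumann case this contains the boundary
condition `∂w/∂n = 0`. -/
def HasLaplacian (w l : D.L2) : Prop :=
  ∃ g, D.HasWeakGrad w g ∧ ∀ (φ : D.L2) (γ : Fin 2 → D.L2), D.HasWeakGrad φ γ →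
    ∑ i, inner ℝ (g i) (γ i) = -inner ℝ l φ

/-- `w` belongs to the space `V_ε`, that is `H²` with the boundary condition, and `Δ w = l`.
(As a set, this space does not depend on `ε`.) -/
def MemV (w l : D.L2) : Prop :=
  (∃ g h, D.HasHess w g h) ∧ D.HasLaplacian w l

/-- `w ∈ L²([0,T], H²)` with gradients `g` and second derivatives `h`. -/
def MemL2H2 (T : ℝ) (w : ℝ → D.L2) (g : ℝ → Fin 2 → D.L2) (h : ℝ → Fin 2 → Fin 2 → D.L2) : Prop :=
  (∀ᵐ t ∂volume.restrict (Icc 0 T), D.HasHess (w t) (g t) (h t)) ∧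
  MemLp w 2 (volume.restrict (Icc 0 T)) ∧
  (∀ i, MemLp (fun t => g t i) 2 (volume.restrict (Icc 0 T))) ∧
  ∀ i j, MemLp (fun t => h t i j) 2 (volume.restrict (Icc 0 T))

/-- The norm of `w` in `H⁻¹`, the dual space of `H¹` (with pivot space `L²`). -/
noncomputable def normNegOne (w : Plane → ℝ) : ℝ≥0∞ :=
  ⨆ (φ : D.L2) (γ : Fin 2 → D.L2) (_ : D.HasWeakGrad φ γ)
    (_ : ‖φ‖ ^ 2 + ∑ i, ‖γ i‖ ^ 2 ≤ 1), ‖∫ x, w x * φ x ∂D.vol‖ₑ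

/-- The norm of `w` in `C⁰`. -/
noncomputable def normC0 (w : Plane → ℝ) : ℝ≥0∞ :=
  ⨆ x ∈ closure D.carrier, ‖w x‖ₑ

end SpatialDomain

/-- The norm in `L^p([0,T])` of a nonnegative function of time. -/
noncomputable def timeNorm (T p : ℝ) (N : ℝ → ℝ≥0∞) : ℝ≥0∞ :=
  (∫⁻ t in Icc 0 T, N t ^ p) ^ (1 / p)

/-! ### Cylindrical Wiener processes and stochastic convolutions -/

section Stochastic

variable {Ω H : Type*} [MeasurableSpace Ω] [NormedAddCommGroup H] [InnerProductSpace ℝ H]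

/-- `W` is a standard cylindrical Wiener process on `H`: the centred Gaussian process, indexed by
`[0,∞) × H`, with covariance `E[W_s(h) W_t(k)] = min(s,t) ⟨h,k⟩`, and continuous in time. -/
structure IsCylindricalWiener (W : ℝ≥0 → H → Ω → ℝ) (P : Measure Ω) : Prop where
  gaussian : IsGaussianProcess (fun q : ℝ≥0 × H => W q.1 q.2) P
  centred : ∀ t h, ∫ ω, W t h ω ∂P = 0
  covariance_eq : ∀ s t h k, cov[W s h, W t k; P] = min (s : ℝ) t * inner ℝ h k
  continuous : ∀ h, ∀ᵐ ω ∂P, Continuous fun t => W t h ω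

/-- `I` is the Wiener integral `∫₀ᵗ ⟨g(s), dW(s)⟩` of the (continuous, deterministic) integrand `g`:
the limit in `L²(Ω)` of the Riemann sums over uniform partitions of `[0,t]`. -/
def IsWienerIntegral (W : ℝ≥0 → H → Ω → ℝ) (P : Measure Ω) (t : ℝ≥0) (g : ℝ≥0 → H)
    (I : Ω → ℝ) : Prop :=
  MemLp I 2 P ∧
  Tendsto (fun n : ℕ => eLpNorm (fun ω =>
    ∑ i ∈ Finset.range n, (W ((i + 1) * t / n) (g (i * t / n)) ω - W (i * t / n) (g (i * t / n)) ω)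
      - I ω) 2 P) atTop (𝓝 0)

/-- `S` is the strongly continuous semigroup on `H` generated by the unbounded operator whose graph
is `A`. -/
structure IsSemigroupGeneratedBy (S : ℝ≥0 → H →L[ℝ] H) (A : H → H → Prop) : Prop where
  zero : S 0 = ContinuousLinearMap.id ℝ H
  add : ∀ s t, S (s + t) = (S s).comp (S t)
  continuous : ∀ h, Continuous fun t => S t h
  generator : ∀ h k, A h k ↔
    Tendsto (fun t : ℝ≥0 => (t : ℝ)⁻¹ • (S t h - h)) (𝓝[>] 0) (𝓝 k)

end Stochastic

/-! ### The equations -/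

/-- The cubic nonlinearity `f(u) = u - u³`. -/
def cubic (r : ℝ) : ℝ := r - r ^ 3

namespace SpatialDomain

variable (D : SpatialDomain)

/-- The graph of `A_ε = (1 - ε - εΔ)Δ` on `L²`. -/
def opA (ε : ℝ) (w k : D.L2) : Prop :=
  ∃ l m, D.HasLaplacian w l ∧ D.HasLaplacian l m ∧ k = (1 - ε) • l - ε • m

/-- `Z` is the stochastic convolution `Z(t) = ∫₀ᵗ e^{(t-s)A_ε} σ dW(s)`, `t ∈ [0,T]`, and has paths in
`C⁰([0,T], C⁰)` almost surely. The `L²`-valued integral is the one whose pairing with any `h` is the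
Wiener integral of `s ↦ σ (e^{(t-s)A_ε})* h`. -/
def IsStochasticConvolution {Ω : Type*} [MeasurableSpace Ω] (P : Measure Ω)
    (W : ℝ≥0 → D.L2 → Ω → ℝ) (ε σ T : ℝ) (Z : Ω → ℝ → Plane → ℝ) : Prop :=
  (∀ᵐ ω ∂P, D.ContTime T (Z ω)) ∧
  ∃ S : ℝ≥0 → D.L2 →L[ℝ] D.L2, IsSemigroupGeneratedBy S (D.opA ε) ∧
    ∀ t : ℝ≥0, (t : ℝ) ≤ T → ∀ h : D.L2,
      IsWienerIntegral W P t (fun s => σ • ContinuousLinearMap.adjoint (S (t - s)) h)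
        (fun ω => ∫ x, Z ω t x * h x ∂D.vol)

/-- `v` is a weak solution in `V_ε ⊆ L² ⊆ V_ε'`, of class `L²([0,T], V_ε) ∩ C⁰([0,T], C⁰)`, of
`∂ₜ v = (1 - ε - εΔ)(Δv + f(v + z))` for a given path `z`. The function `V` is `v` seen as a path in
`L²`, and `∑ i, h s i i` is `Δv(s)`. -/
def IsShiftedSolution (ε T : ℝ) (z v : ℝ → Plane → ℝ) : Prop :=
  D.ContTime T v ∧
  ∃ (V : ℝ → D.L2) (g : ℝ → Fin 2 → D.L2) (h : ℝ → Fin 2 → Fin 2 → D.L2),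
    (∀ t ∈ Icc 0 T, V t =ᵐ[D.vol] v t) ∧
    D.MemL2H2 T V g h ∧
    (∀ᵐ t ∂volume.restrict (Icc 0 T), D.HasLaplacian (V t) (∑ i, h t i i)) ∧
    ∀ φ l : D.L2, D.MemV φ l → ∀ t ∈ Icc 0 T,
      inner ℝ (V t) φ = inner ℝ (V 0) φ + ∫ s in (0)..t,
        (inner ℝ (∑ i, h s i i) ((1 - ε) • φ - ε • l) +
          ∫ x, cubic (v s x + z s x) * ((1 - ε) * φ x - ε * l x) ∂D.vol)

/-- `u ∈ C⁰([0,T], H¹) ∩ L²([0,T], H²)` is a weak solution of `∂ₜ u = Δu + f(u) - 3 C₀ u`, with test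
functions in `H¹`. -/
def IsLimitSolution (C₀ T : ℝ) (u : ℝ → D.L2) : Prop :=
  ∃ (g : ℝ → Fin 2 → D.L2) (h : ℝ → Fin 2 → Fin 2 → D.L2),
    (∀ t ∈ Icc 0 T, D.HasWeakGrad (u t) (g t)) ∧
    ContinuousOn u (Icc 0 T) ∧ ContinuousOn g (Icc 0 T) ∧
    D.MemL2H2 T u g h ∧
    ∀ (φ : D.L2) (γ : Fin 2 → D.L2), D.HasWeakGrad φ γ → ∀ t ∈ Icc 0 T,
      inner ℝ (u t) φ = inner ℝ (u 0) φ + ∫ s in (0)..t,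
        (-∑ i, inner ℝ (g s i) (γ i) + ∫ x, (cubic (u s x) - 3 * C₀ * u s x) * φ x ∂D.vol)

end SpatialDomain

/-! Write v = u_ε - Z, w = v - u, and z for one path of Z. The proof is a pathwise energy estimate
for ‖w‖² outside the six events on the right-hand side. Randomness enters only through the union
bound, the continuity of the paths and the fact that Z(0) = 0 almost surely.

Testing the difference of the two equations with w produces the dissipation (1-ε)‖∇w‖² + ε‖Δw‖². Put
a = u + z. The cube contributes ((w+a)³ - a³)w, which dominates w⁴ + a²w² up to a factor, and the
remainder a³ - u³ = 3u²z + 3uz² + z³. The drift 3C₀u turns z² into z² - C₀. Thus z, z² - C₀ and z³,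
which are small only in H⁻¹, appear paired with u²w, uw and w, and these pairings are absorbed by
part of ‖w‖²_{H¹}. The fourth-order part adds -ε⟨f(v+z), Δw⟩. Its worst term ε⟨v³, Δw⟩ is integrated
by parts and has a good sign up to a term in v²|∇u|². The other products with Δw are absorbed by
ε‖Δw‖² and by the quartic damping, because ε^{1/2}z² ≤ 1/4 off the first event. This is
`energy_pointwise`, integrated in `exists_slice_estimate`.

The products uw and u²w must be controlled in H¹ by w. With n³ = 1 + Σ‖∂ᵢⱼu‖ one has |u| ≤ Cn and
‖(∂ᵢu)²‖ ≤ Cn³, so the squared norms cost at most a multiple of n⁵. Since u ∈ L²H², n⁶ is integrable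
in time, and Hölder's inequality against the squares of H⁻¹ norms in L^p works for p ≥ 12.
Gronwall's inequality closes the argument (`exists_pathwise_bound`).

The supporting analysis rests on two devices. First, a weakly differentiable function satisfies the
fundamental theorem of calculus along almost every short segment (`WeakDeriv.ae_line_identity`).
Using two independent directions, this yields W^{1,1} ⊆ L² and W^{2,1} ⊆ L^∞ in the plane, and,
applied to f² and f³, Ladyzhenskaya's inequality and ‖f‖_∞³ ≤ C‖f‖²_{H¹}‖f‖_{H²}. Secondly,
translations are continuous in L². This replaces mollification both in the product rule
(`WeakDeriv.mul`) and in the energy identity (`energy_identity`), where the equation is only ever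
tested with the frozen function w(s). For that function to be admissible, u(s) must satisfy the
boundary condition for almost every s, which `limit_equation` extracts from the weak formulation. -/

/-! ### Translations in `L²` -/

section Translation

variable {X E : Type*} [NormedAddCommGroup X] [MeasurableSpace X]
  [NormedAddCommGroup E] [InnerProductSpace ℝ E] {μ : Measure X}

theorem abs_integral_mul_inner_le {ψ : X → ℝ} {M : ℝ} (hM : ∀ x, |ψ x| ≤ M)
    (hψ : AEStronglyMeasurable ψ μ) (A B : Lp E 2 μ) :
    Integrable (fun x => ψ x * inner ℝ (A x) (B x)) μ ∧
      |∫ x, ψ x * inner ℝ (A x) (B x) ∂μ| ≤ M * (‖A‖ * ‖B‖) := by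
  have hM0 : 0 ≤ M := (abs_nonneg _).trans (hM 0)
  have h1 : MemLp (fun x => ψ x • B x) 2 μ :=
    (Lp.memLp B).of_le_mul (c := M) (hψ.smul (Lp.aestronglyMeasurable B))
      (ae_of_all _ fun x => by
        rw [norm_smul]; exact mul_le_mul_of_nonneg_right (hM x) (norm_nonneg _))
  set C : Lp E 2 μ := h1.toLp _ with hC
  have hCe : C =ᵐ[μ] fun x => ψ x • B x := h1.coeFn_toLp
  have hn : ‖C‖ ≤ M * ‖B‖ := by
    apply Lp.norm_le_mul_norm_of_ae_le_mul
    filter_upwards [hCe] with x hx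
    rw [hx, norm_smul]; exact mul_le_mul_of_nonneg_right (hM x) (norm_nonneg _)
  have he : (fun x => ψ x * inner ℝ (A x) (B x)) =ᵐ[μ] fun x => inner ℝ (A x) (C x) := by
    filter_upwards [hCe] with x hx
    rw [hx, inner_smul_right]
  refine ⟨(L2.integrable_inner A C).congr he.symm, ?_⟩
  rw [integral_congr_ae he, ← L2.inner_def]
  calc _ ≤ ‖A‖ * ‖C‖ := abs_real_inner_le_norm _ _
    _ ≤ ‖A‖ * (M * ‖B‖) := by gcongr
    _ = _ := by ring

/-- A bounded bilinear form is jointly continuous; the bound is the Cauchy–Schwarz estimate above.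
-/
theorem continuous_integral_mul_inner {ψ : X → ℝ} {M : ℝ} (hM : ∀ x, |ψ x| ≤ M)
    (hψ : AEStronglyMeasurable ψ μ) :
    Continuous fun q : Lp E 2 μ × Lp E 2 μ => ∫ x, ψ x * inner ℝ (q.1 x) (q.2 x) ∂μ := by
  have key := abs_integral_mul_inner_le (E := E) hM hψ
  let T : Lp E 2 μ →ₗ[ℝ] Lp E 2 μ →ₗ[ℝ] ℝ := LinearMap.mk₂ ℝ
    (fun A B => ∫ x, ψ x * inner ℝ (A x) (B x) ∂μ)
    (fun A A' B => by
      rw [← integral_add (key A B).1 (key A' B).1]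
      refine integral_congr_ae ?_
      filter_upwards [Lp.coeFn_add A A'] with x hx
      rw [hx, Pi.add_apply, inner_add_left, mul_add])
    (fun c A B => by
      rw [smul_eq_mul, ← integral_const_mul]
      refine integral_congr_ae ?_
      filter_upwards [Lp.coeFn_smul c A] with x hx
      rw [hx, Pi.smul_apply, real_inner_smul_left]; ring)
    (fun A B B' => by
      rw [← integral_add (key A B).1 (key A B').1]
      refine integral_congr_ae ?_
      filter_upwards [Lp.coeFn_add B B'] with x hx
      rw [hx, Pi.add_apply, inner_add_right, mul_add])
    (fun c A B => by
      rw [smul_eq_mul, ← integral_const_mul]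
      refine integral_congr_ae ?_
      filter_upwards [Lp.coeFn_smul c B] with x hx
      rw [hx, Pi.smul_apply, real_inner_smul_right]; ring)
  let T' := T.mkContinuous₂ M (fun A B => by
    have := (key A B).2
    rw [← mul_assoc] at this
    exact this)
  exact T'.continuous₂

variable [BorelSpace X] [SecondCountableTopology X] [LocallyCompactSpace X] [μ.IsAddHaarMeasure]

/-- `(ρ, σ) ↦ ∫ ψ ⟨A(· + ρ), B(· + σ)⟩` is continuous for `A, B ∈ L²` and bounded `ψ`. -/
theorem continuous_integral_mul_inner_translate {ψ : X → ℝ} {M : ℝ} (hM : ∀ x, |ψ x| ≤ M)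
    (hψ : AEStronglyMeasurable ψ μ) {A B : X → E} (hA : MemLp A 2 μ) (hB : MemLp B 2 μ) :
    Continuous fun q : X × X => ∫ x, ψ x * inner ℝ (A (x + q.1)) (B (x + q.2)) ∂μ := by
  have hτ : ∀ {A : X → E} (hA : MemLp A 2 μ) (ρ : X),
      (DomAddAct.mk ρ +ᵥ hA.toLp A : Lp E 2 μ) =ᵐ[μ] fun x => A (x + ρ) := fun {A} hA ρ => by
    rw [DomAddAct.mk_vadd_toLp]
    refine (MemLp.coeFn_toLp _).trans (ae_of_all _ fun x => ?_)
    simp [add_comm]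
  -- Translation is a continuous action on L², so both arguments of the bilinear form move
  -- continuously.
  have hc : Continuous fun q : X × X =>
      ((DomAddAct.mk q.1 +ᵥ hA.toLp A : Lp E 2 μ), (DomAddAct.mk q.2 +ᵥ hB.toLp B : Lp E 2 μ)) := by
    have h1 : Continuous fun q : X × X => DomAddAct.mk q.1 :=
      DomAddAct.continuous_mk.comp continuous_fst
    have h2 : Continuous fun q : X × X => DomAddAct.mk q.2 :=
      DomAddAct.continuous_mk.comp continuous_snd
    have : Fact ((2 : ℝ≥0∞) ≠ ∞) := ⟨by simp⟩
    exact (h1.vadd continuous_const).prodMk (h2.vadd continuous_const)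
  refine ((continuous_integral_mul_inner hM hψ).comp hc).congr fun q => ?_
  refine integral_congr_ae ?_
  filter_upwards [hτ hA q.1, hτ hB q.2] with x h1 h2
  rw [h1, h2]

-- Needed for Fubini in the averaging arguments. The integrand is dominated by half the sum of the
-- squares, whose integral in x does not depend on the shift.
omit [LocallyCompactSpace X] in
theorem integrable_prod_mul_inner_translate [NormedSpace ℝ X] [SFinite μ] {ψ : X → ℝ} {M : ℝ}
    (hM : ∀ x, |ψ x| ≤ M)
    (hψ : AEStronglyMeasurable ψ μ) {A B : X → E} (hA : MemLp A 2 μ) (hB : MemLp B 2 μ) (e : X)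
    (δ : ℝ) :
    Integrable (fun q : X × ℝ => ψ q.1 * inner ℝ (A (q.1 + q.2 • e)) (B q.1))
      (μ.prod (volume.restrict (Ioc 0 δ))) := by
  have hM0 : 0 ≤ M := (abs_nonneg _).trans (hM 0)
  have hq : Measure.QuasiMeasurePreserving (fun q : X × ℝ => q.1 + q.2 • e)
      (μ.prod (volume.restrict (Ioc 0 δ))) μ := by
    refine QuasiMeasurePreserving.prod_of_left (by fun_prop) (ae_of_all _ fun r => ?_)
    exact (measurePreserving_add_right μ (r • e)).quasiMeasurePreserving
  have hmA : AEStronglyMeasurable (fun q : X × ℝ => A (q.1 + q.2 • e))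
      (μ.prod (volume.restrict (Ioc 0 δ))) := hA.1.comp_quasiMeasurePreserving hq
  have hm : AEStronglyMeasurable (fun q : X × ℝ => ψ q.1 * inner ℝ (A (q.1 + q.2 • e)) (B q.1))
      (μ.prod (volume.restrict (Ioc 0 δ))) :=
    hψ.comp_fst.mul (hmA.inner hB.1.comp_fst)
  have hA2 : Integrable (fun x => ‖A x‖ ^ 2) μ := hA.integrable_norm_pow (by simp)
  have hB2 : Integrable (fun x => ‖B x‖ ^ 2) μ := hB.integrable_norm_pow (by simp)
  have hbd : Integrable (fun q : X × ℝ => M * ((‖A (q.1 + q.2 • e)‖ ^ 2 + ‖B q.1‖ ^ 2) / 2))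
      (μ.prod (volume.restrict (Ioc 0 δ))) := by
    have hAr : ∀ r : ℝ, Integrable (fun x => ‖A (x + r • e)‖ ^ 2) μ := fun r =>
      hA2.comp_add_right (r • e)
    refine (integrable_prod_iff' (((hmA.norm.pow 2).add
      (hB.1.comp_fst.norm.pow 2)).mul_const (1 / 2) |>.const_mul M |>.congr
        (ae_of_all _ fun q => by simp [div_eq_mul_inv]))).2 ⟨ae_of_all _ fun r =>
      (((hAr r).add hB2).div_const 2).const_mul M, ?_⟩
    have : ∀ r : ℝ, ∫ x, ‖M * ((‖A (x + r • e)‖ ^ 2 + ‖B x‖ ^ 2) / 2)‖ ∂μ =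
        M * (((∫ x, ‖A x‖ ^ 2 ∂μ) + ∫ x, ‖B x‖ ^ 2 ∂μ) / 2) := fun r => by
      have h0 : ∀ x, ‖M * ((‖A (x + r • e)‖ ^ 2 + ‖B x‖ ^ 2) / 2)‖ =
          M * ((‖A (x + r • e)‖ ^ 2 + ‖B x‖ ^ 2) / 2) := fun x => by
        rw [Real.norm_eq_abs, abs_of_nonneg (by positivity)]
      simp_rw [h0]
      rw [integral_const_mul, integral_div, integral_add (hAr r) hB2,
        integral_add_right_eq_self (fun x => ‖A x‖ ^ 2)]
    simp_rw [this]
    exact integrable_const _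
  refine hbd.mono' hm (ae_of_all _ fun q => ?_)
  rw [norm_mul, Real.norm_eq_abs]
  have h1 := norm_inner_le_norm (𝕜 := ℝ) (A (q.1 + q.2 • e)) (B q.1)
  have h2 := sq_nonneg (‖A (q.1 + q.2 • e)‖ - ‖B q.1‖)
  exact mul_le_mul (hM _) (by nlinarith) (norm_nonneg _) hM0

end Translation

/-! ### Averages over short intervals and the energy identity -/

/-- Averages over shrinking intervals of a function continuous in two parameters. -/
theorem tendsto_average_of_continuous {Φ : ℝ × ℝ → ℝ} (hΦ : Continuous Φ) :
    Tendsto (fun δ : ℝ => δ⁻¹ * ∫ ρ in (0)..δ, Φ (ρ, δ)) (𝓝[>] 0) (𝓝 (Φ (0, 0))) := by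
  rw [Metric.tendsto_nhdsWithin_nhds]
  intro η hη
  obtain ⟨r, hr, h⟩ := Metric.continuousAt_iff.1 hΦ.continuousAt (η / 2) (half_pos hη)
  refine ⟨r, hr, fun {δ} hδ hδr => ?_⟩
  have hδ0 : 0 < δ := hδ
  have hδr' : δ < r := by simpa [abs_of_pos hδ0] using hδr
  have h1 : ∫ ρ in (0)..δ, (Φ (ρ, δ) - Φ (0, 0)) = (∫ ρ in (0)..δ, Φ (ρ, δ)) - δ * Φ (0, 0) := by
    rw [intervalIntegral.integral_sub]
    · simp
    · exact (hΦ.comp (continuous_id.prodMk continuous_const)).intervalIntegrable _ _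
    · simp
  have h2 : ‖∫ ρ in (0)..δ, (Φ (ρ, δ) - Φ (0, 0))‖ ≤ η / 2 * |δ - 0| := by
    refine intervalIntegral.norm_integral_le_of_norm_le_const fun ρ hρ => ?_
    rw [uIoc_of_le hδ0.le] at hρ
    have h4 : dist (ρ, δ) ((0, 0) : ℝ × ℝ) < r := by
      rw [Prod.dist_eq]
      simp only [Real.dist_eq, sub_zero, abs_of_pos hδ0, abs_of_pos hρ.1]
      exact max_lt (hρ.2.trans_lt hδr') hδr'
    exact (h h4).le
  have h3 : δ⁻¹ * (∫ ρ in (0)..δ, Φ (ρ, δ)) - Φ (0, 0) =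
      δ⁻¹ * ∫ ρ in (0)..δ, (Φ (ρ, δ) - Φ (0, 0)) := by
    rw [h1, mul_sub, ← mul_assoc, inv_mul_cancel₀ hδ0.ne', one_mul]
  rw [Real.dist_eq, h3, abs_mul, abs_of_pos (inv_pos.2 hδ0)]
  rw [Real.norm_eq_abs, sub_zero, abs_of_pos hδ0] at h2
  calc δ⁻¹ * |∫ ρ in (0)..δ, (Φ (ρ, δ) - Φ (0, 0))| ≤ δ⁻¹ * (η / 2 * δ) := by gcongr
    _ = η / 2 := by field_simp
    _ < η := half_lt_self hη

/-- A path whose increments are tested against itself in the form `⟨w t - w r, w s⟩ = ∫ ⟨F, X s⟩`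
satisfies the energy identity. -/
theorem energy_identity {H H' : Type*} [NormedAddCommGroup H] [InnerProductSpace ℝ H]
    [NormedAddCommGroup H'] [InnerProductSpace ℝ H'] {T : ℝ} {w : ℝ → H} {F Y : ℝ → H'}
    (hw : ContinuousOn w (Icc 0 T)) (hF : MemLp F 2 (volume.restrict (Icc 0 T)))
    (hY : MemLp Y 2 (volume.restrict (Icc 0 T)))
    (hweak : ∀ᵐ s ∂volume.restrict (Icc 0 T), ∀ r ∈ Icc 0 T, ∀ t ∈ Icc 0 T,
      inner ℝ (w t - w r) (w s) = ∫ τ in r..t, inner ℝ (F τ) (Y s)) {b : ℝ} (hb : b ∈ Ico 0 T) :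
    ‖w b‖ ^ 2 - ‖w 0‖ ^ 2 = 2 * ∫ s in (0)..b, inner ℝ (F s) (Y s) := by
  obtain ⟨hb0, hbT⟩ := hb
  set F' := (Icc 0 T).indicator F with hF'
  set Y' := (Icc 0 T).indicator Y with hY'
  have hF2 : MemLp F' 2 volume := (memLp_indicator_iff_restrict measurableSet_Icc).2 hF
  have hY2 : MemLp Y' 2 volume := (memLp_indicator_iff_restrict measurableSet_Icc).2 hY
  set ψ : ℝ → ℝ := (Ioc 0 b).indicator fun _ => 1 with hψ
  have hM : ∀ x, |ψ x| ≤ 1 := fun x => by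
    by_cases h : x ∈ Ioc 0 b <;> simp [hψ, h]
  have hψm : AEStronglyMeasurable ψ volume :=
    (stronglyMeasurable_const.indicator measurableSet_Ioc).aestronglyMeasurable
  -- The increment ‖w(x+δ)‖² - ‖w(x)‖² equals ⟨w(x+δ) - w(x), w(x) + w(x+δ)⟩, so the hypothesis at
  -- the two frozen times x and x + δ expresses it as the integral over ρ in (0,δ) of ⟨F(x+ρ), Y(x)
  -- + Y(x+δ)⟩. Integrating in x over (0,b) gives the integral of Φ(·,δ) over (0,δ). Dividing by δ
  -- and letting δ tend to 0 gives Φ(0,0), by continuity of translations.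
  set Φ : ℝ × ℝ → ℝ := fun q => (∫ x, ψ x * inner ℝ (F' (x + q.1)) (Y' x)) +
    ∫ x, ψ x * inner ℝ (F' (x + q.1)) (Y' (x + q.2)) with hΦdef
  have hΦ : Continuous Φ := by
    have h1 := continuous_integral_mul_inner_translate hM hψm hF2 hY2
    refine ((h1.comp (continuous_fst.prodMk (continuous_const : Continuous fun _ => (0 : ℝ)))).congr
      fun q => ?_).add h1
    simp
  have hwn : ContinuousOn (fun t => ‖w t‖ ^ 2) (Icc 0 T) := hw.norm.pow 2
  have hint : ∀ c ∈ Icc 0 T, ∀ d ∈ Icc 0 T,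
      IntervalIntegrable (fun t => ‖w t‖ ^ 2) volume c d := fun c hc d hd =>
    (hwn.mono (uIcc_subset_Icc hc hd)).intervalIntegrable
  have hΦ0 : Φ (0, 0) = 2 * ∫ s in (0)..b, inner ℝ (F s) (Y s) := by
    have : ∫ x, ψ x * inner ℝ (F' x) (Y' x) = ∫ s in (0)..b, inner ℝ (F s) (Y s) := by
      rw [intervalIntegral.integral_of_le hb0, ← integral_indicator measurableSet_Ioc]
      refine integral_congr_ae (ae_of_all _ fun x => ?_)
      by_cases h : x ∈ Ioc 0 b
      · have hx : x ∈ Icc 0 T := ⟨h.1.le, h.2.trans hbT.le⟩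
        simp [hψ, h, hF', hY', hx]
      · simp [hψ, h]
    simp only [hΦdef, add_zero, this]
    ring
  have hlim1 := tendsto_average_of_continuous hΦ
  rw [hΦ0] at hlim1
  refine tendsto_nhds_unique ?_ hlim1
  -- the averages are difference quotients of primitives of `‖w‖²`
  have hder : ∀ c ∈ Ico 0 T, Tendsto (fun δ : ℝ => δ⁻¹ * ∫ t in c..(c + δ), ‖w t‖ ^ 2)
      (𝓝[>] 0) (𝓝 (‖w c‖ ^ 2)) := by
    intro c hc
    have h1 : HasDerivWithinAt (fun u => ∫ t in c..u, ‖w t‖ ^ 2) (‖w c‖ ^ 2) (Ici c) c := by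
      have hcw : ContinuousWithinAt (fun t => ‖w t‖ ^ 2) (Ioi c) c :=
        ((hwn c ⟨hc.1, hc.2.le⟩).mono_of_mem_nhdsWithin
          (mem_of_superset (Ioo_mem_nhdsGT hc.2) fun x hx => ⟨hc.1.trans hx.1.le, hx.2.le⟩))
      refine intervalIntegral.integral_hasDerivWithinAt_right (by simp) ?_ hcw
      refine ⟨Ioo c T, Ioo_mem_nhdsGT hc.2, ?_⟩
      exact ((hwn.mono fun x hx => ⟨hc.1.trans hx.1.le, hx.2.le⟩).aestronglyMeasurable
        measurableSet_Ioo)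
    have h2 := (hasDerivWithinAt_iff_tendsto_slope' (by simp)).1
      (h1.mono Ioi_subset_Ici_self)
    have h3 : Tendsto (fun δ : ℝ => c + δ) (𝓝[>] 0) (𝓝[>] c) := by
      refine tendsto_nhdsWithin_iff.2 ⟨?_, ?_⟩
      · have : Tendsto (fun δ : ℝ => c + δ) (𝓝 0) (𝓝 (c + 0)) :=
          (continuous_const.add continuous_id).tendsto 0
        rw [add_zero] at this
        exact this.mono_left nhdsWithin_le_nhds
      · filter_upwards [self_mem_nhdsWithin] with δ hδ
        simpa using hδ
    refine (h2.comp h3).congr fun δ => ?_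
    simp [slope, Function.comp]
  have hlim2 := (hder b ⟨hb0, hbT⟩).sub (hder 0 ⟨le_rfl, hb0.trans_lt hbT⟩)
  refine hlim2.congr' ?_
  filter_upwards [Ioo_mem_nhdsGT (sub_pos.2 hbT)] with δ hδ
  have hδ0 : 0 < δ := hδ.1
  have hbδ : b + δ < T := by linarith [hδ.2]
  rw [← mul_sub]
  congr 1
  have h0T : (0 : ℝ) ∈ Icc 0 T := ⟨le_rfl, (hb0.trans_lt hbT).le⟩
  have hbm : b ∈ Icc 0 T := ⟨hb0, hbT.le⟩
  have hδm : δ ∈ Icc 0 T := ⟨hδ0.le, by linarith⟩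
  have hbδm : b + δ ∈ Icc 0 T := ⟨by linarith, hbδ.le⟩
  -- Shifting by δ, the contributions of the overlap [δ, b] cancel and only the two end intervals
  -- remain. Strict inequality b < T leaves room for b + δ.
  have e1 : (∫ t in b..(b + δ), ‖w t‖ ^ 2) - ∫ t in (0)..(0 + δ), ‖w t‖ ^ 2 =
      ∫ t in (0)..b, (‖w (t + δ)‖ ^ 2 - ‖w t‖ ^ 2) := by
    rw [intervalIntegral.integral_sub, intervalIntegral.integral_comp_add_right
      (fun t => ‖w t‖ ^ 2), zero_add]
    · have a1 := intervalIntegral.integral_add_adjacent_intervals (hint 0 h0T b hbm)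
        (hint b hbm _ hbδm)
      have a2 := intervalIntegral.integral_add_adjacent_intervals (hint 0 h0T δ hδm)
        (hint δ hδm _ hbδm)
      linarith
    · have := (hint δ hδm _ hbδm).comp_add_right δ
      simpa using this
    · exact hint 0 h0T b hbm
  rw [e1]
  -- the pointwise identity
  have hgood : ∀ᵐ s ∂volume, s ∈ Icc 0 T → ∀ r ∈ Icc 0 T, ∀ t ∈ Icc 0 T,
      inner ℝ (w t - w r) (w s) = ∫ τ in r..t, inner ℝ (F τ) (Y s) :=
    (ae_restrict_iff' measurableSet_Icc).1 hweak
  have hgood' := (measurePreserving_add_right volume δ).quasiMeasurePreserving.ae hgood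
  have hI1 := integrable_prod_mul_inner_translate hM hψm hF2 hY2 1 δ
  have hYδ : MemLp (fun x => Y' (x + δ)) 2 volume :=
    hY2.comp_measurePreserving (measurePreserving_add_right volume δ)
  have hI2 := integrable_prod_mul_inner_translate hM hψm hF2 hYδ 1 δ
  simp only [smul_eq_mul, mul_one] at hI1 hI2
  have hΦi : ∫ ρ in (0)..δ, Φ (ρ, δ) = ∫ x, ∫ ρ in (0)..δ, (ψ x * inner ℝ (F' (x + ρ)) (Y' x) +
      ψ x * inner ℝ (F' (x + ρ)) (Y' (x + δ))) := by
    simp_rw [intervalIntegral.integral_of_le hδ0.le]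
    rw [integral_integral_swap (hI1.add hI2)]
    refine integral_congr_ae ?_
    filter_upwards [hI1.prod_left_ae, hI2.prod_left_ae] with ρ h1 h2
    exact (integral_add h1 h2).symm
  rw [hΦi, intervalIntegral.integral_of_le hb0, ← integral_indicator measurableSet_Ioc]
  refine integral_congr_ae ?_
  filter_upwards [hgood, hgood', hI1.prod_right_ae, hI2.prod_right_ae] with x h1 h2 h3 h4
  by_cases hx : x ∈ Ioc 0 b
  · have hxT : x ∈ Icc 0 T := ⟨hx.1.le, hx.2.trans hbT.le⟩
    have hxδ : x + δ ∈ Icc 0 T := ⟨by linarith [hx.1], by linarith [hx.2]⟩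
    rw [indicator_of_mem hx, intervalIntegral.integral_add]
    · have g1 := h1 hxT x hxT (x + δ) hxδ
      have g2 := h2 hxδ x hxT (x + δ) hxδ
      have conv : ∀ y : H', ∫ τ in x..(x + δ), inner ℝ (F τ) y =
          ∫ ρ in (0)..δ, inner ℝ (F' (x + ρ)) y := fun y => by
        rw [intervalIntegral.integral_comp_add_left (fun τ => inner ℝ (F' τ) y), add_zero]
        refine intervalIntegral.integral_congr fun τ hτ => ?_
        have : τ ∈ Icc 0 T := uIcc_subset_Icc hxT hxδ hτ
        simp only [hF', indicator_of_mem this]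
      have p1 : ψ x = 1 := by simp [hψ, hx]
      simp only [p1, one_mul]
      rw [conv] at g1 g2
      have q1 : Y' x = Y x := by simp [hY', hxT]
      have q2 : Y' (x + δ) = Y (x + δ) := by rw [hY', indicator_of_mem hxδ]
      rw [q1, q2, ← g1, ← g2]
      rw [inner_sub_left, inner_sub_left, real_inner_self_eq_norm_sq, real_inner_self_eq_norm_sq,
        real_inner_comm (w x) (w (x + δ))]
      ring
    · exact (intervalIntegrable_iff_integrableOn_Ioc_of_le hδ0.le).2 h3
    · exact (intervalIntegrable_iff_integrableOn_Ioc_of_le hδ0.le).2 h4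
  · rw [indicator_of_notMem hx]
    have p1 : ψ x = 0 := by simp [hψ, hx]
    simp [p1]

/-! ### Weak directional derivatives on open subsets of the plane -/

/-- `G` is the weak derivative of `F` on `U` in the direction `a`. -/
def WeakDeriv (U : Set Plane) (a : Plane) (F G : Plane → ℝ) : Prop :=
  ∀ φ : Plane → ℝ, ContDiff ℝ (⊤ : ℕ∞) φ → HasCompactSupport φ → tsupport φ ⊆ U →
    ∫ x, F x * fderiv ℝ φ x a = -∫ x, G x * φ x

theorem WeakDeriv.congr_on {U V : Set Plane} {a : Plane} {F G F' G' : Plane → ℝ}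
    (h : WeakDeriv U a F G) (hVU : V ⊆ U) (hF : ∀ᵐ x, x ∈ V → F' x = F x)
    (hG : ∀ᵐ x, x ∈ V → G' x = G x) : WeakDeriv V a F' G' := by
  intro φ h1 h2 h3
  have := h φ h1 h2 (h3.trans hVU)
  have e1 : ∫ x, F' x * fderiv ℝ φ x a = ∫ x, F x * fderiv ℝ φ x a := by
    refine integral_congr_ae ?_
    filter_upwards [hF] with x hx
    by_cases hxV : x ∈ V
    · rw [hx hxV]
    · have : fderiv ℝ φ x = 0 := image_eq_zero_of_notMem_tsupport
        fun hn => hxV (h3 (tsupport_fderiv_subset ℝ hn))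
      simp [this]
  have e2 : ∫ x, G' x * φ x = ∫ x, G x * φ x := by
    refine integral_congr_ae ?_
    filter_upwards [hG] with x hx
    by_cases hxV : x ∈ V
    · rw [hx hxV]
    · have : φ x = 0 := image_eq_zero_of_notMem_tsupport fun hn => hxV (h3 hn)
      simp [this]
  rw [e1, e2, this]

theorem continuous_fderiv_dir {φ : Plane → ℝ} (h : ContDiff ℝ (⊤ : ℕ∞) φ) (a : Plane) :
    Continuous fun x => fderiv ℝ φ x a :=
  (h.continuous_fderiv (by simp)).clm_apply continuous_const

theorem exists_bound_of_hasCompactSupport {φ : Plane → ℝ} (h : ContDiff ℝ (⊤ : ℕ∞) φ)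
    (hc : HasCompactSupport φ) (a : Plane) :
    ∃ M, ∀ x, |φ x| ≤ M ∧ |fderiv ℝ φ x a| ≤ M := by
  obtain ⟨M1, h1⟩ := h.continuous.bounded_above_of_compact_support hc
  obtain ⟨M2, h2⟩ := (continuous_fderiv_dir h a).bounded_above_of_compact_support
    (hc.fderiv_apply (𝕜 := ℝ) a)
  exact ⟨max M1 M2, fun x => ⟨(h1 x).trans (le_max_left _ _), (h2 x).trans (le_max_right _ _)⟩⟩

theorem integrable_mul_test {F φ : Plane → ℝ} (hF : Integrable F) (h : Continuous φ) {M : ℝ}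
    (hM : ∀ x, |φ x| ≤ M) : Integrable fun x => F x * φ x :=
  hF.mul_bdd (c := M) h.aestronglyMeasurable (ae_of_all _ hM)

theorem WeakDeriv.linear_comb {U : Set Plane} {a b : Plane} {F G H : Plane → ℝ}
    (hF : Integrable F) (hG : Integrable G) (hH : Integrable H)
    (h1 : WeakDeriv U a F G) (h2 : WeakDeriv U b F H) (s t : ℝ) :
    WeakDeriv U (s • a + t • b) F (fun x => s * G x + t * H x) := by
  intro φ c1 c2 c3
  obtain ⟨M, hM⟩ := exists_bound_of_hasCompactSupport c1 c2 a
  obtain ⟨M', hM'⟩ := exists_bound_of_hasCompactSupport c1 c2 b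
  have i1 := integrable_mul_test hF (continuous_fderiv_dir c1 a) fun x => (hM x).2
  have i2 := integrable_mul_test hF (continuous_fderiv_dir c1 b) fun x => (hM' x).2
  have i3 := integrable_mul_test hG c1.continuous fun x => (hM x).1
  have i4 := integrable_mul_test hH c1.continuous fun x => (hM x).1
  have e1 : ∀ x, F x * fderiv ℝ φ x (s • a + t • b) =
      s * (F x * fderiv ℝ φ x a) + t * (F x * fderiv ℝ φ x b) := fun x => by
    simp only [map_add, map_smul, smul_eq_mul]; ring
  have e2 : ∀ x, (s * G x + t * H x) * φ x = s * (G x * φ x) + t * (H x * φ x) := fun x => by ring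
  simp_rw [e1, e2]
  rw [integral_add (i1.const_mul s) (i2.const_mul t),
      integral_add (i3.const_mul s) (i4.const_mul t),
    integral_const_mul, integral_const_mul, integral_const_mul, integral_const_mul,
    h1 φ c1 c2 c3, h2 φ c1 c2 c3]
  ring

/-! ### Integration along segments and the product rule -/

theorem integrable_prod_translate {G : Plane → ℝ} (hG : Integrable G) (a : Plane) (h : ℝ) :
    Integrable (fun q : Plane × ℝ => G (q.1 + q.2 • a)) (volume.prod (volume.restrict (Ioc 0 h))) := by
  have hq : Measure.QuasiMeasurePreserving (fun q : Plane × ℝ => q.1 + q.2 • a)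
      (volume.prod (volume.restrict (Ioc 0 h))) volume := by
    refine MeasureTheory.QuasiMeasurePreserving.prod_of_left (by fun_prop) (ae_of_all _ fun r => ?_)
    exact (measurePreserving_add_right volume (r • a)).quasiMeasurePreserving
  refine (integrable_prod_iff' (hG.1.comp_quasiMeasurePreserving hq)).2
    ⟨ae_of_all _ fun r => hG.comp_add_right (r • a), ?_⟩
  have : ∀ r : ℝ, ∫ x, ‖G (x + r • a)‖ = ∫ x, ‖G x‖ := fun r =>
    integral_add_right_eq_self (fun x => ‖G x‖) (r • a)
  simp only [Function.comp_def, this]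
  exact integrable_const _

theorem hasDerivAt_integral_translate {F φ : Plane → ℝ} (hF : Integrable F)
    (h1 : ContDiff ℝ (⊤ : ℕ∞) φ) (h2 : HasCompactSupport φ) (a : Plane) (s : ℝ) :
    HasDerivAt (fun s : ℝ => ∫ x, F x * φ (x - s • a))
      (-∫ x, F x * fderiv ℝ φ (x - s • a) a) s := by
  obtain ⟨M, hM⟩ := exists_bound_of_hasCompactSupport h1 h2 a
  have hφc : Continuous φ := h1.continuous
  have hd : ∀ x : Plane, ∀ r : ℝ, HasDerivAt (fun r : ℝ => F x * φ (x - r • a))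
      (-(F x * fderiv ℝ φ (x - r • a) a)) r := fun x r => by
    have e1 : HasDerivAt (fun r : ℝ => x - r • a) (-a) r := by
      simpa using ((hasDerivAt_id r).smul_const a).const_sub x
    have e2 := ((h1.differentiable (by simp)) (x - r • a)).hasFDerivAt.comp_hasDerivAt r e1
    have e3 := e2.const_mul (F x)
    simpa using e3
  have key := hasDerivAt_integral_of_dominated_loc_of_deriv_le (μ := volume)
    (F := fun r x => F x * φ (x - r • a)) (F' := fun r x => -(F x * fderiv ℝ φ (x - r • a) a))
    (x₀ := s) (s := univ) (bound := fun x => |F x| * M) univ_mem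
    (Eventually.of_forall fun r => hF.1.mul
      (by fun_prop : Continuous fun x => φ (x - r • a)).aestronglyMeasurable)
    (integrable_mul_test hF (h1.continuous.comp (continuous_id.sub continuous_const))
      fun x => (hM _).1)
    ((hF.1.mul ((continuous_fderiv_dir h1 a).comp
      (continuous_id.sub continuous_const)).aestronglyMeasurable).neg)
    (ae_of_all _ fun x r _ => by
      rw [norm_neg, norm_mul, Real.norm_eq_abs, Real.norm_eq_abs]
      exact mul_le_mul_of_nonneg_left (hM _).2 (abs_nonneg _))
    (hF.abs.mul_const M) (ae_of_all _ fun x r _ => hd x r)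
  have hv := key.2
  rw [integral_neg] at hv
  exact hv

/-- Test functions translated along a segment: the pairing with `F` is differentiable, with
derivative the pairing with the weak derivative. -/
theorem WeakDeriv.hasDerivAt_translate {U : Set Plane} {a : Plane} {F G : Plane → ℝ}
    (hF : Integrable F) (hFG : WeakDeriv U a F G) {φ : Plane → ℝ}
    (h1 : ContDiff ℝ (⊤ : ℕ∞) φ) (h2 : HasCompactSupport φ) {s : ℝ}
    (h3 : ∀ x ∈ tsupport φ, x + s • a ∈ U) :
    HasDerivAt (fun s : ℝ => ∫ x, F x * φ (x - s • a)) (∫ x, G x * φ (x - s • a)) s := by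
  have ht := hFG (fun x => φ (x - s • a)) (h1.comp (contDiff_id.sub contDiff_const))
    (h2.comp_homeomorph (Homeomorph.subRight (s • a))) (by
      intro x hx
      have : x - s • a ∈ tsupport φ := by
        have := tsupport_comp_subset_preimage φ (f := fun x : Plane => x - s • a)
          (continuous_id.sub continuous_const) hx
        exact this
      simpa using h3 _ this)
  have e : ∀ x, fderiv ℝ (fun x => φ (x - s • a)) x = fderiv ℝ φ (x - s • a) := fun x =>
    fderiv_comp_sub _
  simp_rw [e] at ht
  have hv := hasDerivAt_integral_translate hF h1 h2 a s
  rw [ht, neg_neg] at hv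
  exact hv

theorem continuous_integral_translate {G φ : Plane → ℝ} (hG : Integrable G) (h1 : Continuous φ)
    {M : ℝ} (hM : ∀ x, |φ x| ≤ M) (a : Plane) :
    Continuous fun s : ℝ => ∫ x, G x * φ (x - s • a) := by
  refine continuous_of_dominated (bound := fun x => |G x| * M) (fun s => hG.1.mul
    (h1.comp (continuous_id.sub continuous_const)).aestronglyMeasurable) (fun s => ?_)
    (hG.abs.mul_const M) (ae_of_all _ fun x => ?_)
  · refine ae_of_all _ fun x => ?_
    rw [norm_mul, Real.norm_eq_abs, Real.norm_eq_abs]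
    exact mul_le_mul_of_nonneg_left (hM _) (abs_nonneg _)
  · exact continuous_const.mul
      (h1.comp (continuous_const.sub (continuous_id.smul continuous_const)))

/-- Weak derivatives integrate along segments, with an affine weight. -/
theorem WeakDeriv.ae_line_identity {U O : Set Plane} (hO : IsOpen O) {a : Plane}
    {F G : Plane → ℝ} (hF : Integrable F) (hG : Integrable G) (hFG : WeakDeriv U a F G) {h : ℝ}
    (hh : 0 ≤ h) (hOU : ∀ x ∈ O, ∀ s ∈ Icc 0 h, x + s • a ∈ U) (α β : ℝ) :
    ∀ᵐ x, x ∈ O → α * F x = (α + β * h) * F (x + h • a) - β * (∫ s in Ioc 0 h, F (x + s • a)) -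
      ∫ s in Ioc 0 h, (α + β * s) * G (x + s • a) := by
  have pF := integrable_prod_translate hF a h
  have pG : Integrable (fun q : Plane × ℝ => (α + β * q.2) * G (q.1 + q.2 • a))
      (volume.prod (volume.restrict (Ioc 0 h))) := by
    refine (integrable_prod_translate hG a h).bdd_mul (c := |α| + |β| * h)
      (by fun_prop) ?_
    have : ∀ᵐ q : Plane × ℝ ∂(volume.prod (volume.restrict (Ioc 0 h))), q.2 ∈ Ioc 0 h :=
      Measure.quasiMeasurePreserving_snd.ae (ae_restrict_mem measurableSet_Ioc)
    filter_upwards [this] with q hq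
    calc ‖α + β * q.2‖ ≤ |α| + |β * q.2| := abs_add_le _ _
      _ = |α| + |β| * q.2 := by rw [abs_mul, abs_of_pos hq.1]
      _ ≤ _ := by gcongr; exact hq.2
  have iF := pF.integral_prod_left
  have iG := pG.integral_prod_left
  have iFh : Integrable fun x => F (x + h • a) := hF.comp_add_right (h • a)
  have iR : Integrable fun x => α * F x - ((α + β * h) * F (x + h • a) -
      β * (∫ s in Ioc 0 h, F (x + s • a)) - ∫ s in Ioc 0 h, (α + β * s) * G (x + s • a)) :=
    (hF.const_mul α).sub (((iFh.const_mul _).sub (iF.const_mul β)).sub iG)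
  -- The identity is tested against φ supported in O. Moving the translation from F to φ leaves a
  -- function j of the single variable s, which is differentiable with derivative k because the
  -- shifted support stays in U. The claim becomes an ordinary integration by parts of (α + βs)
  -- against k.
  have main := hO.ae_eq_zero_of_integral_contDiff_smul_eq_zero
    (iR.locallyIntegrable.locallyIntegrableOn O) (fun φ h1 h2 h3 => ?_)
  · filter_upwards [main] with x hx hxO
    exact sub_eq_zero.1 (hx hxO)
  obtain ⟨M, hM⟩ := exists_bound_of_hasCompactSupport h1 h2 a
  have hM1 : ∀ x, |φ x| ≤ M := fun x => (hM x).1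
  set j : ℝ → ℝ := fun s => ∫ x, F x * φ (x - s • a) with hj
  set k : ℝ → ℝ := fun s => ∫ x, G x * φ (x - s • a) with hk
  have hjd : ∀ s ∈ uIcc 0 h, HasDerivAt j (k s) s := fun s hs => by
    rw [uIcc_of_le hh] at hs
    exact hFG.hasDerivAt_translate hF h1 h2 fun x hx => hOU x (h3 hx) s hs
  have hkc : Continuous k := continuous_integral_translate hG h1.continuous hM1 a
  have hjc : Continuous j := continuous_integral_translate hF h1.continuous hM1 a
  have ibp : ∫ s in (0)..h, (α + β * s) * k s = (α + β * h) * j h - (α + β * 0) * j 0 -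
      ∫ s in (0)..h, β * j s :=
    intervalIntegral.integral_mul_deriv_eq_deriv_mul (u := fun s => α + β * s) (u' := fun _ => β)
      (fun s _ => by simpa using ((hasDerivAt_id s).const_mul β).const_add α) hjd
      (by simp) (hkc.intervalIntegrable _ _)
  rw [intervalIntegral.integral_of_le hh, intervalIntegral.integral_of_le hh] at ibp
  have shift : ∀ (K : Plane → ℝ) (s : ℝ), ∫ x, φ x * K (x + s • a) = ∫ x, K x * φ (x - s • a) :=
    fun K s => by
      rw [← integral_add_right_eq_self (fun x => K x * φ (x - s • a)) (s • a)]
      refine integral_congr_ae (ae_of_all _ fun x => ?_)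
      simp [mul_comm]
  have t1 : Integrable fun x => φ x * F x :=
    (integrable_mul_test hF h1.continuous hM1).congr (ae_of_all _ fun x => mul_comm _ _)
  have t2 : Integrable fun x => φ x * F (x + h • a) :=
    (integrable_mul_test iFh h1.continuous hM1).congr (ae_of_all _ fun x => mul_comm _ _)
  have q3 : Integrable (fun q : Plane × ℝ => φ q.1 * F (q.1 + q.2 • a))
      (volume.prod (volume.restrict (Ioc 0 h))) :=
    pF.bdd_mul (c := M) (h1.continuous.comp continuous_fst).aestronglyMeasurable
      (ae_of_all _ fun q => hM1 _)
  have q4 : Integrable (fun q : Plane × ℝ => φ q.1 * ((α + β * q.2) * G (q.1 + q.2 • a)))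
      (volume.prod (volume.restrict (Ioc 0 h))) :=
    pG.bdd_mul (c := M) (h1.continuous.comp continuous_fst).aestronglyMeasurable
      (ae_of_all _ fun q => hM1 _)
  have t3 : Integrable fun x => φ x * ∫ s in Ioc 0 h, F (x + s • a) :=
    q3.integral_prod_left.congr (ae_of_all _ fun x =>
      integral_const_mul (μ := volume.restrict (Ioc 0 h)) (φ x) _)
  have t4 : Integrable fun x => φ x * ∫ s in Ioc 0 h, (α + β * s) * G (x + s • a) :=
    q4.integral_prod_left.congr (ae_of_all _ fun x =>
      integral_const_mul (μ := volume.restrict (Ioc 0 h)) (φ x) _)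
  have f3 : ∫ x, φ x * ∫ s in Ioc 0 h, F (x + s • a) = ∫ s in Ioc 0 h, j s := by
    simp_rw [← integral_const_mul]
    rw [integral_integral_swap q3]
    simp_rw [shift]
    rfl
  have f4 : ∫ x, φ x * ∫ s in Ioc 0 h, (α + β * s) * G (x + s • a) =
      ∫ s in Ioc 0 h, (α + β * s) * k s := by
    simp_rw [← integral_const_mul]
    rw [integral_integral_swap q4]
    refine integral_congr_ae (ae_of_all _ fun s => ?_)
    simp only
    rw [show k s = _ from (shift G s).symm, ← integral_const_mul]
    refine integral_congr_ae (ae_of_all _ fun x => ?_)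
    simp only; ring
  have f1 : ∫ x, φ x * F x = j 0 := by simp [hj, mul_comm]
  have f2 : ∫ x, φ x * F (x + h • a) = j h := shift F h
  have e : ∀ x, φ x • (α * F x - ((α + β * h) * F (x + h • a) -
      β * (∫ s in Ioc 0 h, F (x + s • a)) - ∫ s in Ioc 0 h, (α + β * s) * G (x + s • a))) =
      α * (φ x * F x) - ((α + β * h) * (φ x * F (x + h • a)) -
      β * (φ x * ∫ s in Ioc 0 h, F (x + s • a)) -
      φ x * ∫ s in Ioc 0 h, (α + β * s) * G (x + s • a)) := fun x => by
    rw [smul_eq_mul]; ring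
  simp_rw [e]
  have r1 : Integrable fun x => (α + β * h) * (φ x * F (x + h • a)) -
      β * (φ x * ∫ s in Ioc 0 h, F (x + s • a)) := (t2.const_mul _).sub (t3.const_mul β)
  have r2 : Integrable fun x => (α + β * h) * (φ x * F (x + h • a)) -
      β * (φ x * ∫ s in Ioc 0 h, F (x + s • a)) -
      φ x * ∫ s in Ioc 0 h, (α + β * s) * G (x + s • a) := r1.sub t4
  rw [integral_sub (t1.const_mul α) r2, integral_sub r1 t4,
    integral_sub (t2.const_mul _) (t3.const_mul β), integral_const_mul, integral_const_mul,
    integral_const_mul, f1, f2, f3, f4]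
  rw [integral_const_mul] at ibp
  linarith

/-- A weakly differentiable function is bounded by averages over segments. -/
theorem WeakDeriv.ae_enorm_le {U O : Set Plane} (hO : IsOpen O) {a : Plane}
    {F G : Plane → ℝ} (hF : Integrable F) (hG : Integrable G) (hFG : WeakDeriv U a F G) {h : ℝ}
    (hh : 0 < h) (hOU : ∀ x ∈ O, ∀ s ∈ Icc 0 h, x + s • a ∈ U) :
    ∀ᵐ x, x ∈ O → ‖F x‖ₑ ≤ ∫⁻ s in Ioc 0 h,
      (ENNReal.ofReal h⁻¹ * ‖F (x + s • a)‖ₑ + ‖G (x + s • a)‖ₑ) := by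
  have pF := (integrable_prod_translate hF a h).prod_right_ae
  filter_upwards [hFG.ae_line_identity hO hF hG hh.le hOU 1 (-h⁻¹), pF] with x hx hxF hxO
  have e := hx hxO
  -- The weight 1 - s/h vanishes at the far end of the segment, so F(x) is expressed through
  -- averages only.
  have z : (1 : ℝ) + -h⁻¹ * h = 0 := by field_simp; ring
  rw [z, one_mul, zero_mul, zero_sub] at e
  rw [e, neg_mul, neg_neg]
  refine (enorm_sub_le).trans ?_
  rw [lintegral_add_left' (by exact (hxF.1.enorm.const_mul _)),
    lintegral_const_mul'' _ hxF.1.enorm]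
  refine add_le_add ?_ ?_
  · rw [enorm_mul, Real.enorm_eq_ofReal (inv_nonneg.2 hh.le)]
    gcongr
    exact enorm_integral_le_lintegral_enorm _
  · refine (enorm_integral_le_lintegral_enorm _).trans ?_
    refine setLIntegral_mono' measurableSet_Ioc fun s hs => ?_
    rw [enorm_mul]
    refine mul_le_of_le_one_left zero_le ?_
    rw [Real.enorm_eq_ofReal_abs, ENNReal.ofReal_le_one, abs_le]
    have : h⁻¹ * s ≤ 1 := by rw [inv_mul_le_iff₀ hh, mul_one]; exact hs.2
    have : 0 ≤ h⁻¹ * s := by have := hs.1; positivity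
    constructor <;> linarith

theorem integral_mul_translate {F φ : Plane → ℝ} (v : Plane) :
    ∫ x, F x * φ (x - v) = ∫ x, φ x * F (x + v) := by
  rw [← integral_add_right_eq_self (fun x => F x * φ (x - v)) v]
  refine integral_congr_ae (ae_of_all _ fun x => ?_)
  simp [mul_comm]

/-- The product rule for weak derivatives of functions in `L²`. -/
theorem WeakDeriv.mul {U : Set Plane} (hU : IsOpen U) {a : Plane} {F G F' G' : Plane → ℝ}
    (hF : Integrable F) (hF' : Integrable F') (hG : Integrable G) (hG' : Integrable G')
    (hF2 : MemLp F 2) (hF2' : MemLp F' 2) (hG2 : MemLp G 2) (hG2' : MemLp G' 2)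
    (h1 : WeakDeriv U a F F') (h2 : WeakDeriv U a G G') :
    WeakDeriv U a (fun x => F x * G x) (fun x => F' x * G x + F x * G' x) := by
  intro φ c1 c2 c3
  obtain ⟨M, hM'⟩ := exists_bound_of_hasCompactSupport c1 c2 a
  have hM : ∀ x, |φ x| ≤ M := fun x => (hM' x).1
  have hφm : AEStronglyMeasurable φ volume := c1.continuous.aestronglyMeasurable
  obtain ⟨δ, hδ, hδU⟩ := c2.isCompact.exists_thickening_subset_open hU c3
  set O := Metric.thickening (δ / 2) (tsupport φ) with hOdef
  have hO : IsOpen O := Metric.isOpen_thickening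
  have hφO : tsupport φ ⊆ O := Metric.self_subset_thickening (half_pos hδ) _
  have hOU : ∀ s : ℝ, 0 ≤ s → s * ‖a‖ ≤ δ / 2 → ∀ x ∈ O, x + s • a ∈ U := by
    intro s hs hsa x hx
    apply hδU
    obtain ⟨z, hz, hxz⟩ := Metric.mem_thickening_iff.1 hx
    refine Metric.mem_thickening_iff.2 ⟨z, hz, ?_⟩
    calc dist (x + s • a) z ≤ dist (x + s • a) x + dist x z := dist_triangle _ _ _
      _ = s * ‖a‖ + dist x z := by
        rw [dist_eq_norm, add_sub_cancel_left, norm_smul, Real.norm_eq_abs, abs_of_nonneg hs]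
      _ < δ := by linarith
  have hFG : Integrable fun x => F x * G x := hF2.integrable_mul hG2
  set I : ℝ → ℝ := fun s => ∫ x, F x * G x * φ (x - s • a) with hI
  have hId : HasDerivAt I (-∫ x, F x * G x * fderiv ℝ φ x a) 0 := by
    have := hasDerivAt_integral_translate hFG c1 c2 a 0
    simpa using this
  -- Discrete Leibniz rule: the increment of FG over sa is the increment of F times the shifted G
  -- plus F times the increment of G. Each increment is an integral of the weak derivative along the
  -- segment, so the difference quotient is an average of Φ, which is continuous because
  -- translations are.
  set Φ : ℝ × ℝ → ℝ := fun q => (∫ x, φ x * inner ℝ (F' (x + q.1 • a)) (G (x + q.2 • a))) +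
    ∫ x, φ x * inner ℝ (G' (x + q.1 • a)) (F x) with hΦ
  have hΦc : Continuous Φ := by
    have e1 := continuous_integral_mul_inner_translate hM hφm hF2' hG2
    have e2 := continuous_integral_mul_inner_translate hM hφm hG2' hF2
    refine (e1.comp (f := fun q : ℝ × ℝ => (q.1 • a, q.2 • a)) (by fun_prop)).add
      ((e2.comp (f := fun q : ℝ × ℝ => (q.1 • a, (0 : Plane))) (by fun_prop)).congr fun q => ?_)
    simp
  have i1 := hF2'.integrable_mul hG2
  have i2 := hF2.integrable_mul hG2'
  have hΦ0 : Φ (0, 0) = ∫ x, (F' x * G x + F x * G' x) * φ x := by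
    have j1 : Integrable fun x => F' x * G x * φ x := integrable_mul_test i1 c1.continuous hM
    have j2 : Integrable fun x => F x * G' x * φ x := integrable_mul_test i2 c1.continuous hM
    simp_rw [add_mul]
    rw [integral_add j1 j2]
    simp only [hΦ, zero_smul, add_zero, RCLike.inner_apply, conj_trivial]
    congr 1 <;> exact integral_congr_ae (ae_of_all _ fun x => by simp only; ring)
  have hlim1 := tendsto_average_of_continuous hΦc
  have hlim2 : Tendsto (fun δ : ℝ => δ⁻¹ * (I δ - I 0)) (𝓝[>] 0)
      (𝓝 (-∫ x, F x * G x * fderiv ℝ φ x a)) := by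
    have h := (hasDerivWithinAt_iff_tendsto_slope' (by simp)).1 (hId.hasDerivWithinAt (s := Ioi 0))
    refine h.congr fun δ => ?_
    simp [slope]
  have hδ1 : ∃ r > 0, r * ‖a‖ ≤ δ / 2 := by
    refine ⟨δ / 2 / (‖a‖ + 1), by positivity, ?_⟩
    rw [div_mul_eq_mul_div, div_le_iff₀ (by positivity)]
    nlinarith [norm_nonneg a]
  obtain ⟨r, hr, hra⟩ := hδ1
  have key : -∫ x, F x * G x * fderiv ℝ φ x a = Φ (0, 0) := by
    refine tendsto_nhds_unique hlim2 (hlim1.congr' ?_)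
    filter_upwards [Ioo_mem_nhdsGT hr] with s hs
    congr 1
    have hs0 : 0 < s := hs.1
    have hsU : ∀ x ∈ O, ∀ t ∈ Icc 0 s, x + t • a ∈ U := fun x hx t ht => by
      refine hOU t ht.1 (le_trans ?_ hra) x hx
      exact mul_le_mul_of_nonneg_right (ht.2.trans hs.2.le) (norm_nonneg _)
    have hGs : MemLp (fun x => G (x + s • a)) 2 volume :=
      hG2.comp_measurePreserving (measurePreserving_add_right volume (s • a))
    have p1 := integrable_prod_mul_inner_translate hM hφm hF2' hGs a s
    have p2 := integrable_prod_mul_inner_translate hM hφm hG2' hF2 a s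
    rw [intervalIntegral.integral_of_le hs0.le]
    have e1 : ∫ ρ in Ioc 0 s, Φ (ρ, s) = ∫ x, ∫ ρ in Ioc 0 s,
        (φ x * inner ℝ (F' (x + ρ • a)) (G (x + s • a)) +
          φ x * inner ℝ (G' (x + ρ • a)) (F x)) := by
      rw [integral_integral_swap (p1.add p2)]
      refine integral_congr_ae ?_
      filter_upwards [p1.prod_left_ae, p2.prod_left_ae] with ρ q1 q2
      exact (integral_add q1 q2).symm
    have hIs : I s = ∫ x, φ x * (F (x + s • a) * G (x + s • a)) := integral_mul_translate _
    have hI0 : I 0 = ∫ x, φ x * (F x * G x) := by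
      simp only [hI, zero_smul, sub_zero]
      exact integral_congr_ae (ae_of_all _ fun x => mul_comm _ _)
    have k1 : Integrable fun x => φ x * (F (x + s • a) * G (x + s • a)) :=
      (hFG.comp_add_right (s • a)).bdd_mul hφm (ae_of_all _ hM)
    have k2 : Integrable fun x => φ x * (F x * G x) := hFG.bdd_mul hφm (ae_of_all _ hM)
    rw [e1, hIs, hI0, ← integral_sub k1 k2]
    refine integral_congr_ae ?_
    filter_upwards [h1.ae_line_identity hO hF hF' hs0.le hsU 1 0,
      h2.ae_line_identity hO hG hG' hs0.le hsU 1 0, p1.prod_right_ae, p2.prod_right_ae]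
      with x l1 l2 q1 q2
    by_cases hx : x ∈ O
    · have l1 := l1 hx
      have l2 := l2 hx
      simp only [zero_mul, add_zero, one_mul, sub_zero] at l1 l2
      rw [integral_add q1 q2, integral_const_mul, integral_const_mul]
      simp only [RCLike.inner_apply, conj_trivial]
      rw [integral_const_mul, integral_const_mul]
      have l1' : ∫ ρ in Ioc 0 s, F' (x + ρ • a) = F (x + s • a) - F x := by linarith
      have l2' : ∫ ρ in Ioc 0 s, G' (x + ρ • a) = G (x + s • a) - G x := by linarith
      rw [l1', l2']
      ring
    · have : φ x = 0 := image_eq_zero_of_notMem_tsupport fun h => hx (hφO h)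
      simp [this]
  rw [← hΦ0, ← key, neg_neg]

/-! ### Sobolev inequalities under a cone condition -/

/-- Near each point of its closure, `U` is stable under small translations in two independent
directions. -/
def ConeCondition (U : Set Plane) : Prop :=
  ∀ x ∈ closure U, ∃ O : Set Plane, IsOpen O ∧ x ∈ O ∧ ∃ a b : Plane, LinearIndependent ℝ ![a, b] ∧
    ∃ h : ℝ, 0 < h ∧ ∀ y ∈ O ∩ U, ∀ s ∈ Icc 0 h, ∀ t ∈ Icc 0 h, y + s • a + t • b ∈ U

/-- Lebesgue measure in oblique coordinates. -/
theorem exists_lintegral_oblique {a b : Plane} (hab : LinearIndependent ℝ ![a, b]) :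
    ∃ κ : ℝ≥0∞, κ ≠ 0 ∧ κ ≠ ∞ ∧ ∀ g : Plane → ℝ≥0∞, Measurable g →
      ∫⁻ s : ℝ, ∫⁻ t : ℝ, g (s • a + t • b) = κ * ∫⁻ x, g x := by
  let l : ℝ × ℝ →ₗ[ℝ] Plane :=
    (LinearMap.fst ℝ ℝ ℝ).smulRight a + (LinearMap.snd ℝ ℝ ℝ).smulRight b
  have hl : ∀ q, l q = q.1 • a + q.2 • b := fun q => by simp [l]
  have hinj : Function.Injective l := by
    rw [← LinearMap.ker_eq_bot, LinearMap.ker_eq_bot']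
    intro q hq
    rw [hl] at hq
    have := LinearIndependent.pair_iff.1 hab q.1 q.2 hq
    exact Prod.ext this.1 this.2
  let e := (LinearEquiv.ofInjectiveOfFinrankEq l hinj (by simp)).toContinuousLinearEquiv
  have he : ∀ q, e q = q.1 • a + q.2 • b := hl
  have : (Measure.map e (volume : Measure (ℝ × ℝ))).IsAddHaarMeasure := by
    have : (volume : Measure (ℝ × ℝ)).IsAddHaarMeasure := by
      rw [Measure.volume_eq_prod]; infer_instance
    exact e.isAddHaarMeasure_map _
  obtain ⟨c, hc0, hc⟩ : ∃ c : ℝ≥0, c ≠ 0 ∧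
      Measure.map e (volume : Measure (ℝ × ℝ)) = c • (volume : Measure Plane) :=
    ⟨_, (Measure.addHaarScalarFactor_pos_of_isAddHaarMeasure _ _).ne',
      Measure.isAddLeftInvariant_eq_smul _ _⟩
  refine ⟨c, by simpa using hc0, by simp, fun g hg => ?_⟩
  have hm : Measurable e := e.continuous.measurable
  have h1 : ∫⁻ x, g x ∂(Measure.map e (volume : Measure (ℝ × ℝ))) = c * ∫⁻ x, g x := by
    rw [hc, lintegral_smul_measure]; rfl
  rw [← h1, lintegral_map hg hm, Measure.volume_eq_prod,
    lintegral_prod (fun q => g (e q)) (hg.comp hm).aemeasurable]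
  simp_rw [he]

/-- Gagliardo's argument. On O the function |F| is bounded by a line integral A in direction a and
by a line integral B in direction b. In oblique coordinates A depends only on the second coordinate
and B only on the first, so the integral of AB factors into the product of two full integrals. -/
theorem lintegral_sq_le_of_cone {U O : Set Plane} (hO : IsOpen O) {a b : Plane}
    (hab : LinearIndependent ℝ ![a, b]) {h : ℝ} (hh : 0 < h)
    (hOa : ∀ x ∈ O, ∀ s ∈ Icc 0 h, x + s • a ∈ U) (hOb : ∀ x ∈ O, ∀ s ∈ Icc 0 h, x + s • b ∈ U) :
    ∃ C : ℝ≥0∞, C ≠ ∞ ∧ ∀ F G H : Plane → ℝ, Measurable F → Measurable G → Measurable H →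
      Integrable F → Integrable G → Integrable H → WeakDeriv U a F G → WeakDeriv U b F H →
      ∫⁻ x in O, ‖F x‖ₑ ^ 2 ≤ C * (∫⁻ x, (‖F x‖ₑ + ‖G x‖ₑ + ‖H x‖ₑ)) ^ 2 := by
  obtain ⟨κ, hκ0, hκ, hint⟩ := exists_lintegral_oblique hab
  set M : ℝ≥0∞ := ENNReal.ofReal h⁻¹ + 1 with hM
  have hMt : M ≠ ∞ := by simp [hM]
  refine ⟨κ * M ^ 2, ENNReal.mul_ne_top hκ (ENNReal.pow_ne_top hMt),
    fun F G H mF mG mH iF iG iH dG dH => ?_⟩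
  set Γ : Plane → ℝ≥0∞ := fun x => M * (‖F x‖ₑ + ‖G x‖ₑ + ‖H x‖ₑ) with hΓ
  have mΓ : Measurable Γ := by fun_prop
  have hM1 : 1 ≤ M := by simp [hM]
  have hMh : ENNReal.ofReal h⁻¹ ≤ M := by simp [hM]
  set A : Plane → ℝ≥0∞ := fun x => ∫⁻ s : ℝ, Γ (x + s • a) with hA
  set B : Plane → ℝ≥0∞ := fun x => ∫⁻ s : ℝ, Γ (x + s • b) with hB
  have mA : Measurable A := Measurable.lintegral_prod_right' (f := fun q : Plane × ℝ =>
    Γ (q.1 + q.2 • a)) (mΓ.comp (by fun_prop))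
  have mB : Measurable B := Measurable.lintegral_prod_right' (f := fun q : Plane × ℝ =>
    Γ (q.1 + q.2 • b)) (mΓ.comp (by fun_prop))
  have hFA : ∀ᵐ x, x ∈ O → ‖F x‖ₑ ≤ A x := by
    filter_upwards [dG.ae_enorm_le hO iF iG hh hOa] with x hx hxO
    refine (hx hxO).trans ((lintegral_mono fun s => ?_).trans (setLIntegral_le_lintegral _ _))
    calc _ ≤ M * ‖F (x + s • a)‖ₑ + M * ‖G (x + s • a)‖ₑ := by
          gcongr
          exact le_mul_of_one_le_left zero_le hM1
      _ ≤ _ := by simp only [hΓ]; rw [mul_add, mul_add]; exact le_self_add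
  have hFB : ∀ᵐ x, x ∈ O → ‖F x‖ₑ ≤ B x := by
    filter_upwards [dH.ae_enorm_le hO iF iH hh hOb] with x hx hxO
    refine (hx hxO).trans ((lintegral_mono fun s => ?_).trans (setLIntegral_le_lintegral _ _))
    calc _ ≤ M * ‖F (x + s • b)‖ₑ + M * ‖H (x + s • b)‖ₑ := by
          gcongr
          exact le_mul_of_one_le_left zero_le hM1
      _ ≤ _ := by simp only [hΓ]; rw [mul_add, mul_add, add_right_comm]; exact le_self_add
  have hAe : ∀ s t : ℝ, A (s • a + t • b) = ∫⁻ r : ℝ, Γ (r • a + t • b) := fun s t => by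
    rw [← lintegral_add_right_eq_self (fun r : ℝ => Γ (r • a + t • b)) s]
    refine lintegral_congr fun r => ?_
    rw [add_smul]; congr 1; abel
  have hBe : ∀ s t : ℝ, B (s • a + t • b) = ∫⁻ r : ℝ, Γ (s • a + r • b) := fun s t => by
    rw [← lintegral_add_right_eq_self (fun r : ℝ => Γ (s • a + r • b)) t]
    refine lintegral_congr fun r => ?_
    rw [add_smul]; congr 1; abel
  have mα : Measurable fun t : ℝ => ∫⁻ r : ℝ, Γ (r • a + t • b) :=
    Measurable.lintegral_prod_right' (f := fun q : ℝ × ℝ => Γ (q.2 • a + q.1 • b))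
      (mΓ.comp (by fun_prop))
  have mβ : Measurable fun s : ℝ => ∫⁻ r : ℝ, Γ (s • a + r • b) :=
    Measurable.lintegral_prod_right' (f := fun q : ℝ × ℝ => Γ (q.1 • a + q.2 • b))
      (mΓ.comp (by fun_prop))
  have hAB : κ * ∫⁻ x, A x * B x = (κ * ∫⁻ x, Γ x) * (κ * ∫⁻ x, Γ x) := by
    rw [← hint (fun x => A x * B x) (mA.mul mB)]
    simp_rw [hAe, hBe]
    simp_rw [lintegral_mul_const _ mα]
    rw [lintegral_const_mul _ mβ]
    have s1 : ∫⁻ t : ℝ, ∫⁻ r : ℝ, Γ (r • a + t • b) = κ * ∫⁻ x, Γ x := by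
      rw [← hint _ mΓ]
      exact lintegral_lintegral_swap (f := fun t r : ℝ => Γ (r • a + t • b))
        (mΓ.comp (by fun_prop)).aemeasurable
    rw [s1, hint _ mΓ]
  have hAB' : ∫⁻ x, A x * B x = κ * (∫⁻ x, Γ x) ^ 2 := by
    refine (ENNReal.mul_right_inj hκ0 hκ).1 ?_
    rw [hAB]; ring
  calc ∫⁻ x in O, ‖F x‖ₑ ^ 2 ≤ ∫⁻ x in O, A x * B x := by
        refine lintegral_mono_ae ?_
        refine (ae_restrict_iff' hO.measurableSet).2 ?_
        filter_upwards [hFA, hFB] with x h1 h2 hx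
        rw [sq]; exact mul_le_mul' (h1 hx) (h2 hx)
    _ ≤ ∫⁻ x, A x * B x := setLIntegral_le_lintegral _ _
    _ = κ * (∫⁻ x, Γ x) ^ 2 := hAB'
    _ = _ := by rw [hΓ, lintegral_const_mul _ (by fun_prop)]; ring

/-- The segment bound is applied in direction a to F, and then in direction b to both F and its
a-derivative. The resulting double integral over a parallelogram is at most the integral over the
plane, up to the Jacobian κ. -/
theorem ae_enorm_le_of_cone {U O : Set Plane} (hO : IsOpen O) {a b : Plane}
    (hab : LinearIndependent ℝ ![a, b]) {h : ℝ} (hh : 0 < h)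
    (hOU : ∀ x ∈ O, ∀ s ∈ Icc 0 h, ∀ t ∈ Icc 0 h, x + s • a + t • b ∈ U) :
    ∃ C : ℝ≥0∞, C ≠ ∞ ∧ ∀ F G H K : Plane → ℝ, Measurable F → Measurable G → Measurable H →
      Measurable K → Integrable F → Integrable G → Integrable H → Integrable K →
      WeakDeriv U a F G → WeakDeriv U b F H → WeakDeriv U b G K →
      ∀ᵐ x, x ∈ O → ‖F x‖ₑ ≤ C * ∫⁻ x, (‖F x‖ₑ + ‖G x‖ₑ + ‖H x‖ₑ + ‖K x‖ₑ) := by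
  obtain ⟨κ, hκ0, hκ, hint⟩ := exists_lintegral_oblique hab
  set m : ℝ≥0∞ := ENNReal.ofReal h⁻¹ + 1 with hm
  have hmt : m ≠ ∞ := by simp [hm]
  have hm1 : 1 ≤ m := by simp [hm]
  have hmh : ENNReal.ofReal h⁻¹ ≤ m := by simp [hm]
  have hm2 : m ≤ m ^ 2 := by rw [sq]; exact le_mul_of_one_le_left zero_le hm1
  refine ⟨κ * m ^ 2, ENNReal.mul_ne_top hκ (ENNReal.pow_ne_top hmt),
    fun F G H K mF mG mH mK iF iG iH iK dG dH dK => ?_⟩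
  -- The second use of the segment bound takes place at the points x + sa, so its open set is O
  -- swept along a.
  set O' : Set Plane := ⋃ s ∈ Icc (0 : ℝ) h, (fun x => x - s • a) ⁻¹' O with hO'
  have hO'o : IsOpen O' := isOpen_biUnion fun s _ =>
    hO.preimage (continuous_id.sub continuous_const)
  have hO'm : ∀ x ∈ O, ∀ s ∈ Icc 0 h, x + s • a ∈ O' := fun x hx s hs =>
    mem_biUnion hs (by simpa using hx)
  have hO'U : ∀ y ∈ O', ∀ t ∈ Icc 0 h, y + t • b ∈ U := fun y hy t ht => by
    obtain ⟨s, hs, hy⟩ := mem_iUnion₂.1 hy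
    have := hOU (y - s • a) hy s hs t ht
    simpa using this
  have hOUa : ∀ x ∈ O, ∀ s ∈ Icc 0 h, x + s • a ∈ U := fun x hx s hs => by
    simpa using hOU x hx s hs 0 ⟨le_rfl, hh.le⟩
  set Γ : Plane → ℝ≥0∞ := fun x => m ^ 2 * (‖F x‖ₑ + ‖G x‖ₑ + ‖H x‖ₑ + ‖K x‖ₑ) with hΓ
  have mΓ : Measurable Γ := by fun_prop
  have hy : ∀ᵐ y, y ∈ O' → m * ‖F y‖ₑ + ‖G y‖ₑ ≤ ∫⁻ t : ℝ, Γ (y + t • b) := by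
    filter_upwards [dH.ae_enorm_le hO'o iF iH hh hO'U, dK.ae_enorm_le hO'o iG iK hh hO'U]
      with y h1 h2 hyO
    refine (add_le_add (mul_le_mul_right (h1 hyO) m) (h2 hyO)).trans ?_
    rw [← lintegral_const_mul _ (by fun_prop), ← lintegral_add_left (by fun_prop)]
    refine (lintegral_mono fun t => ?_).trans (setLIntegral_le_lintegral _ _)
    set f := ‖F (y + t • b)‖ₑ
    set g := ‖G (y + t • b)‖ₑ
    set h' := ‖H (y + t • b)‖ₑ
    set k := ‖K (y + t • b)‖ₑ
    calc m * (ENNReal.ofReal h⁻¹ * f + h') + (ENNReal.ofReal h⁻¹ * g + k)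
        ≤ m * (m * f + h') + (m * g + k) := by gcongr
      _ = m ^ 2 * f + m * g + m * h' + 1 * k := by ring
      _ ≤ m ^ 2 * f + m ^ 2 * g + m ^ 2 * h' + m ^ 2 * k := by
        gcongr; exact hm1.trans hm2
      _ = m ^ 2 * (f + g + h' + k) := by ring
  have hq : Measure.QuasiMeasurePreserving (fun q : Plane × ℝ => q.1 + q.2 • a)
      (volume.prod (volume.restrict (Ioc 0 h))) volume := by
    refine MeasureTheory.QuasiMeasurePreserving.prod_of_left (by fun_prop) (ae_of_all _ fun r => ?_)
    exact (measurePreserving_add_right volume (r • a)).quasiMeasurePreserving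
  -- The bound at y holds off a null set only. For almost every x, almost every point x + sa of the
  -- segment avoids that set.
  filter_upwards [dG.ae_enorm_le hO iF iG hh hOUa, Measure.ae_ae_of_ae_prod (hq.ae hy)]
    with x h1 h2 hxO
  refine (h1 hxO).trans ?_
  have h3 : ∫⁻ s in Ioc 0 h, (ENNReal.ofReal h⁻¹ * ‖F (x + s • a)‖ₑ + ‖G (x + s • a)‖ₑ) ≤
      ∫⁻ s in Ioc 0 h, ∫⁻ t : ℝ, Γ (x + s • a + t • b) := by
    refine lintegral_mono_ae ?_
    filter_upwards [h2, ae_restrict_mem measurableSet_Ioc] with s h4 hs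
    refine le_trans ?_ (h4 (hO'm x hxO s ⟨hs.1.le, hs.2⟩))
    gcongr
  refine h3.trans ((setLIntegral_le_lintegral _ _).trans ?_)
  have h5 := hint (fun y => Γ (x + y)) (mΓ.comp (by fun_prop))
  have h6 : ∀ s t : ℝ, x + s • a + t • b = x + (s • a + t • b) := fun s t => add_assoc _ _ _
  simp_rw [h6]
  rw [h5, lintegral_add_left_eq_self (fun y => Γ y), hΓ, lintegral_const_mul _ (by fun_prop),
    mul_assoc]

/-- The coordinate directions. -/
noncomputable abbrev coordDir (i : Fin 2) : Plane := EuclideanSpace.single i 1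

theorem plane_eq_coord (a : Plane) : a = a 0 • coordDir 0 + a 1 • coordDir 1 := by
  ext i; fin_cases i <;> simp [coordDir]

theorem WeakDeriv.of_coord {U : Set Plane} {F : Plane → ℝ} {G : Fin 2 → Plane → ℝ}
    (hF : Integrable F) (hG : ∀ i, Integrable (G i)) (h : ∀ i, WeakDeriv U (coordDir i) F (G i))
    (a : Plane) : WeakDeriv U a F (fun x => a 0 * G 0 x + a 1 * G 1 x) := by
  have := (h 0).linear_comb hF (hG 0) (hG 1) (h 1) (a 0) (a 1)
  rwa [← plane_eq_coord a] at this

theorem enorm_coord_comb_le (c : Plane) (g : Fin 2 → ℝ) :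
    ‖c 0 * g 0 + c 1 * g 1‖ₑ ≤ (‖c 0‖ₑ + ‖c 1‖ₑ) * ∑ i, ‖g i‖ₑ := by
  rw [Fin.sum_univ_two]
  refine (enorm_add_le _ _).trans ?_
  rw [enorm_mul, enorm_mul, add_mul, mul_add, mul_add]
  refine add_le_add le_self_add le_add_self

/-- `W^{1,1} ⊆ L²` on bounded planar domains with the cone condition. -/
theorem ConeCondition.exists_lintegral_sq_le {U : Set Plane} (hU : IsOpen U)
    (hb : Bornology.IsBounded U) (hc : ConeCondition U) :
    ∃ C : ℝ≥0∞, C ≠ ∞ ∧ ∀ (F : Plane → ℝ) (G : Fin 2 → Plane → ℝ), Measurable F →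
      (∀ i, Measurable (G i)) → Integrable F → (∀ i, Integrable (G i)) →
      (∀ i, WeakDeriv U (coordDir i) F (G i)) →
      ∫⁻ x in U, ‖F x‖ₑ ^ 2 ≤ C * (∫⁻ x, (‖F x‖ₑ + ∑ i, ‖G i x‖ₑ)) ^ 2 := by
  suffices H : ∃ C : ℝ≥0∞, C ≠ ∞ ∧ ∀ (F : Plane → ℝ) (G : Fin 2 → Plane → ℝ), Measurable F →
      (∀ i, Measurable (G i)) → Integrable F → (∀ i, Integrable (G i)) →
      (∀ i, WeakDeriv U (coordDir i) F (G i)) →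
      ∫⁻ x in closure U ∩ U, ‖F x‖ₑ ^ 2 ≤ C * (∫⁻ x, (‖F x‖ₑ + ∑ i, ‖G i x‖ₑ)) ^ 2 by
    rwa [inter_eq_self_of_subset_right subset_closure] at H
  -- Patching: the property of having a finite constant on S passes to subsets and to unions, so by
  -- compactness of the closure the local estimates suffice.
  refine hb.isCompact_closure.induction_on
    (p := fun S => ∃ C : ℝ≥0∞, C ≠ ∞ ∧ ∀ (F : Plane → ℝ) (G : Fin 2 → Plane → ℝ), Measurable F →
      (∀ i, Measurable (G i)) → Integrable F → (∀ i, Integrable (G i)) →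
      (∀ i, WeakDeriv U (coordDir i) F (G i)) →
      ∫⁻ x in S ∩ U, ‖F x‖ₑ ^ 2 ≤ C * (∫⁻ x, (‖F x‖ₑ + ∑ i, ‖G i x‖ₑ)) ^ 2) ?_ ?_ ?_ ?_
  · exact ⟨0, by simp, fun F G _ _ _ _ _ => by simp⟩
  · rintro s t hst ⟨C, hC, h⟩
    exact ⟨C, hC, fun F G h1 h2 h3 h4 h5 => (lintegral_mono_set
      (inter_subset_inter_left _ hst)).trans (h F G h1 h2 h3 h4 h5)⟩
  · rintro s t ⟨C, hC, h⟩ ⟨C', hC', h'⟩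
    refine ⟨C + C', by simp [hC, hC'], fun F G h1 h2 h3 h4 h5 => ?_⟩
    rw [union_inter_distrib_right, add_mul]
    exact (lintegral_union_le _ _ _).trans
      (add_le_add (h F G h1 h2 h3 h4 h5) (h' F G h1 h2 h3 h4 h5))
  · intro x hx
    obtain ⟨O, hO, hxO, a, b, hab, h, hh, hOU⟩ := hc x hx
    refine ⟨O, mem_nhdsWithin_of_mem_nhds (hO.mem_nhds hxO), ?_⟩
    obtain ⟨C, hC, H⟩ := lintegral_sq_le_of_cone (hO.inter hU) hab hh
      (fun y hy s hs => by simpa using hOU y hy s hs 0 ⟨le_rfl, hh.le⟩)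
      (fun y hy s hs => by simpa using hOU y hy 0 ⟨le_rfl, hh.le⟩ s hs)
    set m : ℝ≥0∞ := 1 + ((‖a 0‖ₑ + ‖a 1‖ₑ) + (‖b 0‖ₑ + ‖b 1‖ₑ)) with hm
    have hmt : m ≠ ∞ := by simp [hm]
    refine ⟨C * m ^ 2, ENNReal.mul_ne_top hC (ENNReal.pow_ne_top hmt),
      fun F G mF mG iF iG hFG => ?_⟩
    have key := H F (fun x => a 0 * G 0 x + a 1 * G 1 x) (fun x => b 0 * G 0 x + b 1 * G 1 x) mF
      (by have := mG 0; have := mG 1; fun_prop) (by have := mG 0; have := mG 1; fun_prop) iF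
      (((iG 0).const_mul _).add ((iG 1).const_mul _))
      (((iG 0).const_mul _).add ((iG 1).const_mul _))
      (WeakDeriv.of_coord iF iG hFG a) (WeakDeriv.of_coord iF iG hFG b)
    refine key.trans ?_
    rw [mul_assoc, ← mul_pow]
    gcongr
    rw [← lintegral_const_mul _ (by have := mG 0; have := mG 1; fun_prop)]
    refine lintegral_mono fun x => ?_
    calc _ ≤ ‖F x‖ₑ + (‖a 0‖ₑ + ‖a 1‖ₑ) * ∑ i, ‖G i x‖ₑ + (‖b 0‖ₑ + ‖b 1‖ₑ) * ∑ i, ‖G i x‖ₑ := by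
          gcongr
          · exact enorm_coord_comb_le a fun i => G i x
          · exact enorm_coord_comb_le b fun i => G i x
      _ = ‖F x‖ₑ + ((‖a 0‖ₑ + ‖a 1‖ₑ) + (‖b 0‖ₑ + ‖b 1‖ₑ)) * ∑ i, ‖G i x‖ₑ := by ring
      _ ≤ m * ‖F x‖ₑ + m * ∑ i, ‖G i x‖ₑ := by
          gcongr
          · exact le_mul_of_one_le_left zero_le le_self_add
          · exact le_add_self
      _ = _ := by ring

/-- `W^{2,1} ⊆ L^∞` on bounded planar domains with the cone condition. -/
theorem ConeCondition.exists_ae_enorm_le {U : Set Plane} (hU : IsOpen U)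
    (hb : Bornology.IsBounded U) (hc : ConeCondition U) :
    ∃ C : ℝ≥0∞, C ≠ ∞ ∧ ∀ (F : Plane → ℝ) (G : Fin 2 → Plane → ℝ) (H : Fin 2 → Fin 2 → Plane → ℝ),
      Measurable F → (∀ i, Measurable (G i)) → (∀ i j, Measurable (H i j)) →
      Integrable F → (∀ i, Integrable (G i)) → (∀ i j, Integrable (H i j)) →
      (∀ i, WeakDeriv U (coordDir i) F (G i)) →
      (∀ i j, WeakDeriv U (coordDir j) (G i) (H i j)) →
      ∀ᵐ x, x ∈ U → ‖F x‖ₑ ≤ C * ∫⁻ x, (‖F x‖ₑ + ∑ i, ‖G i x‖ₑ + ∑ i, ∑ j, ‖H i j x‖ₑ) := by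
  let P : Set Plane → Prop := fun S => ∃ C : ℝ≥0∞, C ≠ ∞ ∧
    ∀ (F : Plane → ℝ) (G : Fin 2 → Plane → ℝ) (H : Fin 2 → Fin 2 → Plane → ℝ),
      Measurable F → (∀ i, Measurable (G i)) → (∀ i j, Measurable (H i j)) →
      Integrable F → (∀ i, Integrable (G i)) → (∀ i j, Integrable (H i j)) →
      (∀ i, WeakDeriv U (coordDir i) F (G i)) →
      (∀ i j, WeakDeriv U (coordDir j) (G i) (H i j)) →
      ∀ᵐ x, x ∈ S ∩ U → ‖F x‖ₑ ≤ C * ∫⁻ x, (‖F x‖ₑ + ∑ i, ‖G i x‖ₑ + ∑ i, ∑ j, ‖H i j x‖ₑ)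
  suffices H : P (closure U) by
    simpa only [P, inter_eq_self_of_subset_right (subset_closure (s := U))] using H
  refine hb.isCompact_closure.induction_on (p := P) ?_ ?_ ?_ ?_
  · exact ⟨0, by simp, fun F G H _ _ _ _ _ _ _ _ => by simp⟩
  · rintro s t hst ⟨C, hC, h⟩
    refine ⟨C, hC, fun F G H h1 h2 h3 h4 h5 h6 h7 h8 => ?_⟩
    filter_upwards [h F G H h1 h2 h3 h4 h5 h6 h7 h8] with x hx hxs
    exact hx ⟨hst hxs.1, hxs.2⟩
  · rintro s t ⟨C, hC, h⟩ ⟨C', hC', h'⟩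
    refine ⟨C + C', by simp [hC, hC'], fun F G H h1 h2 h3 h4 h5 h6 h7 h8 => ?_⟩
    filter_upwards [h F G H h1 h2 h3 h4 h5 h6 h7 h8, h' F G H h1 h2 h3 h4 h5 h6 h7 h8] with x g1 g2
    rintro ⟨hx | hx, hxU⟩
    · refine (g1 ⟨hx, hxU⟩).trans ?_
      gcongr; exact le_self_add
    · refine (g2 ⟨hx, hxU⟩).trans ?_
      gcongr; exact le_add_self
  · intro x hx
    obtain ⟨O, hO, hxO, a, b, hab, h, hh, hOU⟩ := hc x hx
    refine ⟨O, mem_nhdsWithin_of_mem_nhds (hO.mem_nhds hxO), ?_⟩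
    obtain ⟨C, hC, key⟩ := ae_enorm_le_of_cone (hO.inter hU) hab hh hOU
    set A := ‖a 0‖ₑ + ‖a 1‖ₑ with hA
    set B := ‖b 0‖ₑ + ‖b 1‖ₑ with hB
    set m : ℝ≥0∞ := 1 + A + B + A * B with hm
    have hAt : A ≠ ∞ := by simp [hA]
    have hBt : B ≠ ∞ := by simp [hB]
    have hmt : m ≠ ∞ := by simp [hm, hAt, hBt, ENNReal.mul_eq_top]
    refine ⟨C * m, ENNReal.mul_ne_top hC hmt, fun F G H mF mG mH iF iG iH hFG hGH => ?_⟩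
    have m0 := mG 0
    have m1 := mG 1
    have m00 := mH 0 0
    have m01 := mH 0 1
    have m10 := mH 1 0
    have m11 := mH 1 1
    have dGb := fun i => WeakDeriv.of_coord (iG i) (iH i) (hGH i) b
    have iK : ∀ i, Integrable fun x => b 0 * H i 0 x + b 1 * H i 1 x := fun i =>
      ((iH i 0).const_mul _).add ((iH i 1).const_mul _)
    have dK : WeakDeriv (U) b (fun x => a 0 * G 0 x + a 1 * G 1 x)
        (fun x => a 0 * (b 0 * H 0 0 x + b 1 * H 0 1 x) +
          a 1 * (b 0 * H 1 0 x + b 1 * H 1 1 x)) := by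
      intro φ c1 c2 c3
      obtain ⟨M, hM⟩ := exists_bound_of_hasCompactSupport c1 c2 b
      have i1 := fun i => integrable_mul_test (iG i) (continuous_fderiv_dir c1 b) fun x => (hM x).2
      have i2 := fun i => integrable_mul_test (iK i) c1.continuous fun x => (hM x).1
      have e1 : ∀ x, (a 0 * G 0 x + a 1 * G 1 x) * fderiv ℝ φ x b =
          a 0 * (G 0 x * fderiv ℝ φ x b) + a 1 * (G 1 x * fderiv ℝ φ x b) := fun x => by ring
      have e2 : ∀ x, (a 0 * (b 0 * H 0 0 x + b 1 * H 0 1 x) +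
          a 1 * (b 0 * H 1 0 x + b 1 * H 1 1 x)) * φ x =
          a 0 * ((b 0 * H 0 0 x + b 1 * H 0 1 x) * φ x) +
          a 1 * ((b 0 * H 1 0 x + b 1 * H 1 1 x) * φ x) := fun x => by ring
      simp_rw [e1, e2]
      rw [integral_add ((i1 0).const_mul _) ((i1 1).const_mul _),
        integral_add ((i2 0).const_mul _) ((i2 1).const_mul _), integral_const_mul,
        integral_const_mul, integral_const_mul, integral_const_mul, dGb 0 φ c1 c2 c3,
        dGb 1 φ c1 c2 c3]
      ring
    have := key F (fun x => a 0 * G 0 x + a 1 * G 1 x) (fun x => b 0 * G 0 x + b 1 * G 1 x)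
      (fun x => a 0 * (b 0 * H 0 0 x + b 1 * H 0 1 x) + a 1 * (b 0 * H 1 0 x + b 1 * H 1 1 x)) mF
      (by fun_prop) (by fun_prop) (by fun_prop) iF
      (((iG 0).const_mul _).add ((iG 1).const_mul _))
      (((iG 0).const_mul _).add ((iG 1).const_mul _))
      (((iK 0).const_mul _).add ((iK 1).const_mul _))
      (WeakDeriv.of_coord iF iG hFG a) (WeakDeriv.of_coord iF iG hFG b) dK
    filter_upwards [this] with x hx hxO
    refine (hx hxO).trans ?_
    rw [mul_assoc]
    gcongr
    rw [← lintegral_const_mul _ (by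
      simp only [Fin.sum_univ_two]; fun_prop)]
    refine lintegral_mono fun x => ?_
    set f := ‖F x‖ₑ
    set g := ∑ i, ‖G i x‖ₑ
    set k := ∑ i, ∑ j, ‖H i j x‖ₑ with hk
    have g1 : ‖a 0 * G 0 x + a 1 * G 1 x‖ₑ ≤ A * g := enorm_coord_comb_le a fun i => G i x
    have g2 : ‖b 0 * G 0 x + b 1 * G 1 x‖ₑ ≤ B * g := enorm_coord_comb_le b fun i => G i x
    have g3 : ‖a 0 * (b 0 * H 0 0 x + b 1 * H 0 1 x) +
        a 1 * (b 0 * H 1 0 x + b 1 * H 1 1 x)‖ₑ ≤ A * (B * k) := by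
      refine (enorm_coord_comb_le a fun i => b 0 * H i 0 x + b 1 * H i 1 x).trans ?_
      gcongr
      rw [hk, Finset.mul_sum]
      exact Finset.sum_le_sum fun i _ => enorm_coord_comb_le b fun j => H i j x
    calc _ ≤ f + A * g + B * g + A * (B * k) := by gcongr
      _ ≤ f + A * g + B * g + A * (B * k) +
          ((A + B + A * B) * f + (1 + A * B) * g + (1 + A + B) * k) := le_self_add
      _ = m * (f + g + k) := by rw [hm]; ring

/-! ### The cone condition for C² domains and for the periodicity cell -/

theorem linearIndependent_of_det_ne_zero {a b : Plane} (h : a 0 * b 1 - a 1 * b 0 ≠ 0) :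
    LinearIndependent ℝ ![a, b] := by
  rw [LinearIndependent.pair_iff]
  intro s t hst
  have h0 : s * a 0 + t * b 0 = 0 := by
    simpa using congrArg (fun v : Plane => v 0) hst
  have h1 : s * a 1 + t * b 1 = 0 := by
    simpa using congrArg (fun v : Plane => v 1) hst
  constructor
  · refine (mul_eq_zero.1 (?_ : s * (a 0 * b 1 - a 1 * b 0) = 0)).resolve_right h
    linear_combination b 1 * h0 - b 0 * h1
  · refine (mul_eq_zero.1 (?_ : t * (a 0 * b 1 - a 1 * b 0) = 0)).resolve_right h
    linear_combination a 0 * h1 - a 1 * h0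

theorem norm_smul_add_smul_lt {a b : Plane} {h r : ℝ} (hh : (‖a‖ + ‖b‖) * h < r) {s t : ℝ}
    (hs : s ∈ Icc 0 h) (ht : t ∈ Icc 0 h) : ‖s • a + t • b‖ < r := by
  calc ‖s • a + t • b‖ ≤ ‖s • a‖ + ‖t • b‖ := norm_add_le _ _
    _ = s * ‖a‖ + t * ‖b‖ := by
      rw [norm_smul, norm_smul, Real.norm_of_nonneg hs.1, Real.norm_of_nonneg ht.1]
    _ ≤ h * ‖a‖ + h * ‖b‖ := by
      gcongr
      · exact hs.2
      · exact ht.2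
    _ < r := by rwa [← mul_add, mul_comm]

/-- At a boundary point, two independent directions can be chosen along which the defining function
ρ decreases. By continuity of the differential it decreases along them throughout a ball, and the
mean value theorem keeps small translates in {ρ < 0}. -/
theorem IsC2Domain.coneCondition {U : Set Plane} (hU : IsC2Domain U) : ConeCondition U := by
  intro x hx
  by_cases hxU : x ∈ U
  · obtain ⟨r, hr, hball⟩ := Metric.isOpen_iff.1 hU.isOpen x hxU
    obtain ⟨h, hh, hr'⟩ := exists_pos_mul_lt (half_pos hr)
      (‖coordDir 0‖ + ‖coordDir 1‖)
    refine ⟨Metric.ball x (r / 2), Metric.isOpen_ball, Metric.mem_ball_self (half_pos hr),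
      coordDir 0, coordDir 1, linearIndependent_of_det_ne_zero (by simp [coordDir]), h, hh,
      fun y hy s hs t ht => hball ?_⟩
    have h1 := norm_smul_add_smul_lt hr' hs ht
    have h2 : dist y x < r / 2 := hy.1
    rw [Metric.mem_ball, dist_eq_norm] at *
    calc ‖y + s • coordDir 0 + t • coordDir 1 - x‖
        = ‖(y - x) + (s • coordDir 0 + t • coordDir 1)‖ := by congr 1; abel
      _ ≤ ‖y - x‖ + ‖s • coordDir 0 + t • coordDir 1‖ := norm_add_le _ _
      _ < r := by linarith
  · have hfr : x ∈ frontier U := by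
      rw [frontier, hU.isOpen.interior_eq]; exact ⟨hx, hxU⟩
    obtain ⟨ρ, N, hN, hρ, hρ0, hNU⟩ := hU.boundary x hfr
    have hdc : ∀ a : Plane, Continuous fun y => fderiv ℝ ρ y a := fun a =>
      (hρ.continuous_fderiv (by simp)).clm_apply continuous_const
    set g : Fin 2 → ℝ := fun i => fderiv ℝ ρ x (coordDir i) with hg
    have happ : ∀ a : Plane, fderiv ℝ ρ x a = a 0 * g 0 + a 1 * g 1 := fun a => by
      conv_lhs => rw [plane_eq_coord a]
      simp [hg]
    have hg0 : 0 < g 0 ^ 2 + g 1 ^ 2 := by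
      by_contra hcon
      have z0 : g 0 = 0 := by nlinarith [sq_nonneg (g 0), sq_nonneg (g 1)]
      have z1 : g 1 = 0 := by nlinarith [sq_nonneg (g 0), sq_nonneg (g 1)]
      apply hρ0
      ext a
      rw [happ, z0, z1]; simp
    -- With g the gradient, these are -g turned by 45 degrees to either side and scaled. Both have
    -- derivative -|g|², and their determinant is 2|g|².
    set a : Plane := !₂[-g 0 - g 1, -g 1 + g 0] with ha
    set b : Plane := !₂[-g 0 + g 1, -g 1 - g 0] with hb
    have ha' : fderiv ℝ ρ x a < 0 := by rw [happ]; simp [ha]; nlinarith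
    have hb' : fderiv ℝ ρ x b < 0 := by rw [happ]; simp [hb]; nlinarith
    have hab : LinearIndependent ℝ ![a, b] := by
      refine linearIndependent_of_det_ne_zero ?_
      simp [ha, hb]; nlinarith
    have hnb : N ∩ ({y | fderiv ℝ ρ y a < 0} ∩ {y | fderiv ℝ ρ y b < 0}) ∈ 𝓝 x :=
      inter_mem hN (inter_mem (((isOpen_Iio).preimage (hdc a)).mem_nhds ha')
        (((isOpen_Iio).preimage (hdc b)).mem_nhds hb'))
    obtain ⟨r, hr, hball⟩ := Metric.mem_nhds_iff.1 hnb
    obtain ⟨h, hh, hr'⟩ := exists_pos_mul_lt (half_pos hr)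
      (‖a‖ + ‖b‖)
    refine ⟨Metric.ball x (r / 2), Metric.isOpen_ball, Metric.mem_ball_self (half_pos hr),
      a, b, hab, h, hh, fun y hy s hs t ht => ?_⟩
    have h1 := norm_smul_add_smul_lt hr' hs ht
    have h2 : dist y x < r / 2 := hy.1
    have hyr : y ∈ Metric.ball x r := Metric.ball_subset_ball (by linarith) hy.1
    have hyd : y + s • a + t • b ∈ Metric.ball x r := by
      rw [Metric.mem_ball, dist_eq_norm] at *
      calc ‖y + s • a + t • b - x‖ = ‖(y - x) + (s • a + t • b)‖ := by congr 1; abel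
        _ ≤ ‖y - x‖ + ‖s • a + t • b‖ := norm_add_le _ _
        _ < r := by linarith
    rw [hNU _ (hball hyd).1]
    have hy0 := (hNU _ (hball hyr).1).1 hy.2
    obtain ⟨z, hz, hzeq⟩ := domain_mvt (f := ρ) (f' := fun y => fderiv ℝ ρ y)
      (s := Metric.ball x r) (fun z _ => ((hρ.differentiable (by simp)) z).hasFDerivAt.hasFDerivWithinAt)
      (convex_ball x r) hyr hyd
    have hzb := hball ((convex_ball x r).segment_subset hyr hyd hz)
    have e : y + s • a + t • b - y = s • a + t • b := by abel
    rw [e, map_add, map_smul, map_smul, smul_eq_mul, smul_eq_mul] at hzeq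
    have n1 := mul_nonpos_of_nonneg_of_nonpos hs.1 (le_of_lt hzb.2.1)
    have n2 := mul_nonpos_of_nonneg_of_nonpos ht.1 (le_of_lt hzb.2.2)
    linarith

namespace SpatialDomain

theorem isOpen_carrier : ∀ D : SpatialDomain, IsOpen D.carrier
  | torus => by
    have : torus.carrier = ⋂ i : Fin 2, (fun x : Plane => x i) ⁻¹' Ioo 0 (2 * Real.pi) := by
      ext x; simp [carrier]
    rw [this]
    exact isOpen_iInter_of_finite fun i => isOpen_Ioo.preimage (by fun_prop)
  | neumann U hU => hU.isOpen

theorem isBounded_carrier : ∀ D : SpatialDomain, Bornology.IsBounded D.carrier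
  | torus => by
    refine (Metric.isBounded_closedBall (x := (0 : Plane)) (r := 4 * Real.pi)).subset fun x hx => ?_
    rw [mem_closedBall_zero_iff, EuclideanSpace.norm_eq, Real.sqrt_le_left (by positivity)]
    have h0 := hx 0
    have h1 := hx 1
    rw [Fin.sum_univ_two, Real.norm_of_nonneg h0.1.le, Real.norm_of_nonneg h1.1.le]
    nlinarith [h0.1, h0.2, h1.1, h1.2, Real.pi_pos]
  | neumann U hU => hU.isBounded

theorem coneCondition : ∀ D : SpatialDomain, ConeCondition D.carrier
  | torus => by
    intro x hx
    -- Each coordinate moves away from the nearer side of the square. A window of size 1 and steps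
    -- of length at most 1 stay inside because π > 3.
    set σ : Fin 2 → ℝ := fun i => if x i ≤ Real.pi then 1 else -1 with hσ
    have hσ1 : ∀ i, σ i ≠ 0 := fun i => by simp only [hσ]; split_ifs <;> norm_num
    have hx' : ∀ i, x i ∈ Icc 0 (2 * Real.pi) := fun i => by
      have : torus.carrier ⊆ (fun x : Plane => x i) ⁻¹' Icc 0 (2 * Real.pi) := fun y hy =>
        Ioo_subset_Icc_self (hy i)
      exact closure_minimal this (isClosed_Icc.preimage (by fun_prop)) hx
    refine ⟨⋂ i : Fin 2, {y : Plane | |y i - x i| < 1}, isOpen_iInter_of_finite fun i =>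
      isOpen_lt (by fun_prop) continuous_const, by simp, σ 0 • coordDir 0, σ 1 • coordDir 1,
      linearIndependent_of_det_ne_zero (by simp [coordDir, hσ1]), 1, one_pos, ?_⟩
    rintro y ⟨hyN, hy⟩ s hs t ht i
    have key : ∀ i, ∀ s ∈ Icc (0 : ℝ) 1, y i + s * σ i ∈ Ioo 0 (2 * Real.pi) := fun i s hs => by
      have h1 : |y i - x i| < 1 := mem_iInter.1 hyN i
      have h2 := hy i
      have h3 := Real.pi_gt_three
      rw [abs_lt] at h1
      simp only [hσ]
      split_ifs with hi
      · constructor <;> linarith [h2.1, h2.2, hs.1, hs.2, h1.1, h1.2]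
      · push Not at hi
        constructor <;> linarith [h2.1, h2.2, hs.1, hs.2, h1.1, h1.2]
    fin_cases i
    · simpa [coordDir] using key 0 s hs
    · simpa [coordDir] using key 1 t ht
  | neumann U hU => hU.coneCondition

end SpatialDomain

/-! ### Periodic extension and unfolding on the torus -/

/-- Coordinates in units of `2π`. -/
noncomputable def torusEquiv : Plane ≃ₗ[ℝ] (Fin 2 → ℝ) where
  toFun x i := x i / (2 * Real.pi)
  invFun y := WithLp.toLp 2 fun i => 2 * Real.pi * y i
  map_add' x y := by ext i; simp [add_div]
  map_smul' c x := by ext i; simp [mul_div_assoc]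
  left_inv x := by ext i; have := Real.pi_ne_zero; simp; field_simp
  right_inv y := by ext i; have := Real.pi_ne_zero; simp

/-- The basis of the period lattice. -/
noncomputable def torusBasis : Module.Basis (Fin 2) ℝ Plane := Module.Basis.ofEquivFun torusEquiv

/-- The period lattice. -/
abbrev periodLattice : Submodule ℤ Plane := Submodule.span ℤ (Set.range torusBasis)

/-- A fundamental domain of the period lattice. -/
abbrev periodCell : Set Plane := ZSpan.fundamentalDomain torusBasis

theorem torusBasis_repr (x : Plane) (i : Fin 2) : torusBasis.repr x i = x i / (2 * Real.pi) := by
  simp [torusBasis, torusEquiv]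

theorem torusBasis_apply (i : Fin 2) : torusBasis i = EuclideanSpace.single i (2 * Real.pi) := by
  ext j
  simp [torusBasis, torusEquiv, Pi.single_apply]

theorem mem_periodCell {x : Plane} : x ∈ periodCell ↔ ∀ i, x i ∈ Ico 0 (2 * Real.pi) := by
  have h2 : (0 : ℝ) < 2 * Real.pi := by positivity
  simp only [periodCell, ZSpan.mem_fundamentalDomain, torusBasis_repr, mem_Ico, le_div_iff₀ h2,
    div_lt_iff₀ h2, zero_mul, one_mul]

theorem torus_carrier_subset : SpatialDomain.torus.carrier ⊆ periodCell := fun _ hx =>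
  mem_periodCell.2 fun i => Ioo_subset_Ico_self (hx i)

/-- The half-open cell is the one that tiles the plane exactly; it exceeds the open one only by
points on the two coordinate axes. -/
theorem torus_carrier_ae_eq : SpatialDomain.torus.carrier =ᵐ[volume] periodCell := by
  refine (LE.le.eventuallyLE torus_carrier_subset).antisymm ?_
  have hnull : ∀ i : Fin 2, ∀ᵐ x : Plane, x i ≠ 0 := fun i => by
    let l : Plane →ₗ[ℝ] ℝ := (EuclideanSpace.proj i : Plane →L[ℝ] ℝ)
    have h := Measure.addHaar_submodule (volume : Measure Plane) (LinearMap.ker l) (by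
      intro htop
      have : (EuclideanSpace.single i 1 : Plane) ∈ LinearMap.ker l := htop ▸ Submodule.mem_top
      simp [l] at this)
    refine measure_mono_null (fun x hx => ?_) h
    simpa [l] using hx
  filter_upwards [hnull 0, hnull 1] with x h0 h1 hx i
  have hi : x i ≠ 0 := by fin_cases i <;> assumption
  have := mem_periodCell.1 hx i
  exact ⟨lt_of_le_of_ne this.1 hi.symm, this.2⟩

theorem torus_vol : SpatialDomain.torus.vol = volume.restrict periodCell :=
  Measure.restrict_congr_set torus_carrier_ae_eq

theorem fract_coord (x : Plane) (i : Fin 2) :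
    (ZSpan.fract torusBasis x) i = 2 * Real.pi * Int.fract (x i / (2 * Real.pi)) := by
  have h := ZSpan.repr_fract_apply torusBasis x i
  rw [torusBasis_repr, torusBasis_repr, div_eq_iff (by positivity)] at h
  rw [h, mul_comm]

theorem measurable_fract_torus : Measurable (ZSpan.fract torusBasis) := by
  have : (ZSpan.fract torusBasis) = fun x : Plane =>
      WithLp.toLp 2 fun i => 2 * Real.pi * Int.fract (x i / (2 * Real.pi)) := by
    ext x i; simp [fract_coord]
  rw [this]
  exact (WithLp.measurable_toLp 2 _).comp (measurable_pi_iff.2 fun i => by fun_prop)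

theorem IsPeriodic.add_lattice {φ : Plane → ℝ} (hφ : IsPeriodic φ) {v : Plane}
    (hv : v ∈ periodLattice) : ∀ x, φ (x + v) = φ x := by
  induction hv using Submodule.span_induction with
  | mem v hv =>
    obtain ⟨i, rfl⟩ := hv
    intro x
    rw [torusBasis_apply]; exact hφ x i
  | zero => simp
  | add v w _ _ h1 h2 => intro x; rw [← add_assoc, h2, h1]
  | smul n v _ h =>
    intro x
    induction n using Int.induction_on generalizing x with
    | zero => simp
    | succ k ih => rw [add_smul, one_smul, ← add_assoc, h, ih]
    | pred k ih =>
      have := h (x + (-(k : ℤ) - 1) • v)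
      rw [← this, add_assoc, sub_smul, one_smul, sub_add_cancel, ih]

instance : MeasurableConstVAdd periodLattice Plane :=
  ⟨fun v => measurable_const_add (v : Plane)⟩

instance : VAddInvariantMeasure periodLattice Plane volume :=
  ⟨fun v s _ => measure_preimage_add volume (v : Plane) s⟩

-- The relevant lattice vectors lie in the bounded difference set of the support and S, and a
-- lattice is discrete. This makes the periodization a finite sum on bounded sets.
open scoped Pointwise in
theorem exists_finset_lattice {ψ : Plane → ℝ} (hψ : HasCompactSupport ψ) {S : Set Plane}
    (hS : Bornology.IsBounded S) :
    ∃ s : Finset periodLattice, ∀ x ∈ S, ∀ v ∉ s, (v : Plane) + x ∉ tsupport ψ := by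
  have hb : Bornology.IsBounded (tsupport ψ - S) := hψ.isCompact.isBounded.sub hS
  have hfin := ZSpan.setFinite_inter torusBasis hb
  have hfin' : {v : periodLattice | (v : Plane) ∈ tsupport ψ - S}.Finite := by
    refine Set.Finite.of_finite_image (f := fun v : periodLattice => (v : Plane))
      (hfin.subset ?_) Subtype.val_injective.injOn
    rintro _ ⟨v, hv, rfl⟩
    exact ⟨hv, v.2⟩
  refine ⟨hfin'.toFinset, fun x hx v hv hmem => hv ?_⟩
  rw [Set.Finite.mem_toFinset]
  exact ⟨_, hmem, x, hx, by simp⟩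

/-- The sum of a function over lattice translates. -/
noncomputable def periodize (ψ : Plane → ℝ) (x : Plane) : ℝ := ∑' v : periodLattice, ψ (v + x)

/-- The finite set is attached to ψ while the summand is any ψ' vanishing off its support, so one
set serves both ψ and its derivatives. -/
theorem periodize_eq_sum {ψ ψ' : Plane → ℝ} {S : Set Plane} {s : Finset periodLattice}
    (hs : ∀ x ∈ S, ∀ v ∉ s, (v : Plane) + x ∉ tsupport ψ) (hψ' : ∀ x ∉ tsupport ψ, ψ' x = 0)
    {x : Plane} (hx : x ∈ S) : periodize ψ' x = ∑ v ∈ s, ψ' (v + x) :=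
  tsum_eq_sum fun v hv => hψ' _ (hs x hx v hv)

theorem periodize_eventuallyEq {ψ : Plane → ℝ} {x : Plane} {s : Finset periodLattice}
    (hs : ∀ y ∈ Metric.ball x 1, ∀ v ∉ s, (v : Plane) + y ∉ tsupport ψ) :
    periodize ψ =ᶠ[𝓝 x] fun y => ∑ v ∈ s, ψ (v + y) := by
  filter_upwards [Metric.ball_mem_nhds x one_pos] with y hy
  exact periodize_eq_sum hs (fun x hx => image_eq_zero_of_notMem_tsupport hx) hy

theorem contDiff_periodize {ψ : Plane → ℝ} (h1 : ContDiff ℝ (⊤ : ℕ∞) ψ)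
    (h2 : HasCompactSupport ψ) : ContDiff ℝ (⊤ : ℕ∞) (periodize ψ) := by
  rw [contDiff_iff_contDiffAt]
  intro x
  obtain ⟨s, hs⟩ := exists_finset_lattice h2 (Metric.isBounded_ball (x := x) (r := 1))
  refine ContDiffAt.congr_of_eventuallyEq ?_ (periodize_eventuallyEq hs)
  exact ContDiffAt.sum fun v _ => (h1.comp (contDiff_const.add contDiff_id)).contDiffAt

theorem fderiv_periodize {ψ : Plane → ℝ} (h1 : ContDiff ℝ (⊤ : ℕ∞) ψ)
    (h2 : HasCompactSupport ψ) (x a : Plane) :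
    fderiv ℝ (periodize ψ) x a = periodize (fun y => fderiv ℝ ψ y a) x := by
  obtain ⟨s, hs⟩ := exists_finset_lattice h2 (Metric.isBounded_ball (x := x) (r := 1))
  rw [(periodize_eventuallyEq hs).fderiv_eq, periodize_eq_sum hs (ψ' := fun y => fderiv ℝ ψ y a)
    (fun y hy => ?_) (Metric.mem_ball_self one_pos)]
  · rw [fderiv_fun_sum fun v _ => ?_]
    · simp only [FunLike.coe_sum, Finset.sum_apply]
      refine Finset.sum_congr rfl fun v _ => ?_
      rw [fderiv_comp_add_left]
    · exact ((h1.comp (contDiff_const.add contDiff_id)).differentiable (by simp)) x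
  · rw [image_eq_zero_of_notMem_tsupport fun hn => hy (tsupport_fderiv_subset ℝ hn)]
    rfl

theorem isPeriodic_periodize (ψ : Plane → ℝ) : IsPeriodic (periodize ψ) := by
  intro x i
  rw [← torusBasis_apply]
  let w : periodLattice := ⟨torusBasis i, Submodule.subset_span (mem_range_self i)⟩
  unfold periodize
  rw [← (Equiv.addRight w).tsum_eq fun v : periodLattice => ψ (v + x)]
  refine tsum_congr fun v => ?_
  simp only [Equiv.coe_addRight, Submodule.coe_add, w]
  congr 1; abel

-- A bounded set meets finitely many lattice translates of the cell, and each contributes at most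
-- the integral over the cell.
open scoped Pointwise in
theorem setLIntegral_comp_fract_lt_top {g : Plane → ℝ≥0∞} (hg : ∫⁻ x in periodCell, g x < ∞)
    {S : Set Plane} (hS : Bornology.IsBounded S) (hSm : MeasurableSet S) :
    ∫⁻ x in S, g (ZSpan.fract torusBasis x) < ∞ := by
  rw [← lintegral_indicator hSm,
    (ZSpan.isAddFundamentalDomain torusBasis volume).lintegral_eq_tsum'']
  have hb : Bornology.IsBounded (S - periodCell) :=
    hS.sub (ZSpan.fundamentalDomain_isBounded torusBasis)
  have hfin := ZSpan.setFinite_inter torusBasis hb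
  have hfin' : {v : periodLattice | (v : Plane) ∈ S - periodCell}.Finite := by
    refine Set.Finite.of_finite_image (f := fun v : periodLattice => (v : Plane))
      (hfin.subset ?_) Subtype.val_injective.injOn
    rintro _ ⟨v, hv, rfl⟩
    exact ⟨hv, v.2⟩
  rw [tsum_eq_sum (s := hfin'.toFinset)]
  · refine ENNReal.sum_lt_top.2 fun v _ => lt_of_le_of_lt ?_ hg
    refine setLIntegral_mono' (ZSpan.fundamentalDomain_measurableSet torusBasis) fun x hx => ?_
    refine (indicator_le_self _ _ _).trans (le_of_eq ?_)
    rw [Submodule.vadd_def, vadd_eq_add, ZSpan.fract_zSpan_add _ _ v.2, ZSpan.fract_eq_self.2 hx]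
  · intro v hv
    rw [setLIntegral_congr_fun (g := fun _ => 0)
      (ZSpan.fundamentalDomain_measurableSet torusBasis) fun x hx => ?_]
    · simp
    · refine indicator_of_notMem (fun hn => hv ?_) _
      rw [Set.Finite.mem_toFinset]
      exact ⟨_, hn, x, hx, by simp [Submodule.vadd_def]⟩

/-- The periodic copy of a null subset of the cell is a countable union of its translates. -/
theorem ae_comp_fract {p : Plane → Prop} (hp : ∀ᵐ x ∂volume.restrict periodCell, p x) :
    ∀ᵐ x, p (ZSpan.fract torusBasis x) := by
  obtain ⟨t, ht, htm, ht0⟩ := exists_measurable_superset_of_null hp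
  have h0 : volume ((ZSpan.fract torusBasis) ⁻¹' t) = 0 := by
    rw [← lintegral_indicator_one (measurable_fract_torus htm),
      (ZSpan.isAddFundamentalDomain torusBasis volume).lintegral_eq_tsum'']
    refine ENNReal.tsum_eq_zero.2 fun v => ?_
    rw [← ht0, ← lintegral_indicator_one htm]
    refine setLIntegral_congr_fun (ZSpan.fundamentalDomain_measurableSet torusBasis) fun x hx => ?_
    have : ZSpan.fract torusBasis (v +ᵥ x) = x := by
      rw [Submodule.vadd_def, vadd_eq_add, ZSpan.fract_zSpan_add _ _ v.2, ZSpan.fract_eq_self.2 hx]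
    have hiff : v +ᵥ x ∈ ZSpan.fract torusBasis ⁻¹' t ↔ x ∈ t := by rw [mem_preimage, this]
    by_cases h : x ∈ t
    · rw [indicator_of_mem h, indicator_of_mem (hiff.2 h)]; rfl
    · rw [indicator_of_notMem h, indicator_of_notMem (mt hiff.1 h)]
  refine measure_mono_null (fun x hx => ?_) h0
  exact ht hx

/-- Unfolding: an integral over the plane is an integral over the cell of the periodization. -/
theorem integral_fract_mul {f ψ : Plane → ℝ} (hf : IntegrableOn f periodCell)
    (hψ : HasCompactSupport ψ) (hψc : Continuous ψ)
    (hi : Integrable fun x => f (ZSpan.fract torusBasis x) * ψ x) :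
    ∫ x, f (ZSpan.fract torusBasis x) * ψ x = ∫ x in periodCell, f x * periodize ψ x := by
  obtain ⟨s, hs⟩ := exists_finset_lattice hψ (ZSpan.fundamentalDomain_isBounded torusBasis)
  obtain ⟨M, hM⟩ := hψc.bounded_above_of_compact_support hψ
  have hm := ZSpan.fundamentalDomain_measurableSet torusBasis
  have hz : ∀ x ∉ tsupport ψ, ψ x = 0 := fun x hx => image_eq_zero_of_notMem_tsupport hx
  rw [(ZSpan.isAddFundamentalDomain torusBasis volume).integral_eq_tsum'' _ hi]
  have e1 : ∀ v : periodLattice, ∫ x in periodCell,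
      f (ZSpan.fract torusBasis (v +ᵥ x)) * ψ (v +ᵥ x) = ∫ x in periodCell, f x * ψ (v + x) :=
    fun v => setIntegral_congr_fun hm fun x hx => by
      simp only [Submodule.vadd_def, vadd_eq_add]
      rw [ZSpan.fract_zSpan_add _ _ v.2, ZSpan.fract_eq_self.2 hx]
  simp_rw [e1]
  rw [tsum_eq_sum (s := s), ← integral_finsetSum]
  · refine setIntegral_congr_fun hm fun x hx => ?_
    rw [periodize_eq_sum hs hz hx, Finset.mul_sum]
  · intro v _
    exact hf.mul_bdd (c := M) (by fun_prop : Continuous fun x => ψ (v + x)).aestronglyMeasurable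
      (ae_of_all _ fun x => hM _)
  · intro v hv
    rw [setIntegral_congr_fun (g := fun _ => 0) hm fun x hx => ?_]
    · simp
    · rw [hz _ (hs x hx v hv), mul_zero]

/-- A bump χ equal to 1 on the cell has a strictly positive periodization. Dividing by it gives a
periodic partition of unity, and χφ divided by the periodization of χ periodizes to φ. -/
theorem exists_periodize_eq {φ : Plane → ℝ} (h1 : ContDiff ℝ (⊤ : ℕ∞) φ) (h2 : IsPeriodic φ) :
    ∃ ψ : Plane → ℝ, ContDiff ℝ (⊤ : ℕ∞) ψ ∧ HasCompactSupport ψ ∧ periodize ψ = φ := by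
  obtain ⟨R, hR⟩ := (ZSpan.fundamentalDomain_isBounded torusBasis).subset_closedBall 0
  set R' := max R 1 with hR'
  have hR'0 : 0 < R' := lt_max_of_lt_right one_pos
  let χ : ContDiffBump (0 : Plane) := ⟨R', R' + 1, hR'0, by linarith⟩
  have c1 : ContDiff ℝ (⊤ : ℕ∞) (χ : Plane → ℝ) := χ.contDiff
  have c2 : HasCompactSupport (χ : Plane → ℝ) := χ.hasCompactSupport
  have hB := contDiff_periodize c1 c2
  have hpos : ∀ x, 0 < periodize χ x := by
    intro x
    obtain ⟨s, hs⟩ := exists_finset_lattice c2 (Bornology.isBounded_singleton (x := x))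
    have hz : ∀ x ∉ tsupport (χ : Plane → ℝ), χ x = 0 := fun x hx =>
      image_eq_zero_of_notMem_tsupport hx
    rw [periodize_eq_sum hs hz (mem_singleton x)]
    obtain ⟨v, hv, -⟩ := ZSpan.exist_unique_vadd_mem_fundamentalDomain torusBasis x
    have hχ : χ (v + x) = 1 := χ.one_of_mem_closedBall
      (Metric.closedBall_subset_closedBall (le_max_left _ _) (hR hv))
    have hvs : v ∈ s := by
      by_contra hn
      have := hz _ (hs x (mem_singleton x) v hn)
      rw [hχ] at this
      exact one_ne_zero this
    calc (0 : ℝ) < χ (v + x) := by rw [hχ]; exact one_pos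
      _ ≤ _ := Finset.single_le_sum (f := fun v : periodLattice => χ (v + x))
        (fun v _ => χ.nonneg) hvs
  refine ⟨fun x => χ x * (φ x / periodize χ x), c1.mul (h1.div hB fun x => (hpos x).ne'),
    c2.mul_right, ?_⟩
  ext x
  have e : ∀ v : periodLattice, χ (v + x) * (φ (v + x) / periodize χ (v + x)) =
      χ (v + x) * (φ x / periodize χ x) := fun v => by
    rw [add_comm (v : Plane) x, h2.add_lattice v.2, (isPeriodic_periodize χ).add_lattice v.2]
  unfold periodize at e ⊢
  simp_rw [e]
  rw [tsum_mul_right]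
  exact mul_div_cancel₀ _ (hpos x).ne'

/-! ### Weak gradients on the spatial domains -/

namespace SpatialDomain

/-- The map along which functions on the region are extended: reduction modulo the periods on the
torus, and the identity for a bounded domain. -/
noncomputable def wrap : SpatialDomain → Plane → Plane
  | torus => ZSpan.fract torusBasis
  | neumann _ _ => id

/-- The open set on which the extended functions are considered. -/
def dom : SpatialDomain → Set Plane
  | torus => univ
  | neumann U _ => U

theorem isOpen_dom : ∀ D : SpatialDomain, IsOpen D.dom
  | torus => isOpen_univ
  | neumann _ hU => hU.isOpen

theorem carrier_subset_dom : ∀ D : SpatialDomain, D.carrier ⊆ D.dom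
  | torus => subset_univ _
  | neumann _ _ => subset_rfl

theorem measurable_wrap : ∀ D : SpatialDomain, Measurable D.wrap
  | torus => measurable_fract_torus
  | neumann _ _ => measurable_id

theorem wrap_of_mem : ∀ (D : SpatialDomain) {x : Plane}, x ∈ D.carrier → D.wrap x = x
  | torus, _, hx => ZSpan.fract_eq_self.2 (torus_carrier_subset hx)
  | neumann _ _, _, _ => rfl

theorem ae_wrap : ∀ (D : SpatialDomain) {p : Plane → Prop}, (∀ᵐ x ∂D.vol, p x) →
    ∀ᵐ x, x ∈ D.dom → p (D.wrap x)
  | torus, p, hp => by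
    rw [torus_vol] at hp
    filter_upwards [ae_comp_fract hp] with x hx _ using hx
  | neumann U hU, p, hp => (ae_restrict_iff' hU.isOpen.measurableSet).1 hp

theorem measurableSet_carrier (D : SpatialDomain) : MeasurableSet D.carrier :=
  D.isOpen_carrier.measurableSet

instance (D : SpatialDomain) : IsFiniteMeasure D.vol :=
  ⟨by rw [Measure.restrict_apply_univ]; exact D.isBounded_carrier.measure_lt_top⟩

theorem setLIntegral_wrap_lt_top : ∀ (D : SpatialDomain) {g : Plane → ℝ≥0∞},
    ∫⁻ x, g x ∂D.vol < ∞ → ∀ {V : Set Plane}, Bornology.IsBounded V → MeasurableSet V →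
    V ⊆ D.dom → ∫⁻ x in V, g (D.wrap x) < ∞
  | torus, g, hg, V, hV, hVm, _ => by
    rw [torus_vol] at hg
    exact setLIntegral_comp_fract_lt_top hg hV hVm
  | neumann U hU, g, hg, V, hV, hVm, hVU => (lintegral_mono_set hVU).trans_lt hg

variable {D : SpatialDomain}

theorem measurable_coe (f : D.L2) : Measurable f := (Lp.stronglyMeasurable f).measurable

/-- The cut-off by a bounded V is essential on the torus, where a nonzero periodic extension is only
locally square integrable. -/
theorem memLp_indicator_wrap (f : D.L2) {V : Set Plane} (hV : Bornology.IsBounded V)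
    (hVm : MeasurableSet V) (hVd : V ⊆ D.dom) :
    MemLp (V.indicator fun x => f (D.wrap x)) 2 := by
  rw [memLp_indicator_iff_restrict hVm]
  refine ⟨((measurable_coe f).comp D.measurable_wrap).aestronglyMeasurable, ?_⟩
  have h := (Lp.memLp f).2
  rw [eLpNorm_lt_top_iff_lintegral_rpow_enorm_lt_top (by simp) (by simp)] at h ⊢
  exact D.setLIntegral_wrap_lt_top h hV hVm hVd

theorem integrable_indicator_wrap (f : D.L2) {V : Set Plane} (hV : Bornology.IsBounded V)
    (hVm : MeasurableSet V) (hVd : V ⊆ D.dom) :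
    Integrable (V.indicator fun x => f (D.wrap x)) := by
  have h := memLp_indicator_wrap f hV hVm hVd
  rw [memLp_indicator_iff_restrict hVm] at h
  have : IsFiniteMeasure (volume.restrict V) :=
    ⟨by rw [Measure.restrict_apply_univ]; exact hV.measure_lt_top⟩
  exact (integrable_indicator_iff hVm).2 (h.integrable (by simp))

theorem integrable_coe (f : D.L2) : Integrable f D.vol := (Lp.memLp f).integrable (by simp)

theorem integrable_wrap_mul (f : D.L2) {ψ : Plane → ℝ} (h1 : Continuous ψ)
    (h2 : HasCompactSupport ψ) (h3 : tsupport ψ ⊆ D.dom) :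
    Integrable fun x => f (D.wrap x) * ψ x := by
  obtain ⟨M, hM⟩ := h1.bounded_above_of_compact_support h2
  have h := integrable_mul_test (integrable_indicator_wrap f h2.isCompact.isBounded
    (isClosed_tsupport ψ).measurableSet h3) h1 hM
  refine h.congr (ae_of_all _ fun x => ?_)
  by_cases hx : x ∈ tsupport ψ
  · simp [hx]
  · simp [hx, image_eq_zero_of_notMem_tsupport hx]

theorem tsupport_fderiv_apply_subset {φ : Plane → ℝ} (a : Plane) :
    tsupport (fun x => fderiv ℝ φ x a) ⊆ tsupport φ := by
  refine closure_minimal (fun x hx => ?_) (isClosed_tsupport φ)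
  refine tsupport_fderiv_subset ℝ (subset_tsupport _ ?_)
  intro h0
  exact hx (by simp [h0])

/-- On the plane, a weak gradient in the sense of the domain is a weak gradient of the extension. -/
theorem hasWeakGrad_iff : ∀ {D : SpatialDomain} {f : D.L2} {g : Fin 2 → D.L2},
    D.HasWeakGrad f g ↔ ∀ i, WeakDeriv D.dom (coordDir i) (fun x => f (D.wrap x))
      (fun x => g i (D.wrap x))
  | torus, f, g => by
    have unf : ∀ (f : torus.L2) {ψ : Plane → ℝ}, Continuous ψ → HasCompactSupport ψ →
        ∫ x, f (torus.wrap x) * ψ x = ∫ x, f x * periodize ψ x ∂torus.vol := fun f ψ h1 h2 => by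
      have hv : ∀ {F : Plane → ℝ}, Integrable F torus.vol → IntegrableOn F periodCell := fun h => by
        rwa [torus_vol] at h
      have hw : ∀ F : Plane → ℝ, ∫ x, F x ∂torus.vol = ∫ x in periodCell, F x := fun F => by
        rw [torus_vol]
      rw [hw]
      exact integral_fract_mul (hv (integrable_coe f)) h2 h1
        (integrable_wrap_mul f h1 h2 (subset_univ _))
    constructor
    · intro h i φ c1 c2 _
      have := h (periodize φ) ⟨contDiff_periodize c1 c2, isPeriodic_periodize φ⟩ i
      rw [unf f (continuous_fderiv_dir c1 _) (c2.fderiv_apply (𝕜 := ℝ) _),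
        unf (g i) c1.continuous c2, ← this]
      refine integral_congr_ae (ae_of_all _ fun x => ?_)
      simp only [partialDeriv]
      rw [fderiv_periodize c1 c2]
    · rintro h φ ⟨c1, c2⟩ i
      -- Every periodic test function is the periodization of a compactly supported one, so the
      -- identity on the plane covers all periodic tests.
      obtain ⟨ψ, d1, d2, rfl⟩ := exists_periodize_eq c1 c2
      have := h i ψ d1 d2 (subset_univ _)
      rw [unf f (continuous_fderiv_dir d1 _) (d2.fderiv_apply (𝕜 := ℝ) _),
        unf (g i) d1.continuous d2] at this
      rw [← this]
      refine integral_congr_ae (ae_of_all _ fun x => ?_)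
      simp only [partialDeriv]
      rw [fderiv_periodize d1 d2]
  | neumann U hU, f, g => by
    have unf : ∀ (f : (neumann U hU).L2) {ψ : Plane → ℝ}, tsupport ψ ⊆ U →
        ∫ x, f ((neumann U hU).wrap x) * ψ x = ∫ x, f x * ψ x ∂(neumann U hU).vol :=
      fun f ψ h => by
        refine (setIntegral_eq_integral_of_forall_compl_eq_zero fun x hx => ?_).symm
        rw [image_eq_zero_of_notMem_tsupport fun hn => hx (h hn), mul_zero]
    constructor
    · intro h i φ c1 c2 c3
      have := h φ ⟨c1, c2, c3⟩ i
      rw [unf f ((tsupport_fderiv_apply_subset _).trans c3), unf (g i) c3, ← this]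
      rfl
    · rintro h φ ⟨c1, c2, c3⟩ i
      have := h i φ c1 c2 c3
      rw [unf f ((tsupport_fderiv_apply_subset _).trans c3), unf (g i) c3] at this
      rw [← this]
      rfl

/-- The extension by zero outside the region. -/
noncomputable def zeroExt (f : Plane → ℝ) (D : SpatialDomain) : Plane → ℝ := D.carrier.indicator f

theorem measurable_zeroExt {f : Plane → ℝ} (hf : Measurable f) : Measurable (zeroExt f D) :=
  hf.indicator D.measurableSet_carrier

theorem integrable_zeroExt {f : Plane → ℝ} (hf : Integrable f D.vol) : Integrable (zeroExt f D) :=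
  (integrable_indicator_iff D.measurableSet_carrier).2 hf

theorem memLp_zeroExt {f : Plane → ℝ} {p : ℝ≥0∞} (hf : MemLp f p D.vol) : MemLp (zeroExt f D) p :=
  (memLp_indicator_iff_restrict D.measurableSet_carrier).2 hf

theorem lintegral_zeroExt (f : Plane → ℝ) (D : SpatialDomain) :
    ∫⁻ x, ‖zeroExt f D x‖ₑ = ∫⁻ x, ‖f x‖ₑ ∂D.vol := by
  simp only [zeroExt, enorm_indicator_eq_indicator_enorm]
  rw [lintegral_indicator D.measurableSet_carrier]

/-- The zero extension may jump across the boundary, but test functions supported in the region do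
not see the jump. -/
theorem HasWeakGrad.weakDeriv {f : D.L2} {g : Fin 2 → D.L2} (h : D.HasWeakGrad f g) (i : Fin 2) :
    WeakDeriv D.carrier (coordDir i) (zeroExt f D) (zeroExt (g i) D) := by
  refine (hasWeakGrad_iff.1 h i).congr_on D.carrier_subset_dom ?_ ?_ <;>
  · refine ae_of_all _ fun x hx => ?_
    rw [zeroExt, indicator_of_mem hx, D.wrap_of_mem hx]

/-- The product rule, with an integrable result. -/
theorem HasWeakGrad.weakDeriv_mul {f g : D.L2} {f' g' : Fin 2 → D.L2} (hf : D.HasWeakGrad f f')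
    (hg : D.HasWeakGrad g g') (i : Fin 2) :
    WeakDeriv D.carrier (coordDir i) (zeroExt (fun x => f x * g x) D)
      (zeroExt (fun x => f' i x * g x + f x * g' i x) D) := by
  have h := WeakDeriv.mul D.isOpen_carrier (integrable_zeroExt (integrable_coe f))
    (integrable_zeroExt (integrable_coe (f' i))) (integrable_zeroExt (integrable_coe g))
    (integrable_zeroExt (integrable_coe (g' i))) (memLp_zeroExt (Lp.memLp f))
    (memLp_zeroExt (Lp.memLp (f' i))) (memLp_zeroExt (Lp.memLp g))
    (memLp_zeroExt (Lp.memLp (g' i))) (hf.weakDeriv i) (hg.weakDeriv i)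
  refine h.congr_on subset_rfl ?_ ?_ <;>
  · refine ae_of_all _ fun x hx => ?_
    simp only [zeroExt, indicator_of_mem hx]

/-- The product rule in `H¹`, when the products are square integrable. -/
theorem HasWeakGrad.mul {f g P : D.L2} {f' g' Q : Fin 2 → D.L2} (hf : D.HasWeakGrad f f')
    (hg : D.HasWeakGrad g g') (hP : P =ᵐ[D.vol] fun x => f x * g x)
    (hQ : ∀ i, Q i =ᵐ[D.vol] fun x => f' i x * g x + f x * g' i x) : D.HasWeakGrad P Q := by
  rw [hasWeakGrad_iff] at hf hg ⊢
  intro i φ c1 c2 c3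
  -- The product rule on the plane asks for globally integrable functions, so the extensions are
  -- first cut off to a bounded neighbourhood of the support of the test function.
  obtain ⟨V, hVo, hφV, hVd, hVb⟩ : ∃ V : Set Plane, IsOpen V ∧ tsupport φ ⊆ V ∧ V ⊆ D.dom ∧
      Bornology.IsBounded V :=
    ⟨D.dom ∩ Metric.thickening 1 (tsupport φ), D.isOpen_dom.inter Metric.isOpen_thickening,
      subset_inter c3 (Metric.self_subset_thickening one_pos _), inter_subset_left,
      (c2.isCompact.isBounded.thickening).subset inter_subset_right⟩
  have hVm := hVo.measurableSet
  set E : D.L2 → Plane → ℝ := fun f => V.indicator fun x => f (D.wrap x) with hE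
  have hEx : ∀ (f : D.L2) x, x ∈ V → E f x = f (D.wrap x) := fun f x hx => indicator_of_mem hx _
  have hd : ∀ {f : D.L2} {f' : Fin 2 → D.L2}, (∀ i, WeakDeriv D.dom (coordDir i)
      (fun x => f (D.wrap x)) (fun x => f' i (D.wrap x))) →
      WeakDeriv V (coordDir i) (E f) (E (f' i)) := fun {f f'} h =>
    (h i).congr_on hVd (ae_of_all _ (hEx f)) (ae_of_all _ (hEx (f' i)))
  have iE : ∀ f : D.L2, Integrable (E f) := fun f => integrable_indicator_wrap f hVb hVm hVd
  have mE : ∀ f : D.L2, MemLp (E f) 2 := fun f => memLp_indicator_wrap f hVb hVm hVd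
  have h := WeakDeriv.mul hVo (iE f) (iE (f' i)) (iE g) (iE (g' i)) (mE f) (mE (f' i)) (mE g)
    (mE (g' i)) (hd hf) (hd hg)
  refine h.congr_on (V := V) (F' := fun x => P (D.wrap x)) (G' := fun x => Q i (D.wrap x))
    subset_rfl ?_ ?_ φ c1 c2 hφV
  · filter_upwards [D.ae_wrap hP] with x hx hxV
    rw [hx (hVd hxV), hEx _ x hxV, hEx _ x hxV]
  · filter_upwards [D.ae_wrap (hQ i)] with x hx hxV
    rw [hx (hVd hxV), hEx _ x hxV, hEx _ x hxV, hEx _ x hxV, hEx _ x hxV]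

end SpatialDomain

/-! ### Sobolev inequalities on the spatial domains -/

theorem WeakDeriv.const_mul {U : Set Plane} {a : Plane} {F G : Plane → ℝ} (h : WeakDeriv U a F G)
    (c : ℝ) : WeakDeriv U a (fun x => c * F x) (fun x => c * G x) := by
  intro φ c1 c2 c3
  simp_rw [mul_assoc]
  rw [integral_const_mul, integral_const_mul, h φ c1 c2 c3]
  ring

namespace SpatialDomain

variable {D : SpatialDomain}

theorem enorm_L2_eq (f : D.L2) : ‖f‖ₑ = (∫⁻ x, ‖f x‖ₑ ^ (2 : ℝ) ∂D.vol) ^ (1 / (2 : ℝ)) := by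
  rw [Lp.enorm_def, eLpNorm_eq_lintegral_rpow_enorm_toReal (by simp) (by simp)]
  simp

theorem enorm_sq_L2_eq (f : D.L2) : ‖f‖ₑ ^ 2 = ∫⁻ x, ‖f x‖ₑ ^ 2 ∂D.vol := by
  rw [enorm_L2_eq, ← ENNReal.rpow_natCast, ← ENNReal.rpow_mul]
  norm_num

theorem enorm_real_ofNat (n : ℕ) [n.AtLeastTwo] : ‖(OfNat.ofNat n : ℝ)‖ₑ = OfNat.ofNat n := by
  rw [Real.enorm_eq_ofReal_abs, Nat.abs_ofNat, ENNReal.ofReal_ofNat]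

theorem lintegral_enorm_mul_le (f g : D.L2) : ∫⁻ x, ‖f x * g x‖ₑ ∂D.vol ≤ ‖f‖ₑ * ‖g‖ₑ := by
  rw [enorm_L2_eq f, enorm_L2_eq g]
  simp_rw [enorm_mul]
  have := measurable_coe f
  have := measurable_coe g
  exact ENNReal.lintegral_mul_le_Lp_mul_Lq D.vol Real.HolderConjugate.two_two (by fun_prop)
    (by fun_prop)

theorem exists_lintegral_enorm_le (D : SpatialDomain) :
    ∃ C : ℝ≥0∞, C ≠ ∞ ∧ ∀ f : D.L2, ∫⁻ x, ‖f x‖ₑ ∂D.vol ≤ C * ‖f‖ₑ := by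
  have h1 : MemLp (fun _ : Plane => (1 : ℝ)) 2 D.vol := memLp_const 1
  refine ⟨‖h1.toLp _‖ₑ, by simp, fun f => ?_⟩
  refine le_trans (le_of_eq ?_) (lintegral_enorm_mul_le (h1.toLp _) f)
  refine lintegral_congr_ae ?_
  filter_upwards [h1.coeFn_toLp] with x hx
  rw [hx, one_mul]

theorem exists_bdd_mul {f g : D.L2} {M : ℝ} (hf : ∀ᵐ x ∂D.vol, |f x| ≤ M) :
    ∃ P : D.L2, P =ᵐ[D.vol] fun x => f x * g x := by
  have hm : MemLp (fun x => f x * g x) 2 D.vol :=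
    (Lp.memLp g).of_le_mul (c := M)
      ((Lp.aestronglyMeasurable f).mul (Lp.aestronglyMeasurable g)) (by
      filter_upwards [hf] with x hx
      rw [norm_mul]; exact mul_le_mul_of_nonneg_right hx (norm_nonneg _))
  exact ⟨hm.toLp _, hm.coeFn_toLp⟩

theorem exists_add_mul {a b c d : D.L2} {M M' : ℝ} (hb : ∀ᵐ x ∂D.vol, |b x| ≤ M)
    (hc : ∀ᵐ x ∂D.vol, |c x| ≤ M') : ∃ P : D.L2, P =ᵐ[D.vol] fun x => a x * b x + c x * d x := by
  obtain ⟨P, hP⟩ := exists_bdd_mul (g := a) hb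
  obtain ⟨Q, hQ⟩ := exists_bdd_mul (g := d) hc
  refine ⟨P + Q, ?_⟩
  filter_upwards [Lp.coeFn_add P Q, hP, hQ] with x h1 h2 h3
  rw [h1, Pi.add_apply, h2, h3, mul_comm (b x)]

/-- The product of bounded functions in `H¹` is in `H¹`. -/
theorem HasWeakGrad.exists_mul {f g : D.L2} {f' g' : Fin 2 → D.L2} (hf : D.HasWeakGrad f f')
    (hg : D.HasWeakGrad g g') {M M' : ℝ} (hfM : ∀ᵐ x ∂D.vol, |f x| ≤ M)
    (hgM : ∀ᵐ x ∂D.vol, |g x| ≤ M') :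
    ∃ (P : D.L2) (Q : Fin 2 → D.L2), P =ᵐ[D.vol] (fun x => f x * g x) ∧
      (∀ i, Q i =ᵐ[D.vol] fun x => f' i x * g x + f x * g' i x) ∧ D.HasWeakGrad P Q := by
  obtain ⟨P, hP⟩ := exists_bdd_mul (g := g) hfM
  choose Q hQ using fun i => exists_add_mul (a := f' i) (d := g' i) hgM hfM
  exact ⟨P, Q, hP, hQ, hf.mul hg hP hQ⟩

/-- Ladyzhenskaya's inequality. -/
theorem exists_sq_enorm_le (D : SpatialDomain) : ∃ C : ℝ≥0∞, C ≠ ∞ ∧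
    ∀ (f : D.L2) (g : Fin 2 → D.L2), D.HasWeakGrad f g →
      ∃ P : D.L2, P =ᵐ[D.vol] (fun x => f x * f x) ∧ ‖P‖ₑ ≤ C * (‖f‖ₑ * (‖f‖ₑ + ∑ i, ‖g i‖ₑ)) := by
  obtain ⟨C, hC, H⟩ := D.coneCondition.exists_lintegral_sq_le D.isOpen_carrier D.isBounded_carrier
  refine ⟨C ^ (1 / 2 : ℝ) * 2, ENNReal.mul_ne_top (ENNReal.rpow_ne_top_of_nonneg (by norm_num) hC)
    (by simp), fun f g hfg => ?_⟩
  have mf := measurable_coe f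
  have mg := fun i => measurable_coe (g i)
  have iff' := (Lp.memLp f).integrable_mul (Lp.memLp f)
  have ifg := fun i => (Lp.memLp f).integrable_mul (Lp.memLp (g i))
  have igf := fun i => (Lp.memLp (g i)).integrable_mul (Lp.memLp f)
  -- The embedding W^{1,1} ⊆ L² is applied to f², whose gradient 2f∇f is integrable with norm at
  -- most 2‖f‖‖∇f‖.
  have key := H (zeroExt (fun x => f x * f x) D) (fun i => zeroExt (fun x => g i x * f x + f x * g i x) D)
    (measurable_zeroExt (mf.mul mf)) (fun i => measurable_zeroExt (((mg i).mul mf).add (mf.mul (mg i))))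
    (integrable_zeroExt iff') (fun i => integrable_zeroExt ((igf i).add (ifg i)))
    (fun i => hfg.weakDeriv_mul hfg i)
  have e1 : ∫⁻ x in D.carrier, ‖zeroExt (fun x => f x * f x) D x‖ₑ ^ 2 =
      ∫⁻ x, ‖f x * f x‖ₑ ^ 2 ∂D.vol :=
    setLIntegral_congr_fun D.measurableSet_carrier fun x hx => by
      simp only [zeroExt, indicator_of_mem hx]
  have mff : Measurable fun x => ‖zeroExt (fun x => f x * f x) D x‖ₑ :=
    (measurable_zeroExt (mf.mul mf)).enorm
  have mgf : ∀ i, Measurable fun x => ‖zeroExt (fun x => g i x * f x + f x * g i x) D x‖ₑ :=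
    fun i => (measurable_zeroExt (((mg i).mul mf).add (mf.mul (mg i)))).enorm
  rw [e1, lintegral_add_left mff, lintegral_finsetSum _ (fun i _ => mgf i)] at key
  simp_rw [lintegral_zeroExt] at key
  have b2 : ∀ i, ∫⁻ x, ‖g i x * f x + f x * g i x‖ₑ ∂D.vol ≤ 2 * (‖f‖ₑ * ‖g i‖ₑ) := fun i => by
    calc _ = ∫⁻ x, 2 * ‖f x * g i x‖ₑ ∂D.vol := by
          refine lintegral_congr fun x => ?_
          rw [mul_comm (g i x), ← two_mul, enorm_mul, enorm_real_ofNat]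
      _ ≤ _ := by
          rw [lintegral_const_mul _ (by have := mg i; fun_prop)]
          gcongr; exact lintegral_enorm_mul_le _ _
  have b3 : (∫⁻ x, ‖f x * f x‖ₑ ∂D.vol) + ∑ i, ∫⁻ x, ‖g i x * f x + f x * g i x‖ₑ ∂D.vol ≤
      2 * (‖f‖ₑ * (‖f‖ₑ + ∑ i, ‖g i‖ₑ)) := by
    calc _ ≤ ‖f‖ₑ * ‖f‖ₑ + ∑ i, 2 * (‖f‖ₑ * ‖g i‖ₑ) :=
          add_le_add (lintegral_enorm_mul_le f f) (Finset.sum_le_sum fun i _ => b2 i)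
      _ ≤ 2 * (‖f‖ₑ * ‖f‖ₑ) + ∑ i, 2 * (‖f‖ₑ * ‖g i‖ₑ) := by
          refine add_le_add ?_ le_rfl; rw [two_mul]; exact le_self_add
      _ = _ := by simp only [← Finset.mul_sum]; ring
  have hlt : ∫⁻ x, ‖f x * f x‖ₑ ^ 2 ∂D.vol ≤ C * (2 * (‖f‖ₑ * (‖f‖ₑ + ∑ i, ‖g i‖ₑ))) ^ 2 :=
    key.trans (by gcongr)
  have hfin : C * (2 * (‖f‖ₑ * (‖f‖ₑ + ∑ i, ‖g i‖ₑ))) ^ 2 < ∞ := by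
    refine ENNReal.mul_lt_top hC.lt_top (ENNReal.pow_lt_top (ENNReal.mul_lt_top (by simp)
      (ENNReal.mul_lt_top (by simp) (ENNReal.add_lt_top.2 ⟨by simp, ?_⟩))))
    exact ENNReal.sum_lt_top.2 fun i _ => by simp
  have hP : MemLp (fun x => f x * f x) 2 D.vol := by
    refine ⟨(mf.mul mf).aestronglyMeasurable, ?_⟩
    rw [eLpNorm_lt_top_iff_lintegral_rpow_enorm_lt_top (by simp) (by simp)]
    simpa using hlt.trans_lt hfin
  refine ⟨hP.toLp _, hP.coeFn_toLp, ?_⟩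
  have e2 : ‖hP.toLp _‖ₑ ^ 2 = ∫⁻ x, ‖f x * f x‖ₑ ^ 2 ∂D.vol := by
    rw [enorm_sq_L2_eq]
    refine lintegral_congr_ae ?_
    filter_upwards [hP.coeFn_toLp] with x hx
    rw [hx]
  rw [← ENNReal.pow_le_pow_left_iff two_ne_zero, e2]
  refine hlt.trans (le_of_eq ?_)
  rw [mul_assoc, mul_pow (C ^ (1 / 2 : ℝ)), ← ENNReal.rpow_natCast (C ^ (1 / 2 : ℝ)),
    ← ENNReal.rpow_mul]
  norm_num

/-- Functions in `H²` are bounded. -/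
theorem exists_ae_enorm_le (D : SpatialDomain) : ∃ C : ℝ≥0∞, C ≠ ∞ ∧
    ∀ (f : D.L2) (g : Fin 2 → D.L2) (h : Fin 2 → Fin 2 → D.L2), D.HasHess f g h →
      ∀ᵐ x ∂D.vol, ‖f x‖ₑ ≤ C * (‖f‖ₑ + ∑ i, ‖g i‖ₑ + ∑ i, ∑ j, ‖h i j‖ₑ) := by
  obtain ⟨C, hC, H⟩ := D.coneCondition.exists_ae_enorm_le D.isOpen_carrier D.isBounded_carrier
  obtain ⟨c, hc, hL⟩ := D.exists_lintegral_enorm_le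
  refine ⟨C * c, ENNReal.mul_ne_top hC hc, fun f g h hh => ?_⟩
  have key := H (zeroExt f D) (fun i => zeroExt (g i) D) (fun i j => zeroExt (h i j) D)
    (measurable_zeroExt (measurable_coe f)) (fun i => measurable_zeroExt (measurable_coe _))
    (fun i j => measurable_zeroExt (measurable_coe _)) (integrable_zeroExt (integrable_coe f))
    (fun i => integrable_zeroExt (integrable_coe _))
    (fun i j => integrable_zeroExt (integrable_coe _)) hh.1.weakDeriv
    (fun i j => (hh.2 i).weakDeriv j)
  refine (ae_restrict_iff' D.measurableSet_carrier).2 ?_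
  filter_upwards [key] with x hx hxD
  have hx := hx hxD
  have hxe : zeroExt f D x = f x := indicator_of_mem hxD _
  rw [hxe] at hx
  refine hx.trans ?_
  rw [mul_assoc]
  gcongr
  have me : ∀ f : D.L2, Measurable fun x => ‖zeroExt f D x‖ₑ := fun f =>
    (measurable_zeroExt (measurable_coe f)).enorm
  have : ∀ f : D.L2, ∫⁻ x, ‖zeroExt f D x‖ₑ ≤ c * ‖f‖ₑ := fun f => by
    rw [lintegral_zeroExt]; exact hL f
  rw [lintegral_add_right _ (Finset.measurable_fun_sum _ fun i _ =>
      Finset.measurable_fun_sum _ fun j _ => me _), lintegral_add_left (me f),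
    lintegral_finsetSum _ (fun i _ => me _), lintegral_finsetSum _ (fun i _ =>
      Finset.measurable_fun_sum _ fun j _ => me _)]
  simp_rw [lintegral_finsetSum Finset.univ (fun (j : Fin 2) _ => me _)]
  calc _ ≤ c * ‖f‖ₑ + ∑ i, c * ‖g i‖ₑ + ∑ i, ∑ j, c * ‖h i j‖ₑ :=
        add_le_add (add_le_add (this f) (Finset.sum_le_sum fun i _ => this _))
          (Finset.sum_le_sum fun i _ => Finset.sum_le_sum fun j _ => this _)
    _ = _ := by simp only [← Finset.mul_sum]; ring

theorem HasHess.exists_bdd {f : D.L2} {g : Fin 2 → D.L2} {h : Fin 2 → Fin 2 → D.L2}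
    (hh : D.HasHess f g h) : ∃ M : ℝ, ∀ᵐ x ∂D.vol, |f x| ≤ M := by
  obtain ⟨C, hC, H⟩ := D.exists_ae_enorm_le
  set B := C * (‖f‖ₑ + ∑ i, ‖g i‖ₑ + ∑ i, ∑ j, ‖h i j‖ₑ) with hB
  have hBt : B ≠ ∞ := by
    refine ENNReal.mul_ne_top hC ?_
    simp [Fin.sum_univ_two]
  refine ⟨B.toReal, ?_⟩
  filter_upwards [H f g h hh] with x hx
  have := ENNReal.toReal_mono hBt hx
  simpa using this

/-- The interpolation inequality `‖u‖_∞³ ≤ C ‖u‖_{H¹}² ‖u‖_{H²}`. -/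
theorem exists_ae_enorm_cube_le (D : SpatialDomain) : ∃ C : ℝ≥0∞, C ≠ ∞ ∧
    ∀ (f : D.L2) (g : Fin 2 → D.L2) (h : Fin 2 → Fin 2 → D.L2), D.HasHess f g h →
      ∀ᵐ x ∂D.vol, ‖f x‖ₑ ^ 3 ≤ C * ((‖f‖ₑ + ∑ i, ‖g i‖ₑ) ^ 2 *
        (‖f‖ₑ + ∑ i, ‖g i‖ₑ + ∑ i, ∑ j, ‖h i j‖ₑ)) := by
  obtain ⟨C, hC, H⟩ := D.coneCondition.exists_ae_enorm_le D.isOpen_carrier D.isBounded_carrier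
  obtain ⟨c, hc, hL⟩ := D.exists_sq_enorm_le
  -- The embedding W^{2,1} ⊆ L^∞ is applied to f³. The L¹ norms of f³, of its two first derivatives
  -- and of its four second derivatives are at most 1, 3 and 9 times cE²(E+N), and 1 + 2·3 + 4·9 =
  -- 43.
  refine ⟨C * (c * 43), ENNReal.mul_ne_top hC (ENNReal.mul_ne_top hc (by simp)),
    fun f g h hh => ?_⟩
  set E := ‖f‖ₑ + ∑ i, ‖g i‖ₑ with hE
  set N := ∑ i, ∑ j, ‖h i j‖ₑ with hN
  obtain ⟨M, hM⟩ := hh.exists_bdd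
  obtain ⟨P, Q, hP, hQ, hPQ⟩ := hh.1.exists_mul hh.1 hM hM
  obtain ⟨P', hP', hPn⟩ := hL f g hh.1
  have hPP : P = P' := Lp.ext (hP.trans hP'.symm)
  subst hPP
  choose R hR hRn using fun i => hL (g i) (h i) (hh.2 i)
  have hfE : ‖f‖ₑ ≤ E := le_self_add
  have hgE : ∀ i, ‖g i‖ₑ ≤ E := fun i =>
    (Finset.single_le_sum (f := fun i => ‖g i‖ₑ) (fun _ _ => zero_le) (Finset.mem_univ i)).trans
      le_add_self
  have hhN' : ∀ i, ∑ j, ‖h i j‖ₑ ≤ N := fun i =>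
    Finset.single_le_sum (f := fun i => ∑ j, ‖h i j‖ₑ) (fun _ _ => zero_le) (Finset.mem_univ i)
  have hhN : ∀ i j, ‖h i j‖ₑ ≤ N := fun i j =>
    (Finset.single_le_sum (f := fun j => ‖h i j‖ₑ) (fun _ _ => zero_le) (Finset.mem_univ j)).trans
      (hhN' i)
  have hPE : ‖P‖ₑ ≤ c * (E * E) := hPn.trans (by gcongr)
  have hRE : ∀ i, ‖R i‖ₑ ≤ c * (E * (E + N)) := fun i => (hRn i).trans (by
    gcongr
    · exact hgE i
    · exact hgE i
    · exact hhN' i)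
  have mf := measurable_coe f
  have mP := measurable_coe P
  have mg := fun i => measurable_coe (g i)
  have mQ := fun i => measurable_coe (Q i)
  have mh := fun i j => measurable_coe (h i j)
  have i2 : ∀ a b : D.L2, Integrable (fun x => a x * b x) D.vol := fun a b =>
    (Lp.memLp a).integrable_mul (Lp.memLp b)
  set G : Fin 2 → Plane → ℝ := fun i => zeroExt (fun x => 3 * (P x * g i x)) D with hG
  set K : Fin 2 → Fin 2 → Plane → ℝ := fun i j =>
    zeroExt (fun x => 3 * (Q j x * g i x + P x * h i j x)) D with hK
  have zc : ∀ (r : ℝ) (k : Plane → ℝ), zeroExt (fun x => r * k x) D = fun x => r * zeroExt k D x :=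
    fun r k => by
      ext x
      by_cases hx : x ∈ D.carrier <;> simp [zeroExt, hx]
  have key := H (zeroExt (fun x => P x * f x) D) G K (measurable_zeroExt (mP.mul mf))
    (fun i => measurable_zeroExt ((mP.mul (mg i)).const_mul 3))
    (fun i j => measurable_zeroExt ((((mQ j).mul (mg i)).add (mP.mul (mh i j))).const_mul 3))
    (integrable_zeroExt (i2 _ _)) (fun i => integrable_zeroExt ((i2 _ _).const_mul 3))
    (fun i j => integrable_zeroExt (((i2 _ _).add (i2 _ _)).const_mul 3))
    (fun i => by
      refine (hPQ.weakDeriv_mul hh.1 i).congr_on subset_rfl (ae_of_all _ fun _ _ => rfl) ?_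
      filter_upwards [(ae_restrict_iff' D.measurableSet_carrier).1 hP,
        (ae_restrict_iff' D.measurableSet_carrier).1 (hQ i)] with x h1 h2 hx
      simp only [hG, zeroExt, indicator_of_mem hx]
      rw [h1 hx, h2 hx]; ring)
    (fun i j => by
      simp only [hG, hK, zc]
      exact (hPQ.weakDeriv_mul (hh.2 i) j).const_mul 3)
  have bF : ∫⁻ x, ‖zeroExt (fun x => P x * f x) D x‖ₑ ≤ c * (E ^ 2 * (E + N)) := by
    rw [lintegral_zeroExt]
    calc _ ≤ ‖P‖ₑ * ‖f‖ₑ := lintegral_enorm_mul_le _ _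
      _ ≤ c * (E * E) * (E + N) := by gcongr; exact hfE.trans le_self_add
      _ = _ := by ring
  have b3 : ∀ {k : Plane → ℝ}, Measurable k → ∫⁻ x, ‖3 * k x‖ₑ ∂D.vol = 3 * ∫⁻ x, ‖k x‖ₑ ∂D.vol :=
    fun {k} hk => by
      simp_rw [enorm_mul]
      rw [lintegral_const_mul _ hk.enorm, enorm_real_ofNat]
  have bG : ∀ i, ∫⁻ x, ‖G i x‖ₑ ≤ 3 * (c * (E ^ 2 * (E + N))) := fun i => by
    simp only [hG]
    rw [lintegral_zeroExt, b3 (k := fun x => P x * g i x) (mP.mul (mg i))]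
    gcongr
    calc _ ≤ ‖P‖ₑ * ‖g i‖ₑ := lintegral_enorm_mul_le _ _
      _ ≤ c * (E * E) * (E + N) := by gcongr; exact (hgE i).trans le_self_add
      _ = _ := by ring
  -- The term 2f gᵢgⱼ is at most |f|(gᵢ² + gⱼ²) in absolute value, and Ladyzhenskaya's inequality
  -- for the gradient components controls gᵢ² in L².
  have bQ : ∀ i j, ∫⁻ x, ‖Q j x * g i x‖ₑ ∂D.vol ≤ 2 * (c * (E ^ 2 * (E + N))) := fun i j => by
    calc ∫⁻ x, ‖Q j x * g i x‖ₑ ∂D.vol ≤ ∫⁻ x, (‖f x * R i x‖ₑ + ‖f x * R j x‖ₑ) ∂D.vol := by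
          refine lintegral_mono_ae ?_
          filter_upwards [hQ j, hR i, hR j] with x h1 h2 h3
          rw [h1, h2, h3]
          simp only [Real.enorm_eq_ofReal_abs]
          rw [← ENNReal.ofReal_add (abs_nonneg _) (abs_nonneg _)]
          refine ENNReal.ofReal_le_ofReal ?_
          have e : (g j x * f x + f x * g j x) * g i x = f x * (2 * (g i x * g j x)) := by ring
          rw [e, abs_mul, abs_mul, abs_mul (f x), abs_mul (f x), ← mul_add,
              abs_of_nonneg (mul_self_nonneg (g i x)),
            abs_of_nonneg (mul_self_nonneg (g j x))]
          refine mul_le_mul_of_nonneg_left ?_ (abs_nonneg _)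
          rw [abs_mul, abs_of_nonneg (zero_le_two : (0 : ℝ) ≤ 2)]
          nlinarith [sq_nonneg (|g i x| - |g j x|), abs_mul_abs_self (g i x),
            abs_mul_abs_self (g j x)]
      _ = (∫⁻ x, ‖f x * R i x‖ₑ ∂D.vol) + ∫⁻ x, ‖f x * R j x‖ₑ ∂D.vol :=
          lintegral_add_left (mf.mul (measurable_coe (R i))).enorm _
      _ ≤ ‖f‖ₑ * ‖R i‖ₑ + ‖f‖ₑ * ‖R j‖ₑ :=
          add_le_add (lintegral_enorm_mul_le _ _) (lintegral_enorm_mul_le _ _)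
      _ ≤ E * (c * (E * (E + N))) + E * (c * (E * (E + N))) := by
          gcongr
          · exact hRE i
          · exact hRE j
      _ = _ := by ring
  have bK : ∀ i j, ∫⁻ x, ‖K i j x‖ₑ ≤ 9 * (c * (E ^ 2 * (E + N))) := fun i j => by
    simp only [hK]
    rw [lintegral_zeroExt, b3 (k := fun x => Q j x * g i x + P x * h i j x)
      (((mQ j).mul (mg i)).add (mP.mul (mh i j)))]
    calc _ ≤ 3 * ∫⁻ x, (‖Q j x * g i x‖ₑ + ‖P x * h i j x‖ₑ) ∂D.vol := by
          gcongr; exact enorm_add_le _ _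
      _ = 3 * ((∫⁻ x, ‖Q j x * g i x‖ₑ ∂D.vol) + ∫⁻ x, ‖P x * h i j x‖ₑ ∂D.vol) := by
          have : Measurable fun x => ‖Q j x * g i x‖ₑ := ((mQ j).mul (mg i)).enorm
          rw [lintegral_add_left this]
      _ ≤ 3 * (2 * (c * (E ^ 2 * (E + N))) + ‖P‖ₑ * ‖h i j‖ₑ) := by
          gcongr
          · exact bQ i j
          · exact lintegral_enorm_mul_le _ _
      _ ≤ 3 * (2 * (c * (E ^ 2 * (E + N))) + c * (E * E) * (E + N)) := by
          gcongr; exact (hhN i j).trans le_add_self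
      _ = _ := by ring
  have mzF : Measurable fun x => ‖zeroExt (fun x => P x * f x) D x‖ₑ :=
    (measurable_zeroExt (mP.mul mf)).enorm
  have mzG : ∀ i, Measurable fun x => ‖G i x‖ₑ := fun i =>
    (measurable_zeroExt ((mP.mul (mg i)).const_mul 3)).enorm
  have mzK : ∀ i j, Measurable fun x => ‖K i j x‖ₑ := fun i j =>
    (measurable_zeroExt ((((mQ j).mul (mg i)).add (mP.mul (mh i j))).const_mul 3)).enorm
  refine (ae_restrict_iff' D.measurableSet_carrier).2 ?_
  filter_upwards [key, (ae_restrict_iff' D.measurableSet_carrier).1 hP] with x hx hPx hxD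
  have hx := hx hxD
  have hxe : zeroExt (fun x => P x * f x) D x = P x * f x := indicator_of_mem hxD _
  rw [hxe, hPx hxD] at hx
  have e : ‖f x‖ₑ ^ 3 = ‖f x * f x * f x‖ₑ := by rw [enorm_mul, enorm_mul]; ring
  rw [e]
  refine hx.trans ?_
  rw [mul_assoc C]
  gcongr
  rw [lintegral_add_right _ (Finset.measurable_fun_sum _ fun i _ =>
      Finset.measurable_fun_sum _ fun j _ => mzK i j),
    lintegral_add_left mzF,
    lintegral_finsetSum _ (fun i _ => mzG i), lintegral_finsetSum _ (fun i _ =>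
      Finset.measurable_fun_sum _ fun j _ => mzK i j)]
  simp_rw [lintegral_finsetSum Finset.univ (fun (j : Fin 2) _ => mzK _ j)]
  calc _ ≤ c * (E ^ 2 * (E + N)) + ∑ i : Fin 2, 3 * (c * (E ^ 2 * (E + N))) +
        ∑ i : Fin 2, ∑ j : Fin 2, 9 * (c * (E ^ 2 * (E + N))) :=
        add_le_add (add_le_add bF (Finset.sum_le_sum fun i _ => bG i))
          (Finset.sum_le_sum fun i _ => Finset.sum_le_sum fun j _ => bK i j)
    _ = _ := by simp only [Fin.sum_univ_two]; ring

end SpatialDomain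

/-! ### Compactly supported test functions as elements of `H¹` -/

namespace SpatialDomain

variable {D : SpatialDomain}

theorem inner_L2_eq (f g : D.L2) : inner ℝ f g = ∫ x, f x * g x ∂D.vol := by
  rw [L2.inner_def]
  simp [mul_comm]

theorem memLp_vol_of_continuous {φ : Plane → ℝ} (h1 : Continuous φ) (h2 : HasCompactSupport φ) :
    MemLp φ 2 D.vol :=
  (h1.memLp_of_hasCompactSupport h2).restrict _

theorem setIntegral_eq_of_tsupport {φ : Plane → ℝ} (hφ : tsupport φ ⊆ D.carrier) (k : Plane → ℝ) :
    ∫ x, k x * φ x ∂D.vol = ∫ x, k x * φ x :=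
  setIntegral_eq_integral_of_forall_compl_eq_zero fun x hx => by
    rw [image_eq_zero_of_notMem_tsupport fun h => hx (hφ h), mul_zero]

theorem hasCompactSupport_fderiv_apply {φ : Plane → ℝ} (h : HasCompactSupport φ) (a : Plane) :
    HasCompactSupport fun x => fderiv ℝ φ x a :=
  h.of_isClosed_subset (isClosed_tsupport _) (tsupport_fderiv_apply_subset a)

theorem hasWeakGrad_of_contDiff {φ : Plane → ℝ} (h1 : ContDiff ℝ (⊤ : ℕ∞) φ)
    (h2 : HasCompactSupport φ) (h3 : tsupport φ ⊆ D.carrier) :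
    D.HasWeakGrad ((memLp_vol_of_continuous (D := D) h1.continuous h2).toLp φ)
      (fun i => (memLp_vol_of_continuous (D := D) (continuous_fderiv_dir h1 (coordDir i))
        (hasCompactSupport_fderiv_apply h2 _)).toLp _) := by
  intro ψ hψ i
  have hψ1 : ContDiff ℝ (⊤ : ℕ∞) ψ := by
    cases D with
    | torus => exact hψ.1
    | neumann U hU => exact hψ.1
  have e1 : ∫ x, (memLp_vol_of_continuous (D := D)
      h1.continuous h2).toLp φ x * partialDeriv ψ i x ∂D.vol =
      ∫ x, φ x * partialDeriv ψ i x ∂D.vol := by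
    refine integral_congr_ae ?_
    filter_upwards [(memLp_vol_of_continuous (D := D) h1.continuous h2).coeFn_toLp] with x hx
    rw [hx]
  have e2 : ∫ x, (memLp_vol_of_continuous (D := D) (continuous_fderiv_dir h1 (coordDir i))
        (hasCompactSupport_fderiv_apply h2 _)).toLp _ x * ψ x ∂D.vol =
      ∫ x, fderiv ℝ φ x (coordDir i) * ψ x ∂D.vol := by
    refine integral_congr_ae ?_
    filter_upwards [(memLp_vol_of_continuous (D := D) (continuous_fderiv_dir h1 (coordDir i))
        (hasCompactSupport_fderiv_apply h2 _)).coeFn_toLp] with x hx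
    rw [hx]
  rw [e1, e2]
  simp_rw [mul_comm (φ _), mul_comm _ (ψ _)]
  rw [setIntegral_eq_of_tsupport h3, setIntegral_eq_of_tsupport
    ((tsupport_fderiv_apply_subset _).trans h3)]
  simp_rw [mul_comm _ (φ _), mul_comm (ψ _)]
  have c1 := continuous_fderiv_dir h1 (coordDir i)
  have c2 := continuous_fderiv_dir hψ1 (coordDir i)
  exact integral_mul_fderiv_eq_neg_fderiv_mul_of_integrable
    ((c1.mul hψ1.continuous).integrable_of_hasCompactSupport
      (hasCompactSupport_fderiv_apply h2 _).mul_right)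
    ((h1.continuous.mul c2).integrable_of_hasCompactSupport h2.mul_right)
    ((h1.continuous.mul hψ1.continuous).integrable_of_hasCompactSupport h2.mul_right)
    (fun x _ => h1.differentiable (by simp) x) (fun x _ => hψ1.differentiable (by simp) x)

theorem eq_zero_of_inner_test {f : D.L2}
    (h : ∀ (φ : Plane → ℝ) (h1 : ContDiff ℝ (⊤ : ℕ∞) φ) (h2 : HasCompactSupport φ),
      tsupport φ ⊆ D.carrier →
      inner ℝ f ((memLp_vol_of_continuous (D := D) h1.continuous h2).toLp φ) = 0) : f = 0 := by
  have key := D.isOpen_carrier.ae_eq_zero_of_integral_contDiff_smul_eq_zero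
    (f := f) (μ := volume) (IntegrableOn.locallyIntegrableOn (integrable_coe f))
    (fun φ h1 h2 h3 => by
      have := h φ h1 h2 h3
      rw [inner_L2_eq] at this
      have e : ∫ x, f x * (memLp_vol_of_continuous (D := D) h1.continuous h2).toLp φ x ∂D.vol =
          ∫ x, f x * φ x ∂D.vol := by
        refine integral_congr_ae ?_
        filter_upwards [(memLp_vol_of_continuous (D := D) h1.continuous h2).coeFn_toLp] with x hx
        rw [hx]
      rw [e, setIntegral_eq_of_tsupport h3] at this
      simpa [mul_comm] using this)
  refine Lp.ext ?_
  filter_upwards [(ae_restrict_iff' D.measurableSet_carrier).2 key, Lp.coeFn_zero ℝ 2 D.vol]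
    with x h1 h2
  rw [h1, h2, Pi.zero_apply]

theorem inner_toLp_eq (k : D.L2) {ψ : Plane → ℝ} (hψ : MemLp ψ 2 D.vol) :
    inner ℝ k (hψ.toLp ψ) = ∫ x, zeroExt k D x * ψ x := by
  rw [inner_L2_eq, ← integral_indicator D.measurableSet_carrier]
  refine integral_congr_ae ?_
  filter_upwards [(ae_restrict_iff' D.measurableSet_carrier).1 hψ.coeFn_toLp] with x hx
  by_cases hxD : x ∈ D.carrier
  · simp only [zeroExt, indicator_of_mem hxD, hx hxD]
  · simp only [zeroExt, indicator_of_notMem hxD, zero_mul]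

/-- In the interior the Laplacian is the trace of the Hessian. -/
theorem HasHess.inner_test {f : D.L2} {g : Fin 2 → D.L2} {h : Fin 2 → Fin 2 → D.L2}
    (hh : D.HasHess f g h) {φ : Plane → ℝ} (h1 : ContDiff ℝ (⊤ : ℕ∞) φ)
    (h2 : HasCompactSupport φ) (h3 : tsupport φ ⊆ D.carrier) :
    ∑ i, inner ℝ (g i) ((memLp_vol_of_continuous (D := D) (continuous_fderiv_dir h1 (coordDir i))
        (hasCompactSupport_fderiv_apply h2 _)).toLp _) =
      -inner ℝ (∑ i, h i i) ((memLp_vol_of_continuous (D := D) h1.continuous h2).toLp φ) := by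
  rw [sum_inner, ← Finset.sum_neg_distrib]
  refine Finset.sum_congr rfl fun i _ => ?_
  have := (hh.2 i).weakDeriv i φ h1 h2 h3
  rw [inner_toLp_eq, inner_toLp_eq]
  exact this

/-! ### Real-valued forms of the Sobolev inequalities -/

theorem exists_sq_norm_le (D : SpatialDomain) : ∃ C : ℝ, 0 ≤ C ∧
    ∀ (f : D.L2) (g : Fin 2 → D.L2), D.HasWeakGrad f g →
      ∃ P : D.L2, P =ᵐ[D.vol] (fun x => f x * f x) ∧ ‖P‖ ≤ C * (‖f‖ * (‖f‖ + ∑ i, ‖g i‖)) := by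
  obtain ⟨C, hC, H⟩ := D.exists_sq_enorm_le
  refine ⟨C.toReal, ENNReal.toReal_nonneg, fun f g hfg => ?_⟩
  obtain ⟨P, hP, hn⟩ := H f g hfg
  refine ⟨P, hP, ?_⟩
  have hs : ∑ i, ‖g i‖ₑ ≠ ∞ := by simp [Fin.sum_univ_two]
  have := ENNReal.toReal_mono (ENNReal.mul_ne_top hC (ENNReal.mul_ne_top enorm_ne_top
    (ENNReal.add_ne_top.2 ⟨enorm_ne_top, hs⟩))) hn
  rw [ENNReal.toReal_mul, ENNReal.toReal_mul, ENNReal.toReal_add enorm_ne_top hs,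
    ENNReal.toReal_sum fun _ _ => enorm_ne_top] at this
  simpa only [toReal_enorm] using this

theorem exists_ae_abs_cube_le (D : SpatialDomain) : ∃ C : ℝ, 0 ≤ C ∧
    ∀ (f : D.L2) (g : Fin 2 → D.L2) (h : Fin 2 → Fin 2 → D.L2), D.HasHess f g h →
      ∀ᵐ x ∂D.vol, |f x| ^ 3 ≤ C * ((‖f‖ + ∑ i, ‖g i‖) ^ 2 *
        (‖f‖ + ∑ i, ‖g i‖ + ∑ i, ∑ j, ‖h i j‖)) := by
  obtain ⟨C, hC, H⟩ := D.exists_ae_enorm_cube_le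
  refine ⟨C.toReal, ENNReal.toReal_nonneg, fun f g h hh => ?_⟩
  filter_upwards [H f g h hh] with x hx
  have hs : ∑ i, ‖g i‖ₑ ≠ ∞ := by simp [Fin.sum_univ_two]
  have hs1 : ‖f‖ₑ + ∑ i, ‖g i‖ₑ ≠ ∞ := ENNReal.add_ne_top.2 ⟨enorm_ne_top, hs⟩
  have hs2 : ∀ i, ∑ j, ‖h i j‖ₑ ≠ ∞ := fun i => by simp [Fin.sum_univ_two]
  have hs3 : ∑ i, ∑ j, ‖h i j‖ₑ ≠ ∞ := by simp [Fin.sum_univ_two]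
  have := ENNReal.toReal_mono (ENNReal.mul_ne_top hC (ENNReal.mul_ne_top (ENNReal.pow_ne_top hs1)
    (ENNReal.add_ne_top.2 ⟨hs1, hs3⟩))) hx
  rw [ENNReal.toReal_mul, ENNReal.toReal_mul, ENNReal.toReal_pow, ENNReal.toReal_pow,
    ENNReal.toReal_add hs1 hs3, ENNReal.toReal_add enorm_ne_top hs,
    ENNReal.toReal_sum fun _ _ => enorm_ne_top, ENNReal.toReal_sum fun i _ => hs2 i] at this
  simp_rw [ENNReal.toReal_sum fun _ _ => enorm_ne_top] at this
  simpa only [toReal_enorm, Real.norm_eq_abs] using this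

end SpatialDomain

/-! ### Truncation of the nonlinearity -/

/-- The cubic nonlinearity, frozen outside `[-n, n]`. -/
noncomputable def truncCubic (n : ℕ) (r : ℝ) : ℝ := cubic (max (-(n : ℝ)) (min n r))

theorem truncCubic_zero (n : ℕ) : truncCubic n 0 = 0 := by
  have : (0 : ℝ) ≤ n := n.cast_nonneg
  simp [truncCubic, cubic]

theorem truncCubic_of_abs_le {n : ℕ} {r : ℝ} (h : |r| ≤ n) : truncCubic n r = cubic r := by
  rw [abs_le] at h
  rw [truncCubic, min_eq_right h.2, max_eq_right h.1]

theorem lipschitzWith_truncCubic (n : ℕ) : ∃ K : ℝ≥0, LipschitzWith K (truncCubic n) := by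
  have hn : (0 : ℝ) ≤ n := n.cast_nonneg
  have h1 : LipschitzWith 1 fun r : ℝ => max (-(n : ℝ)) (min n r) :=
    (LipschitzWith.id.const_min _).const_max _
  have hb : ∀ r : ℝ, |max (-(n : ℝ)) (min n r)| ≤ n := fun r => by
    rw [abs_le]
    exact ⟨le_max_left _ _, max_le (by linarith) (min_le_left _ _)⟩
  have key : ∀ a b : ℝ, |a| ≤ n → |b| ≤ n → |cubic a - cubic b| ≤ (1 + 3 * (n : ℝ) ^ 2) * |a - b| :=
    fun a b ha hb => by
      have e : cubic a - cubic b = (1 - (a ^ 2 + a * b + b ^ 2)) * (a - b) := by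
        simp only [cubic]; ring
      rw [e, abs_mul]
      refine mul_le_mul_of_nonneg_right ?_ (abs_nonneg _)
      have h1 : a ^ 2 ≤ (n : ℝ) ^ 2 := sq_le_sq' (abs_le.1 ha).1 (abs_le.1 ha).2
      have h2 : b ^ 2 ≤ (n : ℝ) ^ 2 := sq_le_sq' (abs_le.1 hb).1 (abs_le.1 hb).2
      rw [abs_le]
      constructor <;> nlinarith [sq_nonneg (a - b), sq_nonneg (a + b)]
  refine ⟨⟨1 + 3 * (n : ℝ) ^ 2, by positivity⟩, LipschitzWith.of_dist_le_mul fun r s => ?_⟩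
  rw [Real.dist_eq, Real.dist_eq]
  refine (key _ _ (hb r) (hb s)).trans ?_
  refine mul_le_mul_of_nonneg_left ?_ (by positivity)
  have := h1.dist_le_mul r s
  simpa [Real.dist_eq] using this

/-! ### Regularity of the limit equation -/

namespace SpatialDomain

variable {D : SpatialDomain}

/-- Slices of a path in `C⁰([0,T],H¹) ∩ L²([0,T],H²)`: bounds in terms of the second derivatives. -/
theorem MemL2H2.exists_bound {T : ℝ} {u : ℝ → D.L2} {g : ℝ → Fin 2 → D.L2}
    {h : ℝ → Fin 2 → Fin 2 → D.L2} (hu : D.MemL2H2 T u g h) (cu : ContinuousOn u (Icc 0 T))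
    (cg : ContinuousOn g (Icc 0 T)) :
    ∃ C : ℝ, 0 ≤ C ∧ ∀ᵐ t ∂volume.restrict (Icc 0 T), ‖u t‖ + ∑ i, ‖g t i‖ ≤ C ∧
      (∀ᵐ x ∂D.vol, |u t x| ^ 3 ≤ C * (1 + ∑ i, ∑ j, ‖h t i j‖)) ∧
      ∀ i, ∃ R : D.L2, R =ᵐ[D.vol] (fun x => g t i x * g t i x) ∧
        ‖R‖ ≤ C * (1 + ∑ i, ∑ j, ‖h t i j‖) := by
  obtain ⟨c1, hc1, H1⟩ := D.exists_ae_abs_cube_le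
  obtain ⟨c2, hc2, H2⟩ := D.exists_sq_norm_le
  have cE : ContinuousOn (fun t => ‖u t‖ + ∑ i, ‖g t i‖) (Icc 0 T) := by
    refine cu.norm.add (continuousOn_finsetSum _ fun i _ => ?_)
    exact ((continuous_apply i).comp_continuousOn cg).norm
  obtain ⟨B, hB⟩ := isCompact_Icc.exists_bound_of_continuousOn cE
  set b := |B| + 1 with hb
  have hb1 : 1 ≤ b := by simp [hb]
  have hEb : ∀ t ∈ Icc 0 T, ‖u t‖ + ∑ i, ‖g t i‖ ≤ b := fun t ht =>
    (le_abs_self _).trans ((hB t ht).trans ((le_abs_self B).trans (by simp [hb])))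
  refine ⟨b + c1 * (b ^ 2 * b) + c2 * (b * b), by positivity, ?_⟩
  filter_upwards [hu.1, ae_restrict_mem measurableSet_Icc] with t hh ht
  have hE := hEb t ht
  have k1 := H1 _ _ _ hh
  set E := ‖u t‖ + ∑ i, ‖g t i‖ with hEd
  set S := ∑ i, ∑ j, ‖h t i j‖ with hS
  have hE0 : 0 ≤ E := by positivity
  have hS0 : 0 ≤ S := Finset.sum_nonneg fun _ _ => Finset.sum_nonneg fun _ _ => norm_nonneg _
  clear_value E S b
  have hES : E + S ≤ b * (1 + S) := by nlinarith
  refine ⟨?_, ?_, fun i => ?_⟩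
  · have : 0 ≤ c1 * (b ^ 2 * b) + c2 * (b * b) := by positivity
    linarith
  · filter_upwards [k1] with x hx
    refine hx.trans ?_
    calc c1 * (E ^ 2 * (E + S)) ≤ c1 * (b ^ 2 * (b * (1 + S))) := by gcongr
      _ = c1 * (b ^ 2 * b) * (1 + S) := by ring
      _ ≤ (b + c1 * (b ^ 2 * b) + c2 * (b * b)) * (1 + S) := by
        refine mul_le_mul_of_nonneg_right ?_ (by positivity)
        have : 0 ≤ b + c2 * (b * b) := by positivity
        linarith
  · obtain ⟨R, hR, hn⟩ := H2 _ _ (hh.2 i)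
    refine ⟨R, hR, hn.trans ?_⟩
    have h1 : ‖g t i‖ ≤ E := by
      rw [hEd]
      exact (Finset.single_le_sum (f := fun i => ‖g t i‖)
      (fun _ _ => norm_nonneg _) (Finset.mem_univ i)).trans (le_add_of_nonneg_left (norm_nonneg _))
    have h2 : ∑ j, ‖h t i j‖ ≤ S := by
      rw [hS]
      exact Finset.single_le_sum (f := fun i => ∑ j, ‖h t i j‖)
        (fun _ _ => Finset.sum_nonneg fun _ _ => norm_nonneg _) (Finset.mem_univ i)
    calc c2 * (‖g t i‖ * (‖g t i‖ + ∑ j, ‖h t i j‖)) ≤ c2 * (b * (b * (1 + S))) := by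
          gcongr
          · exact h1.trans hE
          · linarith
      _ = c2 * (b * b) * (1 + S) := by ring
      _ ≤ (b + c1 * (b ^ 2 * b) + c2 * (b * b)) * (1 + S) := by
        refine mul_le_mul_of_nonneg_right ?_ (by positivity)
        have : 0 ≤ b + c1 * (b ^ 2 * b) := by positivity
        linarith

theorem MemL2H2.memLp_hess {T : ℝ} {u : ℝ → D.L2} {g : ℝ → Fin 2 → D.L2}
    {h : ℝ → Fin 2 → Fin 2 → D.L2} (hu : D.MemL2H2 T u g h) :
    MemLp (fun t => 1 + ∑ i, ∑ j, ‖h t i j‖) 2 (volume.restrict (Icc 0 T)) := by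
  have h1 : ∀ i j, MemLp (fun t => ‖h t i j‖) 2 (volume.restrict (Icc 0 T)) :=
    fun i j => (hu.2.2.2 i j).norm
  have h2 : ∀ i, MemLp (fun t => ∑ j, ‖h t i j‖) 2 (volume.restrict (Icc 0 T)) := fun i =>
    memLp_finsetSum Finset.univ fun j _ => h1 i j
  have h3 : MemLp (fun t => ∑ i, ∑ j, ‖h t i j‖) 2 (volume.restrict (Icc 0 T)) :=
    memLp_finsetSum Finset.univ fun i _ => h2 i
  exact (memLp_const (1 : ℝ)).add h3

theorem exists_cubic {f : D.L2} {M : ℝ} (hf : ∀ᵐ x ∂D.vol, |f x| ≤ M) :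
    ∃ N : D.L2, N =ᵐ[D.vol] fun x => cubic (f x) := by
  obtain ⟨n, hn⟩ := exists_nat_ge M
  obtain ⟨K, hK⟩ := lipschitzWith_truncCubic n
  refine ⟨hK.compLp (truncCubic_zero n) f, ?_⟩
  filter_upwards [hK.coeFn_compLp (truncCubic_zero n) f, hf] with x h1 h2
  rw [h1, Function.comp_apply, truncCubic_of_abs_le (h2.trans hn)]

/-- The nonlinearity along a path of functions which are bounded at almost all times. -/
theorem exists_cubic_path {T : ℝ} {u : ℝ → D.L2}
    (hu : AEStronglyMeasurable u (volume.restrict (Icc 0 T)))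
    (hb : ∀ᵐ t ∂volume.restrict (Icc 0 T), ∃ M : ℝ, ∀ᵐ x ∂D.vol, |u t x| ≤ M) :
    ∃ N : ℝ → D.L2, AEStronglyMeasurable N (volume.restrict (Icc 0 T)) ∧
      ∀ᵐ t ∂volume.restrict (Icc 0 T), N t =ᵐ[D.vol] fun x => cubic (u t x) := by
  classical
  set N : ℝ → D.L2 := fun t => if h : ∃ N : D.L2, N =ᵐ[D.vol] fun x => cubic (u t x)
    then h.choose else 0 with hN
  have hNt : ∀ᵐ t ∂volume.restrict (Icc 0 T), N t =ᵐ[D.vol] fun x => cubic (u t x) := by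
    filter_upwards [hb] with t ht
    obtain ⟨M, hM⟩ := ht
    have h := exists_cubic hM
    simp only [hN, dif_pos h]
    exact h.choose_spec
  refine ⟨N, ?_, hNt⟩
  choose K hK using lipschitzWith_truncCubic
  -- The truncated nonlinearities are Lipschitz on L², hence give measurable paths. At almost every
  -- time u(t) is bounded, so the truncations are eventually equal to the cubic.
  refine aestronglyMeasurable_of_tendsto_ae atTop
    (f := fun n t => (hK n).compLp (truncCubic_zero n) (u t))
    (fun n => ((hK n).continuous_compLp (truncCubic_zero n)).comp_aestronglyMeasurable hu) ?_
  filter_upwards [hNt, hb] with t ht hbt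
  obtain ⟨M, hM⟩ := hbt
  obtain ⟨n₀, hn₀⟩ := exists_nat_ge M
  refine tendsto_const_nhds.congr' ?_
  filter_upwards [eventually_ge_atTop n₀] with n hn
  refine Lp.ext ?_
  filter_upwards [ht, (hK n).coeFn_compLp (truncCubic_zero n) (u t), hM] with x h1 h2 h3
  rw [h1, h2, Function.comp_apply,
      truncCubic_of_abs_le (h3.trans (hn₀.trans (by exact_mod_cast hn)))]

theorem norm_le_of_ae_abs_le {f : D.L2} {k : D.L2} {M : ℝ} (hM : 0 ≤ M)
    (h : ∀ᵐ x ∂D.vol, |f x| ≤ |k x| + M) :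
    ‖f‖ ≤ ‖k‖ + M * ‖(memLp_const 1 : MemLp (fun _ : Plane => (1 : ℝ)) 2 D.vol).toLp‖ := by
  set one := (memLp_const 1 : MemLp (fun _ : Plane => (1 : ℝ)) 2 D.vol).toLp with h1
  have e : |k| + M • one =ᵐ[D.vol] fun x => |k x| + M := by
    filter_upwards [Lp.coeFn_add |k| (M • one), Lp.coeFn_abs k, Lp.coeFn_smul M one,
      (memLp_const 1 : MemLp (fun _ : Plane => (1 : ℝ)) 2 D.vol).coeFn_toLp] with x a b c d
    rw [a, Pi.add_apply, b, c, Pi.smul_apply, h1, d, smul_eq_mul, mul_one]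
  calc ‖f‖ ≤ ‖|k| + M • one‖ := by
        refine Lp.norm_le_norm_of_ae_le ?_
        filter_upwards [h, e] with x hx he
        rw [he, Real.norm_eq_abs, Real.norm_eq_abs]
        exact hx.trans (le_abs_self _)
    _ ≤ ‖|k|‖ + ‖M • one‖ := norm_add_le _ _
    _ = _ := by rw [norm_abs_eq_norm, norm_smul, Real.norm_of_nonneg hM]

end SpatialDomain

/-- An integrable function with vanishing primitive vanishes almost everywhere. -/
theorem ae_eq_zero_of_intervalIntegral_eq_zero {T : ℝ} (hT : 0 ≤ T) {f : ℝ → ℝ}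
    (hf : IntegrableOn f (Icc 0 T)) (h : ∀ t ∈ Icc 0 T, ∫ s in (0)..t, f s = 0) :
    ∀ᵐ t ∂volume.restrict (Icc 0 T), f t = 0 := by
  have hi : IntervalIntegrable f volume 0 T :=
    (intervalIntegrable_iff_integrableOn_Icc_of_le hT).2 hf
  have key := hi.ae_hasDerivAt_integral
  rw [uIcc_of_le hT] at key
  have hne : ∀ a : ℝ, ∀ᵐ x : ℝ, x ≠ a := fun a => by simp [ae_iff]
  refine (ae_restrict_iff' measurableSet_Icc).2 ?_
  filter_upwards [key, hne 0, hne T] with t ht h0 hT' htm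
  have hd := ht htm 0 ⟨le_rfl, hT⟩
  have hc : HasDerivAt (fun x => ∫ s in (0)..x, f s) 0 t := by
    refine (hasDerivAt_const t (0 : ℝ)).congr_of_eventuallyEq ?_
    filter_upwards [Icc_mem_nhds (lt_of_le_of_ne htm.1 h0.symm) (lt_of_le_of_ne htm.2 hT')] with x hx
    exact h x hx
  exact hd.unique hc

namespace SpatialDomain

variable {D : SpatialDomain}

theorem inner_intervalIntegral {T : ℝ} {F : ℝ → D.L2} (hF : IntegrableOn F (Icc 0 T)) (φ : D.L2)
    {t : ℝ} (ht : t ∈ Icc 0 T) :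
    inner ℝ (∫ s in (0)..t, F s) φ = ∫ s in (0)..t, inner ℝ (F s) φ := by
  have hi : IntervalIntegrable F volume 0 t :=
    (intervalIntegrable_iff_integrableOn_Icc_of_le ht.1).2 (hF.mono_set (Icc_subset_Icc_right ht.2))
  rw [real_inner_comm]
  simp_rw [real_inner_comm φ]
  exact ((innerSL ℝ φ).intervalIntegral_comp_comm hi).symm

theorem intervalIntegral_congr_ae_Icc {T : ℝ} {f g : ℝ → ℝ}
    (h : ∀ᵐ s ∂volume.restrict (Icc 0 T), f s = g s) {t : ℝ} (ht : t ∈ Icc 0 T) :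
    ∫ s in (0)..t, f s = ∫ s in (0)..t, g s := by
  refine intervalIntegral.integral_congr_ae ?_
  filter_upwards [(ae_restrict_iff' measurableSet_Icc).1 h] with s hs hst
  rw [uIoc_of_le ht.1] at hst
  exact hs ⟨hst.1.le, hst.2.trans ht.2⟩

/-- The limit equation holds in `L²`, and its solution satisfies the Neumann condition at almost all
times. -/
theorem limit_equation {C₀ T : ℝ} (hT : 0 < T) {u N : ℝ → D.L2} {g : ℝ → Fin 2 → D.L2}
    {h : ℝ → Fin 2 → Fin 2 → D.L2} (hu : D.MemL2H2 T u g h)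
    (hN : ∀ᵐ t ∂volume.restrict (Icc 0 T), N t =ᵐ[D.vol] fun x => cubic (u t x))
    (hN2 : MemLp N 2 (volume.restrict (Icc 0 T)))
    (hw : ∀ (φ : D.L2) (γ : Fin 2 → D.L2), D.HasWeakGrad φ γ → ∀ t ∈ Icc 0 T,
      inner ℝ (u t) φ = inner ℝ (u 0) φ + ∫ s in (0)..t,
        (-∑ i, inner ℝ (g s i) (γ i) + ∫ x, (cubic (u s x) - 3 * C₀ * u s x) * φ x ∂D.vol)) :
    (∀ᵐ t ∂volume.restrict (Icc 0 T), D.HasLaplacian (u t) (∑ i, h t i i)) ∧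
    ∀ t ∈ Icc 0 T, u t = u 0 + ∫ s in (0)..t, (∑ i, h s i i + (N s - (3 * C₀) • u s)) := by
  set μ := volume.restrict (Icc 0 T) with hμ
  set L : ℝ → D.L2 := fun s => ∑ i, h s i i with hL
  set R : ℝ → D.L2 := fun s => N s - (3 * C₀) • u s with hR
  have hL2 : MemLp L 2 μ := memLp_finsetSum' Finset.univ fun i _ => hu.2.2.2 i i
  have hu2 : MemLp ((3 * C₀) • u) 2 μ := hu.2.1.const_smul (3 * C₀)
  have hR2 : MemLp R 2 μ := hN2.sub hu2
  have iL : IntegrableOn L (Icc 0 T) := hL2.integrable (by norm_num)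
  have iR : IntegrableOn R (Icc 0 T) := hR2.integrable (by norm_num)
  have iLR : IntegrableOn (fun s => L s + R s) (Icc 0 T) := iL.add iR
  have hRx : ∀ᵐ s ∂μ, ∀ φ : D.L2, ∫ x, (cubic (u s x) - 3 * C₀ * u s x) * φ x ∂D.vol =
      inner ℝ (R s) φ := by
    filter_upwards [hN] with s hs φ
    rw [inner_L2_eq]
    refine integral_congr_ae ?_
    filter_upwards [hs, Lp.coeFn_sub (N s) ((3 * C₀) • u s), Lp.coeFn_smul (3 * C₀) (u s)]
      with x h1 h2 h3
    rw [h2, Pi.sub_apply, h1, h3, Pi.smul_apply, smul_eq_mul]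
  have hw' : ∀ (φ : D.L2) (γ : Fin 2 → D.L2), D.HasWeakGrad φ γ → ∀ t ∈ Icc 0 T,
      inner ℝ (u t) φ = inner ℝ (u 0) φ + ∫ s in (0)..t,
        (-∑ i, inner ℝ (g s i) (γ i) + inner ℝ (R s) φ) := fun φ γ hφ t ht => by
    rw [hw φ γ hφ t ht]
    congr 1
    refine intervalIntegral_congr_ae_Icc ?_ ht
    filter_upwards [hRx] with s hs
    rw [hs φ]
  -- Compactly supported tests already identify the equation in L², with Δu the trace of the
  -- Hessian.
  have strong : ∀ t ∈ Icc 0 T, u t = u 0 + ∫ s in (0)..t, (L s + R s) := fun t ht => by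
    rw [← sub_eq_zero]
    refine eq_zero_of_inner_test fun φ h1 h2 h3 => ?_
    rw [inner_sub_left, inner_add_left, inner_intervalIntegral iLR _ ht,
      hw' _ _ (hasWeakGrad_of_contDiff h1 h2 h3) t ht, sub_eq_zero]
    congr 1
    refine intervalIntegral_congr_ae_Icc ?_ ht
    filter_upwards [hu.1] with s hs
    rw [hs.inner_test h1 h2 h3, neg_neg, inner_add_left]
  refine ⟨?_, strong⟩
  have iinner : ∀ {F : ℝ → D.L2}, IntegrableOn F (Icc 0 T) → ∀ φ : D.L2,
      IntegrableOn (fun s => inner ℝ (F s) φ) (Icc 0 T) := fun hF φ => hF.inner_const φ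
  -- Comparing the strong equation with the weak one for a general φ in H¹, the difference of the
  -- integrands has zero primitive. This is Green's formula without boundary term at almost every
  -- time.
  have hae : ∀ (φ : D.L2) (γ : Fin 2 → D.L2), D.HasWeakGrad φ γ →
      ∀ᵐ s ∂μ, ∑ i, inner ℝ (g s i) (γ i) = -inner ℝ (L s) φ := fun φ γ hφ => by
    have ig : IntegrableOn (fun s => ∑ i, inner ℝ (g s i) (γ i)) (Icc 0 T) :=
      integrable_finsetSum _ fun i _ => iinner ((hu.2.2.1 i).integrable (by norm_num)) (γ i)
    have := ae_eq_zero_of_intervalIntegral_eq_zero hT.le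
      (f := fun s => (-∑ i, inner ℝ (g s i) (γ i) + inner ℝ (R s) φ) - inner ℝ (L s + R s) φ)
      ((ig.neg.add (iinner iR φ)).sub (iinner iLR φ)) (fun t ht => by
        have hi : ∀ {F : ℝ → ℝ}, IntegrableOn F (Icc 0 T) → IntervalIntegrable F volume 0 t :=
          fun hF => (intervalIntegrable_iff_integrableOn_Icc_of_le ht.1).2
            (hF.mono_set (Icc_subset_Icc_right ht.2))
        have i1 : IntegrableOn (fun s => -∑ i, inner ℝ (g s i) (γ i) + inner ℝ (R s) φ) (Icc 0 T) :=
          ig.neg.add (iinner iR φ)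
        rw [intervalIntegral.integral_sub (hi i1) (hi (iinner iLR φ)),
          ← inner_intervalIntegral iLR φ ht]
        have e1 := hw' φ γ hφ t ht
        rw [strong t ht, inner_add_left] at e1
        linarith)
    filter_upwards [this] with s hs
    rw [inner_add_left] at hs
    linarith
  have : Fact ((2 : ℝ≥0∞) ≠ ∞) := ⟨by simp⟩
  have : SecondCountableTopology D.L2 := Lp.SecondCountableTopology
  -- The exceptional set of times depends on φ. The graph of the weak gradient is separable, so a
  -- countable dense family of tests gives a single null set, and both sides are continuous in the
  -- graph norm.
  let Γ : Set (D.L2 × (Fin 2 → D.L2)) := {q | D.HasWeakGrad q.1 q.2}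
  obtain ⟨c, hc, hcΓ, hΓc⟩ :=
      (TopologicalSpace.IsSeparable.of_separableSpace Γ).exists_countable_dense_subset
  have hall : ∀ᵐ s ∂μ, ∀ q ∈ c, ∑ i, inner ℝ (g s i) (q.2 i) = -inner ℝ (L s) q.1 :=
    (ae_ball_iff hcΓ).2 fun q hq => hae q.1 q.2 (hc hq)
  filter_upwards [hall, hu.1] with s hs hh
  refine ⟨g s, hh.1, fun φ γ hφ => ?_⟩
  have hcl : IsClosed {q : D.L2 × (Fin 2 → D.L2) | ∑ i,
      inner ℝ (g s i) (q.2 i) = -inner ℝ (L s) q.1} :=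
    isClosed_eq (by fun_prop) (by fun_prop)
  exact closure_minimal hs hcl (hΓc (show (φ, γ) ∈ Γ from hφ))

/-- The pointwise bound of |u|³ by C(1 + Σ‖∂ᵢⱼu‖) is square integrable in time, so f(u) lies in
L²(0,T;L²). That is what `limit_equation` needs to upgrade the weak equation. -/
theorem IsLimitSolution.exists_regular {C₀ T : ℝ} (hT : 0 < T) {u : ℝ → D.L2}
    (hu : D.IsLimitSolution C₀ T u) :
    ContinuousOn u (Icc 0 T) ∧
    ∃ (g : ℝ → Fin 2 → D.L2) (h : ℝ → Fin 2 → Fin 2 → D.L2) (N : ℝ → D.L2) (C : ℝ), 0 ≤ C ∧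
      D.MemL2H2 T u g h ∧
      (∀ᵐ t ∂volume.restrict (Icc 0 T), D.HasLaplacian (u t) (∑ i, h t i i)) ∧
      (∀ᵐ t ∂volume.restrict (Icc 0 T), N t =ᵐ[D.vol] fun x => cubic (u t x)) ∧
      MemLp N 2 (volume.restrict (Icc 0 T)) ∧
      (∀ t ∈ Icc 0 T, u t = u 0 + ∫ s in (0)..t, (∑ i, h s i i + (N s - (3 * C₀) • u s))) ∧
      ∀ᵐ t ∂volume.restrict (Icc 0 T), ‖u t‖ + ∑ i, ‖g t i‖ ≤ C ∧
        (∀ᵐ x ∂D.vol, |u t x| ^ 3 ≤ C * (1 + ∑ i, ∑ j, ‖h t i j‖)) ∧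
        ∀ i, ∃ R : D.L2, R =ᵐ[D.vol] (fun x => g t i x * g t i x) ∧
          ‖R‖ ≤ C * (1 + ∑ i, ∑ j, ‖h t i j‖) := by
  obtain ⟨g, h, -, cu, cg, hH, hw⟩ := hu
  refine ⟨cu, g, h, ?_⟩
  obtain ⟨C, hC, hb⟩ := hH.exists_bound cu cg
  obtain ⟨N, mN, hN⟩ := exists_cubic_path hH.2.1.1 (by
    filter_upwards [hH.1] with t ht using ht.exists_bdd)
  have hN2 : MemLp N 2 (volume.restrict (Icc 0 T)) := by
    refine MemLp.of_le_mul (c := 1) (g := fun t => ‖u t‖ + C * (1 + ∑ i, ∑ j, ‖h t i j‖) *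
      ‖(memLp_const 1 : MemLp (fun _ : Plane => (1 : ℝ)) 2 D.vol).toLp‖)
      (hH.2.1.norm.add ((hH.memLp_hess.const_mul C).mul_const _)) mN ?_
    filter_upwards [hb, hN] with t h1 h2
    rw [one_mul]
    have hS : 0 ≤ ∑ i, ∑ j, ‖h t i j‖ :=
      Finset.sum_nonneg fun _ _ => Finset.sum_nonneg fun _ _ => norm_nonneg _
    refine le_trans (norm_le_of_ae_abs_le (k := u t) (M := C * (1 + ∑ i, ∑ j, ‖h t i j‖))
      (mul_nonneg hC (by linarith)) ?_) (le_abs_self _)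
    filter_upwards [h1.2.1, h2] with x h3 h4
    rw [h4, cubic]
    refine (abs_sub _ _).trans ?_
    rw [abs_pow]
    linarith
  obtain ⟨h1, h2⟩ := limit_equation hT hH hN hN2 hw
  exact ⟨N, C, hC, hH, h1, hN, hN2, h2, hb⟩

end SpatialDomain

/-! ### Continuous functions of time and space as paths in `L²` -/

namespace SpatialDomain

variable {D : SpatialDomain}

theorem ContTime.continuousOn {T : ℝ} {w : ℝ → Plane → ℝ} (hw : D.ContTime T w) :
    ContinuousOn (fun q : ℝ × Plane => w q.1 q.2) (Icc 0 T ×ˢ closure D.carrier) := by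
  cases D with
  | torus => exact hw.1.mono (prod_mono subset_rfl (subset_univ _))
  | neumann U hU => exact hw

theorem isCompact_closure_carrier (D : SpatialDomain) : IsCompact (closure D.carrier) :=
  D.isBounded_carrier.isCompact_closure

theorem exists_abs_le_of_continuousOn {T : ℝ} {w : ℝ → Plane → ℝ}
    (hw : ContinuousOn (fun q : ℝ × Plane => w q.1 q.2) (Icc 0 T ×ˢ closure D.carrier)) :
    ∃ M : ℝ, 0 ≤ M ∧ ∀ t ∈ Icc 0 T, ∀ x ∈ closure D.carrier, |w t x| ≤ M := by
  obtain ⟨M, hM⟩ := (isCompact_Icc.prod D.isCompact_closure_carrier).exists_bound_of_continuousOn hw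
  exact ⟨|M|, abs_nonneg _, fun t ht x hx => (hM (t, x) ⟨ht, hx⟩).trans (le_abs_self _)⟩

theorem memLp_slice {T : ℝ} {w : ℝ → Plane → ℝ}
    (hw : ContinuousOn (fun q : ℝ × Plane => w q.1 q.2) (Icc 0 T ×ˢ closure D.carrier)) {t : ℝ}
    (ht : t ∈ Icc 0 T) (p : ℝ≥0∞) : MemLp (w t) p D.vol := by
  obtain ⟨M, -, hM⟩ := exists_abs_le_of_continuousOn hw
  have hc : ContinuousOn (w t) D.carrier := by
    have : ContinuousOn (fun x : Plane => (t, x)) D.carrier := by fun_prop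
    exact hw.comp this fun x hx => ⟨ht, subset_closure hx⟩
  refine MemLp.of_bound (hc.aestronglyMeasurable D.measurableSet_carrier) M ?_
  filter_upwards [ae_restrict_mem D.measurableSet_carrier] with x hx
  exact hM t ht x (subset_closure hx)

theorem exists_path {T : ℝ} {w : ℝ → Plane → ℝ}
    (hw : ContinuousOn (fun q : ℝ × Plane => w q.1 q.2) (Icc 0 T ×ˢ closure D.carrier)) :
    ∃ Θ : ℝ → D.L2, (∀ t ∈ Icc 0 T, Θ t =ᵐ[D.vol] w t) ∧ ContinuousOn Θ (Icc 0 T) := by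
  classical
  set Θ : ℝ → D.L2 := fun t => if h : MemLp (w t) 2 D.vol then h.toLp else 0 with hΘ
  have hΘt : ∀ t ∈ Icc 0 T, Θ t =ᵐ[D.vol] w t := fun t ht => by
    have h := memLp_slice hw ht 2
    simp only [hΘ, dif_pos h]
    exact h.coeFn_toLp
  refine ⟨Θ, hΘt, ?_⟩
  set c := ‖(memLp_const 1 : MemLp (fun _ : Plane => (1 : ℝ)) 2 D.vol).toLp‖ with hc
  have hu := (isCompact_Icc.prod D.isCompact_closure_carrier).uniformContinuousOn_of_continuous hw
  rw [Metric.uniformContinuousOn_iff] at hu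
  rw [Metric.continuousOn_iff]
  intro t ht ε hε
  have hc0 : 0 ≤ c := norm_nonneg _
  obtain ⟨δ, hδ, H⟩ := hu (ε / (c + 1)) (by positivity)
  refine ⟨δ, hδ, fun s hs hst => ?_⟩
  have hb := norm_le_of_ae_abs_le (D := D) (f := Θ s - Θ t) (k := 0)
      (M := ε / (c + 1)) (by positivity) (by
    filter_upwards [hΘt s hs, hΘt t ht, Lp.coeFn_sub (Θ s) (Θ t), Lp.coeFn_zero ℝ 2 D.vol,
      ae_restrict_mem D.measurableSet_carrier] with x h1 h2 h3 h4 hx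
    rw [h3, Pi.sub_apply, h1, h2, h4, Pi.zero_apply, abs_zero, zero_add]
    have := H (s, x) ⟨hs, subset_closure hx⟩ (t, x) ⟨ht, subset_closure hx⟩ (by
      rw [Prod.dist_eq, dist_self]; exact max_lt hst hδ)
    rw [Real.dist_eq] at this
    exact this.le)
  rw [dist_eq_norm]
  rw [norm_zero, zero_add] at hb
  refine hb.trans_lt ?_
  rw [div_mul_eq_mul_div, div_lt_iff₀ (by positivity)]
  nlinarith

/-! ### The dual norm -/

theorem normNegOne_congr {w w' : Plane → ℝ} (h : w =ᵐ[D.vol] w') :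
    D.normNegOne w = D.normNegOne w' := by
  have : ∀ φ : D.L2, ∫ x, w x * φ x ∂D.vol = ∫ x, w' x * φ x ∂D.vol := fun φ =>
    integral_congr_ae (by filter_upwards [h] with x hx; rw [hx])
  simp only [normNegOne, this]

theorem enorm_inner_le_normNegOne (k : D.L2) {φ : D.L2} {γ : Fin 2 → D.L2}
    (hφ : D.HasWeakGrad φ γ) (h1 : ‖φ‖ ^ 2 + ∑ i, ‖γ i‖ ^ 2 ≤ 1) :
    ‖inner ℝ k φ‖ₑ ≤ D.normNegOne k := by
  rw [inner_L2_eq]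
  exact le_iSup_of_le φ (le_iSup_of_le γ (le_iSup_of_le hφ (le_iSup_of_le h1 le_rfl)))

theorem normNegOne_le_iff (k : D.L2) {b : ℝ≥0∞} : D.normNegOne k ≤ b ↔
    ∀ (φ : D.L2) (γ : Fin 2 → D.L2), D.HasWeakGrad φ γ → ‖φ‖ ^ 2 + ∑ i, ‖γ i‖ ^ 2 ≤ 1 →
      ‖inner ℝ k φ‖ₑ ≤ b := by
  simp only [normNegOne, iSup_le_iff, inner_L2_eq]

theorem enorm_inner_le (k : D.L2) {φ : D.L2} {γ : Fin 2 → D.L2}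
    (h1 : ‖φ‖ ^ 2 + ∑ i, ‖γ i‖ ^ 2 ≤ 1) : ‖inner ℝ k φ‖ₑ ≤ ‖k‖ₑ := by
  have h0 : 0 ≤ ∑ i, ‖γ i‖ ^ 2 := Finset.sum_nonneg fun _ _ => sq_nonneg _
  have hφ : ‖φ‖ ≤ 1 := by
    rw [← sq_le_one_iff₀ (norm_nonneg _)]; linarith
  refine enorm_le_iff_norm_le.2 ((norm_inner_le_norm _ _).trans ?_)
  exact mul_le_of_le_one_right (norm_nonneg _) hφ

theorem normNegOne_le_enorm (k : D.L2) : D.normNegOne k ≤ ‖k‖ₑ :=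
  (normNegOne_le_iff k).2 fun _ _ _ h1 => enorm_inner_le k h1

theorem normNegOne_ne_top (k : D.L2) : D.normNegOne k ≠ ∞ :=
  ((normNegOne_le_enorm k).trans_lt enorm_lt_top).ne

/-- The norm in `H⁻¹` of an element of `L²`, as a real number. -/
noncomputable def negNorm (k : D.L2) : ℝ := (D.normNegOne k).toReal

theorem negNorm_nonneg (k : D.L2) : 0 ≤ negNorm k := ENNReal.toReal_nonneg

theorem ofReal_negNorm (k : D.L2) : ENNReal.ofReal (negNorm k) = D.normNegOne k :=
  ENNReal.ofReal_toReal (normNegOne_ne_top k)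

/-- Gives Lipschitz continuity on L², hence measurability in time of the H⁻¹ norm along continuous
paths. -/
theorem negNorm_le_add (k k' : D.L2) : negNorm k ≤ negNorm k' + ‖k - k'‖ := by
  have h : D.normNegOne k ≤ D.normNegOne k' + ‖k - k'‖ₑ := (normNegOne_le_iff k).2
    fun φ γ hφ h1 => by
      have e : inner ℝ k φ = inner ℝ k' φ + inner ℝ (k - k') φ := by
        rw [← inner_add_left]; congr 1; abel
      rw [e]
      exact (enorm_add_le _ _).trans
        (add_le_add (enorm_inner_le_normNegOne k' hφ h1) (enorm_inner_le _ h1))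
  have := ENNReal.toReal_mono (ENNReal.add_ne_top.2 ⟨normNegOne_ne_top k', enorm_ne_top⟩) h
  rwa [ENNReal.toReal_add (normNegOne_ne_top k') enorm_ne_top, toReal_enorm] at this

theorem continuous_negNorm : Continuous (negNorm : D.L2 → ℝ) := by
  have : LipschitzWith 1 (negNorm : D.L2 → ℝ) := LipschitzWith.of_le_add fun k k' => by
    rw [dist_eq_norm]; exact negNorm_le_add k k'
  exact this.continuous

/-- The duality between `H⁻¹` and `H¹`. -/
theorem inner_sq_le_negNorm (k : D.L2) {φ : D.L2} {γ : Fin 2 → D.L2} (hφ : D.HasWeakGrad φ γ) :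
    inner ℝ k φ ^ 2 ≤ negNorm k ^ 2 * (‖φ‖ ^ 2 + ∑ i, ‖γ i‖ ^ 2) := by
  set Q := ‖φ‖ ^ 2 + ∑ i, ‖γ i‖ ^ 2 with hQ
  have hs : 0 ≤ ∑ i, ‖γ i‖ ^ 2 := Finset.sum_nonneg fun _ _ => sq_nonneg _
  have hQ0 : 0 ≤ Q := add_nonneg (sq_nonneg _) hs
  rcases hQ0.eq_or_lt with h0 | hpos
  · have : φ = 0 := by
      have : ‖φ‖ ^ 2 = 0 := le_antisymm (by linarith) (sq_nonneg _)
      simpa using this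
    rw [this, inner_zero_right, ← h0]
    simp
  -- Scaling φ to unit norm in H¹, where the supremum defining the dual norm applies.
  · set r := (Real.sqrt Q)⁻¹ with hr
    have hr2 : r ^ 2 * Q = 1 := by
      rw [hr, inv_pow, Real.sq_sqrt hQ0, inv_mul_cancel₀ hpos.ne']
    have hg : D.HasWeakGrad (r • φ) (fun i => r • γ i) := by
      rw [hasWeakGrad_iff]
      intro i
      have h := (hasWeakGrad_iff.1 hφ i).const_mul r
      refine h.congr_on subset_rfl ?_ ?_
      · filter_upwards [D.ae_wrap (Lp.coeFn_smul r φ)] with x hx hxd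
        rw [hx hxd, Pi.smul_apply, smul_eq_mul]
      · filter_upwards [D.ae_wrap (Lp.coeFn_smul r (γ i))] with x hx hxd
        rw [hx hxd, Pi.smul_apply, smul_eq_mul]
    have h1 : ‖r • φ‖ ^ 2 + ∑ i, ‖r • γ i‖ ^ 2 ≤ 1 := by
      simp only [norm_smul, mul_pow, ← Finset.mul_sum, ← mul_add, Real.norm_eq_abs, sq_abs]
      exact hr2.le
    have h2 := ENNReal.toReal_mono (normNegOne_ne_top k) (enorm_inner_le_normNegOne k hg h1)
    rw [toReal_enorm, inner_smul_right, Real.norm_eq_abs] at h2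
    have h3 : (r * inner ℝ k φ) ^ 2 ≤ negNorm k ^ 2 := by
      rw [← sq_abs (r * _)]
      exact pow_le_pow_left₀ (abs_nonneg _) h2 2
    calc inner ℝ k φ ^ 2 = (r * inner ℝ k φ) ^ 2 * Q := by
          rw [mul_pow, mul_right_comm, hr2, one_mul]
      _ ≤ _ := mul_le_mul_of_nonneg_right h3 hQ0

theorem HasWeakGrad.sub {f g : D.L2} {f' g' : Fin 2 → D.L2} (hf : D.HasWeakGrad f f')
    (hg : D.HasWeakGrad g g') : D.HasWeakGrad (f - g) (fun i => f' i - g' i) := by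
  rw [hasWeakGrad_iff] at hf hg ⊢
  intro i φ h1 h2 h3
  have key : ∀ (a b : D.L2) {ψ : Plane → ℝ}, Continuous ψ → HasCompactSupport ψ →
      tsupport ψ ⊆ D.dom → ∫ x, (a - b : D.L2) (D.wrap x) * ψ x =
        (∫ x, a (D.wrap x) * ψ x) - ∫ x, b (D.wrap x) * ψ x := fun a b ψ c1 c2 c3 => by
    rw [← integral_sub (integrable_wrap_mul a c1 c2 c3) (integrable_wrap_mul b c1 c2 c3)]
    refine integral_congr_ae ?_
    filter_upwards [D.ae_wrap (Lp.coeFn_sub a b)] with x hx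
    by_cases hxd : x ∈ D.dom
    · rw [hx hxd, Pi.sub_apply, sub_mul]
    · rw [image_eq_zero_of_notMem_tsupport fun h => hxd (c3 h)]
      simp
  have c := continuous_fderiv_dir h1 (coordDir i)
  rw [key f g c (hasCompactSupport_fderiv_apply h2 _) ((tsupport_fderiv_apply_subset _).trans h3),
    key _ _ h1.continuous h2 h3, hf i φ h1 h2 h3, hg i φ h1 h2 h3]
  ring

theorem HasWeakGrad.unique {f : D.L2} {g g' : Fin 2 → D.L2} (hg : D.HasWeakGrad f g)
    (hg' : D.HasWeakGrad f g') : g = g' := by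
  funext i
  rw [← sub_eq_zero]
  refine eq_zero_of_inner_test fun φ h1 h2 h3 => ?_
  have e1 := hg.weakDeriv i φ h1 h2 h3
  have e2 := hg'.weakDeriv i φ h1 h2 h3
  rw [inner_sub_left, inner_toLp_eq, inner_toLp_eq]
  linarith

theorem HasLaplacian.inner_eq {w l : D.L2} (hw : D.HasLaplacian w l) {g : Fin 2 → D.L2}
    (hg : D.HasWeakGrad w g) {φ : D.L2} {γ : Fin 2 → D.L2} (hφ : D.HasWeakGrad φ γ) :
    ∑ i, inner ℝ (g i) (γ i) = -inner ℝ l φ := by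
  obtain ⟨g', hg', H⟩ := hw
  rw [hg.unique hg']
  exact H φ γ hφ

theorem HasLaplacian.sub {w w' l l' : D.L2} (h : D.HasLaplacian w l) (h' : D.HasLaplacian w' l') :
    D.HasLaplacian (w - w') (l - l') := by
  obtain ⟨g, hg, H⟩ := h
  obtain ⟨g', hg', H'⟩ := h'
  refine ⟨_, hg.sub hg', fun φ γ hφ => ?_⟩
  simp only [inner_sub_left, Finset.sum_sub_distrib, H φ γ hφ, H' φ γ hφ]
  ring

end SpatialDomain

/-! ### The pointwise inequality behind the energy estimate -/

/-- The right side is w²(w² + 3wa + 3a²). After multiplication by 6 the difference of the two sides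
is w² times the form 5w² + 18wa + 17a², which is positive definite since 18² = 324 < 340 = 4·5·17.
-/
theorem cube_sub_cube_mul_ge (w a : ℝ) :
    w ^ 2 * (w ^ 2 + a ^ 2) / 6 ≤ ((w + a) ^ 3 - a ^ 3) * w := by
  have : 0 ≤ w ^ 2 * (5 * w ^ 2 + 18 * w * a + 17 * a ^ 2) := by
    refine mul_nonneg (sq_nonneg _) ?_
    nlinarith [sq_nonneg (5 * w + 9 * a)]
  nlinarith

theorem add_pow_four_le (x y : ℝ) : (x + y) ^ 4 ≤ 8 * x ^ 4 + 8 * y ^ 4 := by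
  have h1 : 0 ≤ (x - y) ^ 2 * (7 * x ^ 2 + 10 * x * y + 7 * y ^ 2) := by
    refine mul_nonneg (sq_nonneg _) ?_
    nlinarith [sq_nonneg (x + y), sq_nonneg x, sq_nonneg y]
  linarith [(by ring : (x - y) ^ 2 * (7 * x ^ 2 + 10 * x * y + 7 * y ^ 2) =
    8 * x ^ 4 + 8 * y ^ 4 - (x + y) ^ 4)]

theorem neg_sum_mul_le (w u z : ℝ) : -((w + u + z) * w) ≤ u ^ 2 + z ^ 2 := by
  linarith [sq_nonneg (w + u), sq_nonneg (w + z), sq_nonneg u, sq_nonneg z,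
    (by ring : u ^ 2 + z ^ 2 + (w + u + z) * w =
      ((w + u) ^ 2 + (w + z) ^ 2 + u ^ 2 + z ^ 2) / 2)]

theorem cube_mul_le (a w : ℝ) : a ^ 3 * w ≤ 1 / 2 * (a ^ 2 * w ^ 2) + 1 / 2 * a ^ 4 := by
  linarith [sq_nonneg (a ^ 2 - a * w), (by ring : (a ^ 2 - a * w) ^ 2 =
    a ^ 4 - 2 * (a ^ 3 * w) + a ^ 2 * w ^ 2)]

theorem sum_sq_le_three (w u z : ℝ) : (w + u + z) ^ 2 ≤ 3 * (w ^ 2 + u ^ 2 + z ^ 2) := by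
  linarith [sq_nonneg (w - u), sq_nonneg (u - z), sq_nonneg (w - z),
    (by ring : 3 * (w ^ 2 + u ^ 2 + z ^ 2) - (w + u + z) ^ 2 =
      (w - u) ^ 2 + (u - z) ^ 2 + (w - z) ^ 2)]

theorem pow_four_mul_sq_le (z u : ℝ) : z ^ 4 * u ^ 2 ≤ z ^ 6 + u ^ 6 := by
  have h1 : 0 ≤ z ^ 2 := sq_nonneg _
  have h2 : 0 ≤ u ^ 2 := sq_nonneg _
  have h3 : 0 ≤ z ^ 6 := by positivity
  have h4 : 0 ≤ u ^ 6 := by positivity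
  rcases le_total (u ^ 2) (z ^ 2) with h | h
  · calc z ^ 4 * u ^ 2 ≤ z ^ 4 * z ^ 2 := by gcongr
      _ = z ^ 6 := by ring
      _ ≤ _ := by linarith
  · calc z ^ 4 * u ^ 2 = (z ^ 2) ^ 2 * u ^ 2 := by ring
      _ ≤ (u ^ 2) ^ 2 * u ^ 2 := by gcongr
      _ = u ^ 6 := by ring
      _ ≤ _ := by linarith

/-- The weight 1/16 is such that the four products with l in `energy_pointwise` cost e²l²/4
together. -/
theorem mul_le_young (x y : ℝ) : x * y ≤ 1 / 16 * y ^ 2 + 4 * x ^ 2 := by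
  linarith [sq_nonneg (8 * x - y), (by ring : (8 * x - y) ^ 2 = 64 * x ^ 2 - 16 * (x * y) + y ^ 2)]

-- Here e is ε^{1/2} and l stands for Δw. The left side is the nonlinear part of the energy balance
-- with everything to be treated by integration moved across: the H⁻¹ pairings with z, z² - C and
-- z³, and the term e²v³l. The summand with v⁴ = (w+u)⁴ pays in advance for the integration by parts
-- of the latter. Monotonicity of the cube supplies a negative multiple of w⁴ + a²w², and every
-- competing quartic term in w carries a factor e or e².
set_option maxHeartbeats 800000 in
theorem energy_pointwise {e w u z l C : ℝ} (he : 0 < e) (he1 : e ≤ 1 / 2000)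
    (hz : e * z ^ 2 ≤ 1 / 4) :
    (1 - e ^ 2) * (cubic (w + u + z) * w) - cubic u * w + 3 * C * (u * w) -
        e ^ 2 * (cubic (w + u + z) * l) - e ^ 2 * ((w + u) ^ 3 * l) + 3 * (z * (u * (u * w))) +
        3 * ((z ^ 2 - C) * (u * w)) + z ^ 3 * w - z * w + 3 / 4 * e ^ 2 * ((w + u) ^ 4) ≤
      2 * w ^ 2 + e ^ 2 / 4 * l ^ 2 + 500 * (e * (1 + u ^ 6)) + 500 * (e ^ 2 * z ^ 6) := by
  obtain ⟨a, ha⟩ : ∃ a, a = u + z := ⟨_, rfl⟩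
  obtain ⟨v, hv⟩ : ∃ v, v = w + u := ⟨_, rfl⟩
  -- The pairing terms cancel a³ - u³ and the linear z exactly, and C drops out. What remains is the
  -- monotone increment of the cube plus terms of order e².
  have id : (1 - e ^ 2) * (cubic (w + u + z) * w) - cubic u * w + 3 * C * (u * w) -
        e ^ 2 * (cubic (w + u + z) * l) - e ^ 2 * ((w + u) ^ 3 * l) + 3 * (z * (u * (u * w))) +
        3 * ((z ^ 2 - C) * (u * w)) + z ^ 3 * w - z * w + 3 / 4 * e ^ 2 * ((w + u) ^ 4) =
      w ^ 2 - e ^ 2 * ((w + u + z) * w) - (1 - e ^ 2) * (((w + a) ^ 3 - a ^ 3) * w) +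
        e ^ 2 * (a ^ 3 * w) - e ^ 2 * ((w + u + z) * l) + e ^ 2 * (3 * v ^ 2 * z * l) +
        e ^ 2 * (3 * v * z ^ 2 * l) + e ^ 2 * (z ^ 3 * l) + 3 / 4 * e ^ 2 * v ^ 4 := by
    subst ha hv
    simp only [cubic]
    ring
  rw [id]
  have cube : ∀ t : ℝ, 0 ≤ t → t ≤ 1 + t ^ 3 ∧ t ^ 2 ≤ 1 + t ^ 3 := fun t ht => by
    have h1 : 0 ≤ (t - 1) ^ 2 * t := by positivity
    have h2 : 0 ≤ (t - 1) ^ 2 := by positivity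
    constructor <;> nlinarith
  have hE0 : 0 < e ^ 2 := by positivity
  have hEe : e ^ 2 ≤ e / 2000 := by nlinarith
  obtain ⟨E, hE⟩ : ∃ E, E = e ^ 2 := ⟨_, rfl⟩
  rw [← hE] at hE0 hEe ⊢
  obtain ⟨U, hU⟩ : ∃ U, U = 1 + u ^ 6 := ⟨_, rfl⟩
  obtain ⟨Z, hZ⟩ : ∃ Z, Z = z ^ 6 := ⟨_, rfl⟩
  have u2 : u ^ 2 ≤ U := by have := (cube (u ^ 2) (sq_nonneg _)).1; rw [hU]; linarith [this,
      (by ring : (u ^ 2) ^ 3 = u ^ 6)]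
  have u4 : u ^ 4 ≤ U := by have := (cube (u ^ 2) (sq_nonneg _)).2; rw [hU]; linarith [this,
      (by ring : (u ^ 2) ^ 3 = u ^ 6), (by ring : (u ^ 2) ^ 2 = u ^ 4)]
  have z2 : z ^ 2 ≤ 1 + Z := by have := (cube (z ^ 2) (sq_nonneg _)).1; rw [hZ]; linarith [this,
      (by ring : (z ^ 2) ^ 3 = z ^ 6)]
  have z4 : z ^ 4 ≤ 1 + Z := by have := (cube (z ^ 2) (sq_nonneg _)).2; rw [hZ]; linarith [this,
      (by ring : (z ^ 2) ^ 3 = z ^ 6), (by ring : (z ^ 2) ^ 2 = z ^ 4)]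
  have u6 : 0 ≤ u ^ 6 := by positivity
  have U1 : 1 ≤ U := by linarith
  have Z0 : 0 ≤ Z := by rw [hZ]; positivity
  rw [← hU, ← hZ]
  have EU : E * U ≤ e * U := mul_le_mul_of_nonneg_right (by linarith) (by linarith)
  have E1 : E ≤ e * U := by nlinarith
  have EZ : 0 ≤ E * Z := by positivity
  have h1 : (w ^ 4 + a ^ 2 * w ^ 2) / 12 ≤ (1 - E) * (((w + a) ^ 3 - a ^ 3) * w) := by
    have hM := cube_sub_cube_mul_ge w a
    have h0 : 0 ≤ w ^ 2 * (w ^ 2 + a ^ 2) / 6 := by positivity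
    have : 1 / 2 * (w ^ 2 * (w ^ 2 + a ^ 2) / 6) ≤ (1 - E) * (((w + a) ^ 3 - a ^ 3) * w) :=
      mul_le_mul (by linarith) hM h0 (by linarith)
    linarith only [this, (by ring : 1 / 2 * (w ^ 2 * (w ^ 2 + a ^ 2) / 6) = (w ^ 4 + a ^ 2 * w ^ 2) / 12)]
  have h2 : -(E * ((w + u + z) * w)) ≤ E * (U + (1 + Z)) := by
    rw [← mul_neg]
    refine mul_le_mul_of_nonneg_left ?_ hE0.le
    linarith only [neg_sum_mul_le w u z, u2, z2]
  have a4 : a ^ 4 ≤ 8 * U + 8 * (1 + Z) := by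
    have := add_pow_four_le u z
    rw [← ha] at this
    linarith only [this, u4, z4]
  have v4 : v ^ 4 ≤ 8 * w ^ 4 + 8 * U := by
    have := add_pow_four_le w u
    rw [← hv] at this
    linarith only [this, u4]
  have v2 : v ^ 2 ≤ 2 * w ^ 2 + 2 * u ^ 2 := by rw [hv]; linarith [sq_nonneg (w - u),
      (by ring : (w + u) ^ 2 + (w - u) ^ 2 = 2 * w ^ 2 + 2 * u ^ 2)]
  have zz : z ^ 2 ≤ 2 * a ^ 2 + 2 * u ^ 2 := by rw [ha]; linarith [sq_nonneg (2 * u + z),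
      (by ring : 2 * (u + z) ^ 2 + 2 * u ^ 2 = (2 * u + z) ^ 2 + z ^ 2)]
  have h3 : E * (a ^ 3 * w) ≤ E * (1 / 2 * (a ^ 2 * w ^ 2) + 4 * U + 4 * (1 + Z)) := by
    refine mul_le_mul_of_nonneg_left ?_ hE0.le
    linarith only [cube_mul_le a w, a4]
  have h4 : -(E * ((w + u + z) * l)) ≤ E * (1 / 16 * l ^ 2 + 12 * (w ^ 2 + U + (1 + Z))) := by
    rw [← mul_neg]
    refine mul_le_mul_of_nonneg_left ?_ hE0.le
    have := mul_le_young (-(w + u + z)) l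
    linarith only [this, u2, z2, sum_sq_le_three w u z,
        (by ring : (-(w + u + z)) ^ 2 = (w + u + z) ^ 2),
      (by ring : -((w + u + z) * l) = -(w + u + z) * l)]
  -- The bound on z converts a factor z² into a gain: e²z² = e(ez²).
  have Ez : E * z ^ 2 ≤ e / 4 := by
    rw [hE]
    have : e ^ 2 * z ^ 2 = e * (e * z ^ 2) := by ring
    rw [this]
    linarith only [mul_le_mul_of_nonneg_left hz he.le]
  have h5 : E * (3 * v ^ 2 * z * l) ≤ E * (1 / 16 * l ^ 2) + 9 * (e * (8 * w ^ 4 + 8 * U)) := by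
    have h := mul_le_mul_of_nonneg_left (mul_le_young (3 * v ^ 2 * z) l) hE0.le
    have h' : E * z ^ 2 * v ^ 4 ≤ e / 4 * (8 * w ^ 4 + 8 * U) :=
      mul_le_mul Ez v4 (by positivity) (by positivity)
    linarith only [h, h', (by ring : E * (1 / 16 * l ^ 2 + 4 * (3 * v ^ 2 * z) ^ 2) =
      E * (1 / 16 * l ^ 2) + 36 * (E * z ^ 2 * v ^ 4))]
  -- In z⁴w² one factor z² is spent through `Ez`; the other is replaced by 2a² + 2u², so that a²w²
  -- can be absorbed by the damping.
  have h6 : E * (3 * v * z ^ 2 * l) ≤ E * (1 / 16 * l ^ 2) + 36 * (e * (a ^ 2 * w ^ 2)) +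
      18 * (e * w ^ 4) + 18 * (e * U) + 72 * (E * Z) + 72 * (E * U) := by
    have h := mul_le_mul_of_nonneg_left (mul_le_young (3 * v * z ^ 2) l) hE0.le
    have k1 : E * (z ^ 4 * v ^ 2) ≤ E * (z ^ 4 * (2 * w ^ 2 + 2 * u ^ 2)) := by gcongr
    have k2 : E * z ^ 2 * (z ^ 2 * w ^ 2) ≤ e / 4 * ((2 * a ^ 2 + 2 * u ^ 2) * w ^ 2) :=
      mul_le_mul Ez (by gcongr) (by positivity) (by positivity)
    have k3 : e * (u ^ 2 * w ^ 2) ≤ e * (1 / 2 * w ^ 4 + 1 / 2 * U) := by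
      refine mul_le_mul_of_nonneg_left ?_ he.le
      linarith only [sq_nonneg (u ^ 2 - w ^ 2), u4, (by ring : (u ^ 2 - w ^ 2) ^ 2 =
        u ^ 4 - 2 * (u ^ 2 * w ^ 2) + w ^ 4)]
    have k4 : E * (z ^ 4 * u ^ 2) ≤ E * (Z + U) := by
      refine mul_le_mul_of_nonneg_left ?_ hE0.le
      linarith only [pow_four_mul_sq_le z u, hZ, hU]
    linarith only [h, k1, k2, k3, k4, (by ring : E * (1 / 16 * l ^ 2 + 4 * (3 * v * z ^ 2) ^ 2) =
      E * (1 / 16 * l ^ 2) + 36 * (E * (z ^ 4 * v ^ 2))),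
      (by ring : E * (z ^ 4 * (2 * w ^ 2 + 2 * u ^ 2)) =
        2 * (E * z ^ 2 * (z ^ 2 * w ^ 2)) + 2 * (E * (z ^ 4 * u ^ 2))),
      (by ring : e / 4 * ((2 * a ^ 2 + 2 * u ^ 2) * w ^ 2) =
        1 / 2 * (e * (a ^ 2 * w ^ 2)) + 1 / 2 * (e * (u ^ 2 * w ^ 2)))]
  have h7 : E * (z ^ 3 * l) ≤ E * (1 / 16 * l ^ 2 + 4 * Z) := by
    refine mul_le_mul_of_nonneg_left ?_ hE0.le
    have := mul_le_young (z ^ 3) l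
    rw [hZ]
    linarith only [this, (by ring : (z ^ 3) ^ 2 = z ^ 6)]
  have h8 : 3 / 4 * E * v ^ 4 ≤ 3 / 4 * E * (8 * w ^ 4 + 8 * U) :=
    mul_le_mul_of_nonneg_left v4 (by positivity)
  have w4 : 0 ≤ w ^ 4 := by positivity
  have aw : 0 ≤ a ^ 2 * w ^ 2 := by positivity
  -- The threshold 1/2000 makes the total coefficients (about 90e for w⁴ and 36e for a²w²) smaller
  -- than the available 1/12.
  have ew4 : e * w ^ 4 ≤ 1 / 2000 * w ^ 4 := mul_le_mul_of_nonneg_right he1 w4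
  have eaw : e * (a ^ 2 * w ^ 2) ≤ 1 / 2000 * (a ^ 2 * w ^ 2) := mul_le_mul_of_nonneg_right he1 aw
  have Ew4 : E * w ^ 4 ≤ 1 / 2000 * w ^ 4 := mul_le_mul_of_nonneg_right (by linarith) w4
  have Eaw : E * (a ^ 2 * w ^ 2) ≤ 1 / 2000 * (a ^ 2 * w ^ 2) :=
    mul_le_mul_of_nonneg_right (by linarith) aw
  have Ew2 : E * w ^ 2 ≤ 1 / 2000 * w ^ 2 := mul_le_mul_of_nonneg_right (by linarith) (sq_nonneg _)
  have eU : 0 ≤ e * U := by positivity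
  have w2 : 0 ≤ w ^ 2 := sq_nonneg _
  linarith only [h1, h2, h3, h4, h5, h6, h7, h8, w4, aw, ew4, eaw, Ew4, Eaw, Ew2, eU, w2, EU, E1,
      EZ]

/-! ### The energy estimate at a fixed time -/

namespace SpatialDomain

variable {D : SpatialDomain}

/-- Turns a pointwise quadratic inequality into one between inner products, without separate
integrability checks for each product. -/
theorem sum_inner_nonpos {n : ℕ} (c : Fin n → ℝ) (f g : Fin n → D.L2)
    (h : ∀ᵐ x ∂D.vol, ∑ i, c i * (f i x * g i x) ≤ 0) : ∑ i, c i * inner ℝ (f i) (g i) ≤ 0 := by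
  have hi : ∀ i, Integrable (fun x => c i * (f i x * g i x)) D.vol := fun i =>
    ((Lp.memLp (f i)).integrable_mul (Lp.memLp (g i))).const_mul (c i)
  simp_rw [inner_L2_eq, ← integral_const_mul]
  rw [← integral_finsetSum _ fun i _ => hi i]
  exact integral_nonpos_of_ae h

theorem norm_le_mul_of_ae {f k : D.L2} {U : ℝ} (h : ∀ᵐ x ∂D.vol, |f x| ≤ U * |k x|) :
    ‖f‖ ≤ U * ‖k‖ := Lp.norm_le_mul_norm_of_ae_le_mul h

theorem norm_sq_add_le {f a b : D.L2} (h : f =ᵐ[D.vol] fun x => a x + b x) :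
    ‖f‖ ^ 2 ≤ 2 * ‖a‖ ^ 2 + 2 * ‖b‖ ^ 2 := by
  have : f = a + b := Lp.ext (h.trans (Lp.coeFn_add a b).symm)
  rw [this]
  nlinarith [norm_add_le a b, norm_nonneg (a + b), norm_nonneg a, norm_nonneg b,
    sq_nonneg (‖a‖ - ‖b‖)]

/-- Estimates in `H¹` of the products `u w` and `u² w`. -/
theorem exists_mul_norm_le (D : SpatialDomain) : ∃ c : ℝ, 0 ≤ c ∧
    ∀ (u w : D.L2) (gu gw R : Fin 2 → D.L2) (U B M : ℝ), D.HasWeakGrad u gu → D.HasWeakGrad w gw →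
      0 ≤ U → 0 ≤ B → (∀ᵐ x ∂D.vol, |u x| ≤ U) → (∀ᵐ x ∂D.vol, |w x| ≤ M) →
      (∀ i, R i =ᵐ[D.vol] fun x => gu i x * gu i x) → (∀ i, ‖R i‖ ≤ B) →
      ∃ (P₁ P₂ : D.L2) (Q₁ Q₂ : Fin 2 → D.L2), P₁ =ᵐ[D.vol] (fun x => u x * w x) ∧
        P₂ =ᵐ[D.vol] (fun x => u x * (u x * w x)) ∧ D.HasWeakGrad P₁ Q₁ ∧ D.HasWeakGrad P₂ Q₂ ∧
        ‖P₁‖ ^ 2 + ∑ i, ‖Q₁ i‖ ^ 2 ≤ (c * B + 2 * U ^ 2) * (‖w‖ ^ 2 + ∑ i, ‖gw i‖ ^ 2) ∧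
        ‖P₂‖ ^ 2 + ∑ i, ‖Q₂ i‖ ^ 2 ≤
          (c * B * U ^ 2 + 4 * U ^ 4) * (‖w‖ ^ 2 + ∑ i, ‖gw i‖ ^ 2) := by
  obtain ⟨c, hc, H⟩ := D.exists_sq_norm_le
  refine ⟨24 * c, by positivity, fun u w gu gw R U B M hu hw hU hB huU hwM hR hRB => ?_⟩
  obtain ⟨Pw, hPw, hPwn⟩ := H w gw hw
  obtain ⟨P₁, Q₁, hP₁, hQ₁, hg₁⟩ := hu.exists_mul hw huU hwM
  have hP₁M : ∀ᵐ x ∂D.vol, |P₁ x| ≤ U * M := by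
    filter_upwards [hP₁, huU, hwM] with x h1 h2 h3
    rw [h1, abs_mul]
    exact mul_le_mul h2 h3 (abs_nonneg _) hU
  obtain ⟨P₂, Q₂, hP₂, hQ₂, hg₂⟩ := hu.exists_mul hg₁ huU hP₁M
  choose S hS using fun i => exists_bdd_mul (g := gu i) hwM
  choose T hT using fun i => exists_bdd_mul (g := gw i) huU
  set Y := ‖w‖ ^ 2 + ∑ i, ‖gw i‖ ^ 2 with hY
  have hYe : Y = ‖w‖ ^ 2 + (‖gw 0‖ ^ 2 + ‖gw 1‖ ^ 2) := by rw [hY, Fin.sum_univ_two]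
  have hPwY : ‖Pw‖ ≤ c * (2 * Y) := by
    refine hPwn.trans (mul_le_mul_of_nonneg_left ?_ hc)
    rw [Fin.sum_univ_two, hYe]
    nlinarith [sq_nonneg (‖w‖ - ‖gw 0‖), sq_nonneg (‖w‖ - ‖gw 1‖), sq_nonneg ‖gw 0‖,
      sq_nonneg ‖gw 1‖]
  -- The square of the norm of w∂ᵢu is the pairing of (∂ᵢu)² with w². The first is bounded by B, the
  -- second by Ladyzhenskaya's inequality for w.
  have hSn : ∀ i, ‖S i‖ ^ 2 ≤ 2 * (c * B * Y) := fun i => by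
    have e : ‖S i‖ ^ 2 = inner ℝ (R i) Pw := by
      rw [← real_inner_self_eq_norm_sq, inner_L2_eq, inner_L2_eq]
      refine integral_congr_ae ?_
      filter_upwards [hS i, hR i, hPw] with x h1 h2 h3
      rw [h1, h2, h3]; ring
    rw [e]
    calc inner ℝ (R i) Pw ≤ ‖R i‖ * ‖Pw‖ := real_inner_le_norm _ _
      _ ≤ B * (c * (2 * Y)) := mul_le_mul (hRB i) hPwY (norm_nonneg _) hB
      _ = _ := by ring
  have hTn : ∀ i, ‖T i‖ ^ 2 ≤ U ^ 2 * ‖gw i‖ ^ 2 := fun i => by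
    have : ‖T i‖ ≤ U * ‖gw i‖ := norm_le_mul_of_ae (by
      filter_upwards [hT i, huU] with x h1 h2
      rw [h1, abs_mul]; exact mul_le_mul_of_nonneg_right h2 (abs_nonneg _))
    rw [← mul_pow]
    exact pow_le_pow_left₀ (norm_nonneg _) this 2
  have hP₁n : ‖P₁‖ ^ 2 ≤ U ^ 2 * ‖w‖ ^ 2 := by
    have : ‖P₁‖ ≤ U * ‖w‖ := norm_le_mul_of_ae (by
      filter_upwards [hP₁, huU] with x h1 h2
      rw [h1, abs_mul]; exact mul_le_mul_of_nonneg_right h2 (abs_nonneg _))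
    rw [← mul_pow]
    exact pow_le_pow_left₀ (norm_nonneg _) this 2
  have hP₂n : ‖P₂‖ ^ 2 ≤ U ^ 2 * ‖P₁‖ ^ 2 := by
    have : ‖P₂‖ ≤ U * ‖P₁‖ := norm_le_mul_of_ae (by
      filter_upwards [hP₂, huU] with x h1 h2
      rw [h1, abs_mul]; exact mul_le_mul_of_nonneg_right h2 (abs_nonneg _))
    rw [← mul_pow]
    exact pow_le_pow_left₀ (norm_nonneg _) this 2
  have hQ₁n : ∀ i, ‖Q₁ i‖ ^ 2 ≤ 4 * (c * B * Y) + 2 * (U ^ 2 * ‖gw i‖ ^ 2) := fun i => by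
    have := norm_sq_add_le (f := Q₁ i) (a := S i) (b := T i) (by
      filter_upwards [hQ₁ i, hS i, hT i] with x h1 h2 h3
      rw [h1, h2, h3]; ring)
    linarith [hSn i, hTn i]
  have hQ₂n : ∀ i, ‖Q₂ i‖ ^ 2 ≤ U ^ 2 * (12 * (c * B * Y) + 4 * (U ^ 2 * ‖gw i‖ ^ 2)) := fun i => by
    have h : ‖Q₂ i‖ ≤ U * ‖|S i| + |Q₁ i|‖ := norm_le_mul_of_ae (by
      filter_upwards [hQ₂ i, hS i, hP₁, huU, Lp.coeFn_add |S i| |Q₁ i|, Lp.coeFn_abs (S i),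
        Lp.coeFn_abs (Q₁ i)] with x h1 h2 h3 h4 h5 h6 h7
      rw [h1, h5, Pi.add_apply, h6, h7, h3, h2]
      have e : gu i x * (u x * w x) + u x * Q₁ i x = u x * (w x * gu i x + Q₁ i x) := by ring
      rw [e, abs_mul]
      exact mul_le_mul h4 ((abs_add_le _ _).trans (le_abs_self _)) (abs_nonneg _) hU)
    have h2 : ‖|S i| + |Q₁ i|‖ ^ 2 ≤ 2 * ‖S i‖ ^ 2 + 2 * ‖Q₁ i‖ ^ 2 := by
      have := norm_sq_add_le (f := |S i| + |Q₁ i|) (a := |S i|) (b := |Q₁ i|) (Lp.coeFn_add _ _)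
      rwa [norm_abs_eq_norm, norm_abs_eq_norm] at this
    calc ‖Q₂ i‖ ^ 2 ≤ (U * ‖|S i| + |Q₁ i|‖) ^ 2 := pow_le_pow_left₀ (norm_nonneg _) h 2
      _ = U ^ 2 * ‖|S i| + |Q₁ i|‖ ^ 2 := mul_pow _ _ _
      _ ≤ _ := mul_le_mul_of_nonneg_left (by linarith [hSn i, hQ₁n i]) (sq_nonneg _)
  have hY0 : 0 ≤ Y := by rw [hYe]; positivity
  have hcB : 0 ≤ c * B * Y := by positivity
  refine ⟨P₁, P₂, Q₁, Q₂, hP₁, ?_, hg₁, hg₂, ?_, ?_⟩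
  · filter_upwards [hP₁, hP₂] with x h1 h2
    rw [h2, h1]
  · rw [Fin.sum_univ_two]
    have h0 := hQ₁n 0
    have h1 := hQ₁n 1
    have h2 : 0 ≤ U ^ 2 * ‖w‖ ^ 2 := by positivity
    calc _ ≤ 8 * (c * B * Y) + 2 * (U ^ 2 * (‖w‖ ^ 2 + (‖gw 0‖ ^ 2 + ‖gw 1‖ ^ 2))) := by
          linarith
      _ ≤ _ := by rw [← hYe]; linarith
  · rw [Fin.sum_univ_two]
    have h0 := hQ₂n 0
    have h1 := hQ₂n 1
    have h2 : U ^ 2 * ‖P₁‖ ^ 2 ≤ U ^ 2 * (U ^ 2 * ‖w‖ ^ 2) :=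
      mul_le_mul_of_nonneg_left hP₁n (sq_nonneg _)
    have h3 : 0 ≤ U ^ 4 * ‖w‖ ^ 2 := by positivity
    calc _ ≤ 24 * (c * B * Y * U ^ 2) + 4 * (U ^ 4 * (‖w‖ ^ 2 + (‖gw 0‖ ^ 2 + ‖gw 1‖ ^ 2))) := by
          linarith
      _ = _ := by rw [← hYe]; ring

/-- The cube of a bounded function in `H¹`. -/
theorem HasWeakGrad.exists_cube {v : D.L2} {gv : Fin 2 → D.L2} (hv : D.HasWeakGrad v gv) {M : ℝ}
    (hM : ∀ᵐ x ∂D.vol, |v x| ≤ M) :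
    ∃ (P P₃ : D.L2) (Q₃ : Fin 2 → D.L2), P =ᵐ[D.vol] (fun x => v x * v x) ∧
      P₃ =ᵐ[D.vol] (fun x => v x ^ 3) ∧ (∀ i, Q₃ i =ᵐ[D.vol] fun x => 3 * v x ^ 2 * gv i x) ∧
      D.HasWeakGrad P₃ Q₃ := by
  obtain ⟨P, Q, hP, hQ, hg⟩ := hv.exists_mul hv hM hM
  have hPM : ∀ᵐ x ∂D.vol, |P x| ≤ M * M := by
    filter_upwards [hP, hM] with x h1 h2
    rw [h1, abs_mul]
    exact mul_le_mul h2 h2 (abs_nonneg _) ((abs_nonneg _).trans h2)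
  obtain ⟨P₃, Q₃, hP₃, hQ₃, hg₃⟩ := hg.exists_mul hv hPM hM
  refine ⟨P, P₃, Q₃, hP, ?_, fun i => ?_, hg₃⟩
  · filter_upwards [hP₃, hP] with x h1 h2
    rw [h1, h2]; ring
  · filter_upwards [hQ₃ i, hP, hQ i] with x h1 h2 h3
    rw [h1, h2, h3]; ring

end SpatialDomain

/-- Arithmetic-geometric mean. With weight 1/8, the four H⁻¹ pairings together use only half of the
squared H¹ norm of w. -/
theorem le_of_sq_le_mul {x a b : ℝ} (ha : 0 ≤ a) (hb : 0 ≤ b) (h : x ^ 2 ≤ a * b) :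
    |x| ≤ 2 * a + 1 / 8 * b := by
  refine abs_le_of_sq_le_sq ?_ (by positivity)
  nlinarith [sq_nonneg (2 * a - 1 / 8 * b)]

namespace SpatialDomain

variable {D : SpatialDomain}

theorem exists_const (D : SpatialDomain) : ∃ one : D.L2, one =ᵐ[D.vol] fun _ => 1 :=
  ⟨_, (memLp_const 1 : MemLp (fun _ : Plane => (1 : ℝ)) 2 D.vol).coeFn_toLp⟩

/-- The integrated form of `energy_pointwise`. -/
theorem energy_integrated {e C₀ U : ℝ} (he : 0 < e) (he1 : e ≤ 1 / 2000)
    {one w u z l v Nv Nu P₁ P₂ Pv P₃ ζ z₃ : D.L2} (hone : one =ᵐ[D.vol] fun _ => 1)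
    (hz : ∀ᵐ x ∂D.vol, e * z x ^ 2 ≤ 1 / 4) (hv : v = w + u)
    (hNv : Nv =ᵐ[D.vol] fun x => cubic (v x + z x)) (hNu : Nu =ᵐ[D.vol] fun x => cubic (u x))
    (hP₁ : P₁ =ᵐ[D.vol] fun x => u x * w x) (hP₂ : P₂ =ᵐ[D.vol] fun x => u x * (u x * w x))
    (hPv : Pv =ᵐ[D.vol] fun x => v x * v x) (hP₃ : P₃ =ᵐ[D.vol] fun x => v x ^ 3)
    (hζ : ζ =ᵐ[D.vol] fun x => z x ^ 2 - C₀) (hz₃ : z₃ =ᵐ[D.vol] fun x => z x ^ 3)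
    (hu : ∀ᵐ x ∂D.vol, |u x| ≤ U) :
    (1 - e ^ 2) * inner ℝ Nv w - inner ℝ Nu w + 3 * C₀ * inner ℝ u w - e ^ 2 * inner ℝ Nv l -
        e ^ 2 * inner ℝ P₃ l + 3 * inner ℝ z P₂ + 3 * inner ℝ ζ P₁ + inner ℝ z₃ w - inner ℝ z w +
        3 / 4 * e ^ 2 * ‖Pv‖ ^ 2 ≤
      2 * ‖w‖ ^ 2 + e ^ 2 / 4 * ‖l‖ ^ 2 + 500 * (e * (1 + U ^ 6)) * ‖one‖ ^ 2 +
        500 * e ^ 2 * ‖z₃‖ ^ 2 := by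
  -- All terms are brought to one side; the constant function supplies the term without w, z or l.
  have key := sum_inner_nonpos
    (c := ![1 - e ^ 2, -1, 3 * C₀, -e ^ 2, -e ^ 2, 3, 3, 1, -1, 3 / 4 * e ^ 2, -2, -(e ^ 2 / 4),
      -(500 * (e * (1 + U ^ 6))), -(500 * e ^ 2)])
    (f := ![Nv, Nu, u, Nv, P₃, z, ζ, z₃, z, Pv, w, l, one, z₃])
    (g := ![w, w, w, l, l, P₂, P₁, w, w, Pv, w, l, one, z₃]) (by
      filter_upwards [hone, hz, hNv, hNu, hP₁, hP₂, hPv, hP₃, hζ, hz₃, hu, Lp.coeFn_add w u]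
        with x h1 h2 h3 h4 h5 h6 h7 h8 h9 h10 h11 h12
      simp only [Fin.sum_univ_succ, Fin.sum_univ_zero, Matrix.cons_val_zero, Matrix.cons_val_succ]
      rw [hv, h12, Pi.add_apply] at h3 h7 h8
      rw [h1, h3, h4, h5, h6, h7, h8, h9, h10]
      have hU : u x ^ 6 ≤ U ^ 6 := by
        have := pow_le_pow_left₀ (abs_nonneg _) h11 6
        rwa [Even.pow_abs (by decide)] at this
      have p := energy_pointwise (w := w x) (u := u x) (z := z x) (l := l x) (C := C₀) he he1 h2
      have q : e * (1 + u x ^ 6) ≤ e * (1 + U ^ 6) := by gcongr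
      linarith only [p, q])
  simp only [Fin.sum_univ_succ, Fin.sum_univ_zero, Matrix.cons_val_zero, Matrix.cons_val_succ,
    real_inner_self_eq_norm_sq] at key
  linarith only [key]

/-- The quartic term is controlled by the dissipation and the gradient of the limit. -/
theorem inner_cube_laplacian_le {w v l P₃ Pv : D.L2} {gw gu gv Q₃ R : Fin 2 → D.L2}
    (hw : D.HasWeakGrad w gw) (hl : D.HasLaplacian w l) (hQ : D.HasWeakGrad P₃ Q₃)
    (hQ₃ : ∀ i, Q₃ i =ᵐ[D.vol] fun x => 3 * v x ^ 2 * gv i x) (hgv : ∀ i, gv i = gw i + gu i)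
    (hR : ∀ i, R i =ᵐ[D.vol] fun x => gu i x * gu i x) (hPv : Pv =ᵐ[D.vol] fun x => v x * v x) :
    inner ℝ P₃ l ≤ 3 / 8 * (‖R 0‖ ^ 2 + ‖R 1‖ ^ 2) + 3 / 4 * ‖Pv‖ ^ 2 := by
  have h := hl.inner_eq hw hQ
  rw [Fin.sum_univ_two] at h
  -- Completing the square (2∂ᵢw + ∂ᵢu)² gives -3v²(∂ᵢw + ∂ᵢu)∂ᵢw ≤ (3/4)v²(∂ᵢu)², which is then
  -- split into fourth powers.
  have hi : ∀ i, -inner ℝ (gw i) (Q₃ i) ≤ 3 / 8 * ‖R i‖ ^ 2 + 3 / 8 * ‖Pv‖ ^ 2 := fun i => by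
    have key := sum_inner_nonpos (c := ![-1, -(3 / 8), -(3 / 8)]) (f := ![gw i, R i, Pv])
      (g := ![Q₃ i, R i, Pv]) (by
        filter_upwards [hQ₃ i, hR i, hPv, Lp.coeFn_add (gw i) (gu i)] with x h1 h2 h3 h4
        simp only [Fin.sum_univ_succ, Fin.sum_univ_zero, Matrix.cons_val_zero, Matrix.cons_val_succ]
        rw [h1, h2, h3, hgv i, h4, Pi.add_apply]
        have s1 := mul_nonneg (sq_nonneg (v x)) (sq_nonneg (2 * gw i x + gu i x))
        have s2 := sq_nonneg (v x ^ 2 - gu i x ^ 2)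
        linarith only [s1, s2, (by ring : v x ^ 2 * (2 * gw i x + gu i x) ^ 2 =
          4 * (v x ^ 2 * (gw i x + gu i x) * gw i x) + v x ^ 2 * gu i x ^ 2),
          (by ring : (v x ^ 2 - gu i x ^ 2) ^ 2 =
            v x * v x * (v x * v x) - 2 * (v x ^ 2 * gu i x ^ 2) +
              gu i x * gu i x * (gu i x * gu i x))])
    simp only [Fin.sum_univ_succ, Fin.sum_univ_zero, Matrix.cons_val_zero, Matrix.cons_val_succ,
      real_inner_self_eq_norm_sq] at key
    linarith only [key]
  rw [real_inner_comm]
  linarith only [hi 0, hi 1, h]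

/-- The parameter n plays the role of the cube root of 1 + Σ‖∂ᵢⱼu‖ at a fixed time. With |u| of
order n and (∂ᵢu)² of order n³, multiplication by u² on H¹ costs n³·n² + n⁴ in the squared norm,
whence the weight n⁵. The constant is uniform in e and n. -/
theorem exists_slice_estimate (D : SpatialDomain) (C C₀ : ℝ) (hC : 0 ≤ C) : ∃ K : ℝ, 0 ≤ K ∧
    ∀ (e n : ℝ), 0 < e → e ≤ 1 / 2000 → 1 ≤ n →
    ∀ (V u lV lu Nv Nu z ζ z₃ : D.L2) (gV gu : Fin 2 → D.L2) (hV hu : Fin 2 → Fin 2 → D.L2),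
      D.HasHess V gV hV → D.HasHess u gu hu → D.HasLaplacian V lV → D.HasLaplacian u lu →
      (∀ᵐ x ∂D.vol, |u x| ≤ C * n) →
      (∀ i, ∃ R : D.L2, R =ᵐ[D.vol] (fun x => gu i x * gu i x) ∧ ‖R‖ ≤ C * n ^ 3) →
      ‖lu‖ ≤ n ^ 3 → (Nv =ᵐ[D.vol] fun x => cubic (V x + z x)) →
      (Nu =ᵐ[D.vol] fun x => cubic (u x)) → (ζ =ᵐ[D.vol] fun x => z x ^ 2 - C₀) →
      (z₃ =ᵐ[D.vol] fun x => z x ^ 3) → (∀ᵐ x ∂D.vol, e * z x ^ 2 ≤ 1 / 4) →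
      inner ℝ ((1 - e ^ 2) • (lV + Nv) - (lu + (Nu - (3 * C₀) • u))) (V - u) +
        inner ℝ (-(e ^ 2) • (lV + Nv)) (lV - lu) ≤
      K * (‖V - u‖ ^ 2 + n ^ 5 * (negNorm z ^ 2 + negNorm ζ ^ 2) + negNorm z₃ ^ 2 + e * n ^ 6 +
        e ^ 2 * ‖z₃‖ ^ 2) := by
  obtain ⟨c, hc, H⟩ := D.exists_mul_norm_le
  obtain ⟨one, hone⟩ := D.exists_const
  set κ := c * C + 2 * C ^ 2 + c * C ^ 3 + 4 * C ^ 4 with hκ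
  have hκ0 : 0 ≤ κ := by positivity
  refine ⟨504 + 18 * κ + 500 * (1 + C ^ 6) * ‖one‖ ^ 2 + C ^ 2, by positivity, ?_⟩
  intro e n he he1 hn V u lV lu Nv Nu z ζ z₃ gV gu hV hu hhV hhu hlV hlu huC hR hlun hNv hNu hζ hz₃ hz
  choose R hR hRn using hR
  obtain ⟨w, hw⟩ : ∃ w, w = V - u := ⟨_, rfl⟩
  obtain ⟨l, hl⟩ : ∃ l, l = lV - lu := ⟨_, rfl⟩
  have hVw : V = w + u := by rw [hw]; abel
  have hlVl : lV = l + lu := by rw [hl]; abel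
  obtain ⟨gw, hgw⟩ : ∃ gw : Fin 2 → D.L2, gw = fun i => gV i - gu i := ⟨_, rfl⟩
  have hgwV : ∀ i, gV i = gw i + gu i := fun i => by rw [hgw]; simp only [sub_add_cancel]
  have gradw : D.HasWeakGrad w gw := by rw [hw, hgw]; exact hhV.1.sub hhu.1
  have lapw : D.HasLaplacian w l := by rw [hw, hl]; exact hlV.sub hlu
  obtain ⟨M, hM⟩ := hhV.exists_bdd
  have hwM : ∀ᵐ x ∂D.vol, |w x| ≤ M + C * n := by
    filter_upwards [hM, huC, Lp.coeFn_sub V u] with x h1 h2 h3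
    rw [hw, h3, Pi.sub_apply]
    exact (abs_sub _ _).trans (add_le_add h1 h2)
  have hn0 : 0 ≤ n := by linarith
  obtain ⟨P₁, P₂, Q₁, Q₂, hP₁, hP₂, hg₁, hg₂, e₁, e₂⟩ :=
    H u w gu gw R (C * n) (C * n ^ 3) (M + C * n)
    hhu.1 gradw (by positivity) (by positivity) huC hwM hR hRn
  obtain ⟨Pv, P₃, Q₃, hPv, hP₃, hQ₃, hg₃⟩ := hhV.1.exists_cube hM
  have main := energy_integrated (l := l) he he1 hone hz hVw hNv hNu hP₁ hP₂ hPv hP₃ hζ hz₃ huC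
  have quart := inner_cube_laplacian_le gradw lapw hg₃ hQ₃ hgwV hR hPv
  set Y := ‖w‖ ^ 2 + ∑ i, ‖gw i‖ ^ 2 with hY
  -- The Laplacian of w paired with w yields minus the squared gradient norm, the dissipation that
  -- absorbs the pairings.
  have hG := lapw.inner_eq gradw gradw
  simp only [real_inner_self_eq_norm_sq] at hG
  obtain ⟨G, hGd⟩ : ∃ G, G = ∑ i, ‖gw i‖ ^ 2 := ⟨_, rfl⟩
  have hG0 : 0 ≤ G := by rw [hGd]; exact Finset.sum_nonneg fun _ _ => sq_nonneg _
  rw [← hGd] at hG hY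
  have hY0 : 0 ≤ Y := by rw [hY]; positivity
  clear_value Y
  have hn5 : 1 ≤ n ^ 5 := one_le_pow₀ hn
  have pw : ∀ {j : ℕ}, j ≤ 5 → n ^ j ≤ n ^ 5 := fun hj => pow_le_pow_right₀ hn hj
  have e₁' : ‖P₁‖ ^ 2 + ∑ i, ‖Q₁ i‖ ^ 2 ≤ κ * n ^ 5 * Y := by
    refine e₁.trans (mul_le_mul_of_nonneg_right ?_ hY0)
    have h3 : c * C * n ^ 3 ≤ c * C * n ^ 5 :=
        mul_le_mul_of_nonneg_left (pw (by norm_num)) (by positivity)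
    have h2 : 2 * C ^ 2 * n ^ 2 ≤ 2 * C ^ 2 * n ^ 5 :=
      mul_le_mul_of_nonneg_left (pw (by norm_num)) (by positivity)
    have h4 : 0 ≤ (c * C ^ 3 + 4 * C ^ 4) * n ^ 5 := by positivity
    rw [hκ]
    linarith only [h2, h3, h4]
  have e₂' : ‖P₂‖ ^ 2 + ∑ i, ‖Q₂ i‖ ^ 2 ≤ κ * n ^ 5 * Y := by
    refine e₂.trans (mul_le_mul_of_nonneg_right ?_ hY0)
    have h2 : 4 * C ^ 4 * n ^ 4 ≤ 4 * C ^ 4 * n ^ 5 :=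
      mul_le_mul_of_nonneg_left (pw (by norm_num)) (by positivity)
    have h4 : 0 ≤ (c * C + 2 * C ^ 2) * n ^ 5 := by positivity
    rw [hκ]
    linarith only [h2, h4]
  have d₁ := inner_sq_le_negNorm z gradw
  rw [← hGd, ← hY] at d₁
  have d₁ := le_of_sq_le_mul (sq_nonneg _) hY0 d₁
  have d₂ := inner_sq_le_negNorm z₃ gradw
  rw [← hGd, ← hY] at d₂
  have d₂ := le_of_sq_le_mul (sq_nonneg _) hY0 d₂
  have dual : ∀ (k P : D.L2) (Q : Fin 2 → D.L2), D.HasWeakGrad P Q →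
      ‖P‖ ^ 2 + ∑ i, ‖Q i‖ ^ 2 ≤ κ * n ^ 5 * Y →
      |3 * inner ℝ k P| ≤ 2 * (9 * κ * (n ^ 5 * negNorm k ^ 2)) + 1 / 8 * Y :=
          fun k P Q hPQ hPn => by
    refine le_of_sq_le_mul (by positivity) hY0 ?_
    have h1 := inner_sq_le_negNorm k hPQ
    have h2 := mul_le_mul_of_nonneg_left hPn (sq_nonneg (negNorm k))
    rw [mul_pow]
    linarith only [h1, h2]
  have d₃ := dual z P₂ Q₂ hg₂ e₂'
  have d₄ := dual ζ P₁ Q₁ hg₁ e₁'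
  rw [abs_le] at d₁ d₂ d₃ d₄
  -- The limit equation has no ε-part, so Δu survives paired with w and with Δw. Both terms carry
  -- e², and e²‖Δu‖² is at most en⁶.
  have lw : -inner ℝ lu w ≤ 1 / 2 * ‖lu‖ ^ 2 + 1 / 2 * ‖w‖ ^ 2 := by
    have := (abs_le.1 (abs_real_inner_le_norm lu w)).1
    nlinarith only [this, sq_nonneg (‖lu‖ - ‖w‖)]
  have ll : -inner ℝ lu l ≤ ‖lu‖ ^ 2 + 1 / 4 * ‖l‖ ^ 2 := by
    have := (abs_le.1 (abs_real_inner_le_norm lu l)).1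
    nlinarith only [this, sq_nonneg (2 * ‖lu‖ - ‖l‖)]
  have expand : inner ℝ ((1 - e ^ 2) • (lV + Nv) - (lu + (Nu - (3 * C₀) • u))) (V - u) +
        inner ℝ (-(e ^ 2) • (lV + Nv)) (lV - lu) =
      (1 - e ^ 2) * inner ℝ l w - e ^ 2 * inner ℝ lu w - e ^ 2 * ‖l‖ ^ 2 - e ^ 2 * inner ℝ lu l +
        ((1 - e ^ 2) * inner ℝ Nv w - inner ℝ Nu w + 3 * C₀ * inner ℝ u w -
          e ^ 2 * inner ℝ Nv l) := by
    rw [← hw, ← hl, hlVl]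
    simp only [inner_sub_left, inner_add_left, real_inner_smul_left, neg_smul, inner_neg_left,
      real_inner_self_eq_norm_sq]
    ring
  rw [expand, ← hw]
  have E0 : 0 ≤ e ^ 2 := sq_nonneg _
  have Ee : e ^ 2 ≤ e / 2000 := by nlinarith only [he, he1]
  have quart' := mul_le_mul_of_nonneg_left quart E0
  have lw' := mul_le_mul_of_nonneg_left lw E0
  have ll' := mul_le_mul_of_nonneg_left ll E0
  have n6 : 1 ≤ n ^ 6 := one_le_pow₀ hn
  have lu6 : ‖lu‖ ^ 2 ≤ n ^ 6 := by
    have := pow_le_pow_left₀ (norm_nonneg _) hlun 2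
    linarith only [this, (by ring : (n ^ 3) ^ 2 = n ^ 6)]
  have R6 : ∀ i, ‖R i‖ ^ 2 ≤ C ^ 2 * n ^ 6 := fun i => by
    have := pow_le_pow_left₀ (norm_nonneg _) (hRn i) 2
    linarith only [this, (by ring : (C * n ^ 3) ^ 2 = C ^ 2 * n ^ 6)]
  have t1 : e ^ 2 * ‖lu‖ ^ 2 ≤ e * n ^ 6 :=
    mul_le_mul (by linarith only [Ee, he]) lu6 (sq_nonneg _) he.le
  have t2 : e ^ 2 * (‖R 0‖ ^ 2 + ‖R 1‖ ^ 2) ≤ e * (2 * (C ^ 2 * n ^ 6)) :=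
    mul_le_mul (by linarith only [Ee, he]) (by linarith only [R6 0, R6 1]) (by positivity) he.le
  have t3 : 500 * (e * (1 + (C * n) ^ 6)) * ‖one‖ ^ 2 ≤
      500 * (1 + C ^ 6) * ‖one‖ ^ 2 * (e * n ^ 6) := by
    have h : e * (1 + (C * n) ^ 6) * ‖one‖ ^ 2 ≤ e * ((1 + C ^ 6) * n ^ 6) * ‖one‖ ^ 2 := by
      gcongr
      linarith only [n6, (by ring : (C * n) ^ 6 = C ^ 6 * n ^ 6)]
    linarith only [h]
  have hG' : e ^ 2 * G = e ^ 2 * -inner ℝ l w := by rw [hG]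
  have t4 : e ^ 2 * ‖w‖ ^ 2 ≤ 1 / 2000 * ‖w‖ ^ 2 :=
    mul_le_mul_of_nonneg_right (by linarith only [Ee, he1]) (sq_nonneg _)
  have t5 : e ^ 2 * G ≤ 1 / 2000 * G :=
    mul_le_mul_of_nonneg_right (by linarith only [Ee, he1]) hG0
  have z1 : negNorm z ^ 2 ≤ n ^ 5 * negNorm z ^ 2 := le_mul_of_one_le_left (sq_nonneg _) hn5
  have p0 : 0 ≤ ‖w‖ ^ 2 := sq_nonneg _
  have p1 : 0 ≤ n ^ 5 * negNorm z ^ 2 := by positivity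
  have p2 : 0 ≤ n ^ 5 * negNorm ζ ^ 2 := by positivity
  have p3 : 0 ≤ negNorm z₃ ^ 2 := sq_nonneg _
  have p4 : 0 ≤ e * n ^ 6 := by positivity
  have p5 : 0 ≤ e ^ 2 * ‖z₃‖ ^ 2 := by positivity
  obtain ⟨k, hk⟩ : ∃ k, k = 500 * (1 + C ^ 6) * ‖one‖ ^ 2 := ⟨_, rfl⟩
  have hk0 : 0 ≤ k := by rw [hk]; positivity
  rw [← hk] at t3 ⊢
  have q0 : 0 ≤ (18 * κ + k + C ^ 2) * ‖w‖ ^ 2 := by positivity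
  have q1 : 0 ≤ (502 + k + C ^ 2) * (n ^ 5 * negNorm z ^ 2) := by positivity
  have q2 : 0 ≤ (504 + k + C ^ 2) * (n ^ 5 * negNorm ζ ^ 2) := by positivity
  have q3 : 0 ≤ (502 + 18 * κ + k + C ^ 2) * negNorm z₃ ^ 2 := by positivity
  have q4 : 0 ≤ (502 + 18 * κ) * (e * n ^ 6) := by positivity
  have q5 : 0 ≤ (4 + 18 * κ + k + C ^ 2) * (e ^ 2 * ‖z₃‖ ^ 2) := by positivity
  have l0 : 0 ≤ e ^ 2 * ‖l‖ ^ 2 := by positivity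
  have q6 : 0 ≤ C ^ 2 * (e * n ^ 6) := by positivity
  linarith only [hG, hG', main, quart', lw', ll', t1, t2, t3, t4, t5, z1, p0, p1, p2, p3, p4, p5,
      q0, q1,
    q2, q3, q4, q5, q6, l0, d₁.2, d₂.1, d₃.1, d₄.1, hG0, hY]

end SpatialDomain

/-! ### Energy identity for the difference of two solutions -/

/-! ### Gronwall's inequality in integral form -/

/-- The differential form is applied to the primitive of y. The hypothesis excludes b = T because
the energy identity does; the endpoint is recovered by continuity. -/
theorem integral_gronwall {T K B : ℝ} (hT : 0 < T) (hK : 0 < K) (hB : 0 ≤ B) {y : ℝ → ℝ}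
    (hy : ContinuousOn y (Icc 0 T)) (y0 : ∀ t ∈ Icc 0 T, 0 ≤ y t)
    (h : ∀ b ∈ Ico 0 T, y b ≤ B + K * ∫ s in (0)..b, y s) {b : ℝ} (hb : b ∈ Icc 0 T) :
    y b ≤ B * Real.exp (K * T) := by
  -- The constant extension makes the primitive differentiable at every point, including the
  -- endpoints.
  set y' : ℝ → ℝ := IccExtend hT.le ((Icc 0 T).domRestrict y) with hy'
  have cy : Continuous y' := (continuousOn_iff_continuous_domRestrict.1 hy).Icc_extend'
  have ey : ∀ t ∈ Icc 0 T, y' t = y t := fun t ht => by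
    rw [hy', IccExtend_of_mem _ _ ht]; rfl
  have ei : ∀ b ∈ Icc 0 T, ∫ s in (0)..b, y' s = ∫ s in (0)..b, y s := fun b hb => by
    refine intervalIntegral.integral_congr fun s hs => ey s ?_
    rw [uIcc_of_le hb.1] at hs
    exact ⟨hs.1, hs.2.trans hb.2⟩
  have y0' : ∀ t, 0 ≤ y' t := fun t => y0 _ (projIcc 0 T hT.le t).2
  set Y : ℝ → ℝ := fun b => ∫ s in (0)..b, y' s with hY
  have dY : ∀ t, HasDerivAt Y (y' t) t := fun t => (cy.integral_hasStrictDerivAt 0 t).hasDerivAt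
  have Y0 : ∀ t ∈ Icc 0 T, 0 ≤ Y t := fun t ht =>
    intervalIntegral.integral_nonneg ht.1 fun s _ => y0' s
  have hG := norm_le_gronwallBound_of_norm_deriv_right_le (f := Y) (f' := y') (δ := 0) (K := K)
    (ε := B) (a := 0) (b := T) (fun t _ => (dY t).continuousAt.continuousWithinAt)
    (fun t _ => (dY t).hasDerivWithinAt) (by simp [hY]) (fun t ht => by
      have ht' : t ∈ Icc 0 T := ⟨ht.1, ht.2.le⟩
      rw [Real.norm_of_nonneg (y0' t), Real.norm_of_nonneg (Y0 t ht'), ey t ht']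
      have := h t ht
      rw [← ei t ht'] at this
      linarith)
  have hIco : ∀ t ∈ Ico 0 T, y t ≤ B * Real.exp (K * T) := fun t ht => by
    have ht' : t ∈ Icc 0 T := ⟨ht.1, ht.2.le⟩
    have h1 := hG t ht'
    rw [Real.norm_of_nonneg (Y0 t ht'), gronwallBound_of_K_ne_0 hK.ne'] at h1
    simp only [sub_zero, zero_mul, zero_add] at h1
    have h2 := h t ht
    rw [← ei t ht'] at h2
    have h3 : K * Y t ≤ K * (B / K * (Real.exp (K * t) - 1)) := mul_le_mul_of_nonneg_left h1 hK.le
    have h4 : K * (B / K * (Real.exp (K * t) - 1)) = B * (Real.exp (K * t) - 1) := by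
      field_simp
    have h5 : B * Real.exp (K * t) ≤ B * Real.exp (K * T) := by
      gcongr; exact ht'.2
    change y t ≤ B + K * Y t at h2
    linarith
  have hcl : closure (Ico 0 T) = Icc 0 T := closure_Ico hT.ne
  exact le_on_closure hIco (by rwa [hcl]) continuousOn_const (by rwa [hcl])

/-- The energy identity with a pair of test functions. -/
theorem energy_identity_pair {H : Type*} [NormedAddCommGroup H] [InnerProductSpace ℝ H] {T : ℝ}
    {w F₁ F₂ Y₁ Y₂ : ℝ → H} (hw : ContinuousOn w (Icc 0 T))
    (hF₁ : MemLp F₁ 2 (volume.restrict (Icc 0 T))) (hF₂ : MemLp F₂ 2 (volume.restrict (Icc 0 T)))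
    (hY₁ : MemLp Y₁ 2 (volume.restrict (Icc 0 T))) (hY₂ : MemLp Y₂ 2 (volume.restrict (Icc 0 T)))
    (hweak : ∀ᵐ s ∂volume.restrict (Icc 0 T), ∀ r ∈ Icc 0 T, ∀ t ∈ Icc 0 T,
      inner ℝ (w t - w r) (w s) = ∫ τ in r..t, (inner ℝ (F₁ τ) (Y₁ s) + inner ℝ (F₂ τ) (Y₂ s)))
    {b : ℝ} (hb : b ∈ Ico 0 T) :
    ‖w b‖ ^ 2 - ‖w 0‖ ^ 2 =
      2 * ∫ s in (0)..b, (inner ℝ (F₁ s) (Y₁ s) + inner ℝ (F₂ s) (Y₂ s)) := by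
  -- In the Hilbert product H × H the two pairings are one inner product.
  let ι₁ : H →L[ℝ] WithLp 2 (H × H) :=
    ((WithLp.prodContinuousLinearEquiv 2 ℝ H H).symm : H × H →L[ℝ] WithLp 2 (H × H)).comp
      (ContinuousLinearMap.inl ℝ H H)
  let ι₂ : H →L[ℝ] WithLp 2 (H × H) :=
    ((WithLp.prodContinuousLinearEquiv 2 ℝ H H).symm : H × H →L[ℝ] WithLp 2 (H × H)).comp
      (ContinuousLinearMap.inr ℝ H H)
  have hin : ∀ a b c d : H, inner ℝ (ι₁ a + ι₂ b) (ι₁ c + ι₂ d) = inner ℝ a c + inner ℝ b d :=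
    fun a b c d => by
      simp [ι₁, ι₂, WithLp.prod_inner_apply]
  have hm : ∀ {f g : ℝ → H}, MemLp f 2 (volume.restrict (Icc 0 T)) →
      MemLp g 2 (volume.restrict (Icc 0 T)) →
      MemLp (fun s => ι₁ (f s) + ι₂ (g s)) 2 (volume.restrict (Icc 0 T)) := fun hf hg =>
    (ι₁.comp_memLp' hf).add (ι₂.comp_memLp' hg)
  have := energy_identity (H' := WithLp 2 (H × H)) (F := fun s => ι₁ (F₁ s) + ι₂ (F₂ s))
    (Y := fun s => ι₁ (Y₁ s) + ι₂ (Y₂ s)) hw (hm hF₁ hF₂) (hm hY₁ hY₂) (by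
      filter_upwards [hweak] with s hs r hr t ht
      simp only [hin]
      exact hs r hr t ht) hb
  simpa only [hin] using this

namespace SpatialDomain

variable {D : SpatialDomain}

theorem HasHess.sub {f f' : D.L2} {g g' : Fin 2 → D.L2} {h h' : Fin 2 → Fin 2 → D.L2}
    (H : D.HasHess f g h) (H' : D.HasHess f' g' h') :
    D.HasHess (f - f') (fun i => g i - g' i) (fun i j => h i j - h' i j) :=
  ⟨H.1.sub H'.1, fun i => (H.2 i).sub (H'.2 i)⟩

theorem MemL2H2.memLp_laplacian {T : ℝ} {u : ℝ → D.L2} {g : ℝ → Fin 2 → D.L2}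
    {h : ℝ → Fin 2 → Fin 2 → D.L2} (hu : D.MemL2H2 T u g h) :
    MemLp (fun s => ∑ i, h s i i) 2 (volume.restrict (Icc 0 T)) :=
  memLp_finsetSum Finset.univ fun i _ => hu.2.2.2 i i

theorem memLp_of_continuousOn {T : ℝ} {Θ : ℝ → D.L2} (h : ContinuousOn Θ (Icc 0 T)) :
    MemLp Θ 2 (volume.restrict (Icc 0 T)) := by
  obtain ⟨M, hM⟩ := isCompact_Icc.exists_bound_of_continuousOn h
  refine MemLp.of_bound (h.aestronglyMeasurable measurableSet_Icc) M ?_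
  filter_upwards [ae_restrict_mem measurableSet_Icc] with t ht using hM t ht

theorem integrable_inner {T : ℝ} {f g : ℝ → D.L2} (hf : MemLp f 2 (volume.restrict (Icc 0 T)))
    (hg : MemLp g 2 (volume.restrict (Icc 0 T))) :
    IntegrableOn (fun s => inner ℝ (f s) (g s)) (Icc 0 T) := by
  refine (hf.norm.integrable_mul hg.norm).mono' (hf.1.inner hg.1) (ae_of_all _ fun s => ?_)
  exact norm_inner_le_norm _ _

/-- The energy identity for the difference of a solution of the shifted equation and a solution of
the limit equation. -/
theorem energy_difference {ε C₀ T : ℝ} {V u Nv Nu : ℝ → D.L2} {gV gu : ℝ → Fin 2 → D.L2}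
    {hV hu : ℝ → Fin 2 → Fin 2 → D.L2} {f : ℝ → Plane → ℝ} (cV : ContinuousOn V (Icc 0 T))
    (cu : ContinuousOn u (Icc 0 T)) (HV : D.MemL2H2 T V gV hV) (Hu : D.MemL2H2 T u gu hu)
    (lV : ∀ᵐ t ∂volume.restrict (Icc 0 T), D.HasLaplacian (V t) (∑ i, hV t i i))
    (lu : ∀ᵐ t ∂volume.restrict (Icc 0 T), D.HasLaplacian (u t) (∑ i, hu t i i))
    (mNv : MemLp Nv 2 (volume.restrict (Icc 0 T))) (mNu : MemLp Nu 2 (volume.restrict (Icc 0 T)))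
    (hNv : ∀ t ∈ Icc 0 T, Nv t =ᵐ[D.vol] f t)
    (eV : ∀ φ l : D.L2, D.MemV φ l → ∀ t ∈ Icc 0 T,
      inner ℝ (V t) φ = inner ℝ (V 0) φ + ∫ s in (0)..t,
        (inner ℝ (∑ i, hV s i i) ((1 - ε) • φ - ε • l) +
          ∫ x, f s x * ((1 - ε) * φ x - ε * l x) ∂D.vol))
    (eu : ∀ t ∈ Icc 0 T, u t = u 0 + ∫ s in (0)..t, (∑ i, hu s i i + (Nu s - (3 * C₀) • u s))) :
    let m : ℝ → ℝ := fun s =>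
      inner ℝ ((1 - ε) • (∑ i, hV s i i + Nv s) - (∑ i, hu s i i + (Nu s - (3 * C₀) • u s)))
        (V s - u s) + inner ℝ (-ε • (∑ i, hV s i i + Nv s)) (∑ i, hV s i i - ∑ i, hu s i i)
    IntegrableOn m (Icc 0 T) ∧ ∀ b ∈ Ico 0 T,
      ‖V b - u b‖ ^ 2 - ‖V 0 - u 0‖ ^ 2 = 2 * ∫ s in (0)..b, m s := by
  intro m
  have mlV := HV.memLp_laplacian
  have mlu := Hu.memLp_laplacian
  obtain ⟨LV, hLV⟩ : ∃ LV : ℝ → D.L2, LV = fun s => ∑ i, hV s i i := ⟨_, rfl⟩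
  obtain ⟨Lu, hLu⟩ : ∃ Lu : ℝ → D.L2, Lu = fun s => ∑ i, hu s i i := ⟨_, rfl⟩
  have hLV' : ∀ s, ∑ i, hV s i i = LV s := fun s => by rw [hLV]
  have hLu' : ∀ s, ∑ i, hu s i i = Lu s := fun s => by rw [hLu]
  simp only [hLV', hLu'] at mlV mlu lV lu eV eu
  have mu3 : MemLp (fun s => (3 * C₀) • u s) 2 (volume.restrict (Icc 0 T)) :=
    Hu.2.1.const_smul (3 * C₀)
  have mA : MemLp (fun s => LV s + Nv s) 2 (volume.restrict (Icc 0 T)) := mlV.add mNv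
  have mB : MemLp (fun s => Lu s + (Nu s - (3 * C₀) • u s)) 2 (volume.restrict (Icc 0 T)) :=
    mlu.add (mNu.sub mu3)
  have mA1 : MemLp (fun s => (1 - ε) • (LV s + Nv s)) 2 (volume.restrict (Icc 0 T)) :=
    mA.const_smul (1 - ε)
  have mF₁ : MemLp (fun s => (1 - ε) • (LV s + Nv s) - (Lu s + (Nu s - (3 * C₀) • u s))) 2
    (volume.restrict (Icc 0 T)) := mA1.sub mB
  have mF₂ : MemLp (fun s => -ε • (LV s + Nv s)) 2 (volume.restrict (Icc 0 T)) :=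
    mA.const_smul (-ε)
  have mw : MemLp (fun s => V s - u s) 2 (volume.restrict (Icc 0 T)) := HV.2.1.sub Hu.2.1
  have ml : MemLp (fun s => LV s - Lu s) 2 (volume.restrict (Icc 0 T)) := mlV.sub mlu
  have hm : m = fun s => inner ℝ ((1 - ε) • (LV s + Nv s) - (Lu s + (Nu s - (3 * C₀) • u s)))
      (V s - u s) + inner ℝ (-ε • (LV s + Nv s)) (LV s - Lu s) := by
    funext s
    simp only [m, hLV', hLu']
  rw [hm]
  refine ⟨(integrable_inner mF₁ mw).add (integrable_inner mF₂ ml), fun b hb => ?_⟩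
  refine energy_identity_pair (w := fun s => V s - u s) (cV.sub cu) mF₁ mF₂ mw ml ?_ hb
  filter_upwards [HV.1, Hu.1, lV, lu] with s h1 h2 h3 h4 r hr t ht
  set φ := V s - u s with hφ
  set l := LV s - Lu s with hl
  -- For almost every s the frozen difference V(s) - u(s) is an admissible test function, so the
  -- weak equation, stated for time-independent tests, can be used at all other times t.
  have memV : D.MemV φ l := ⟨⟨_, _, h1.sub h2⟩, h3.sub h4⟩
  have iB : IntegrableOn (fun s => Lu s + (Nu s - (3 * C₀) • u s)) (Icc 0 T) :=
    mB.integrable (by norm_num)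
  have iA : IntegrableOn (fun s => LV s + Nv s) (Icc 0 T) := mA.integrable (by norm_num)
  have key : ∀ t ∈ Icc 0 T, inner ℝ (V t - u t) φ = inner ℝ (V 0 - u 0) φ + ∫ τ in (0)..t,
      (inner ℝ ((1 - ε) • (LV τ + Nv τ) - (Lu τ + (Nu τ - (3 * C₀) • u τ))) φ +
        inner ℝ (-ε • (LV τ + Nv τ)) l) := fun t ht => by
    have e1 : inner ℝ (V t) φ = inner ℝ (V 0) φ +
        ∫ τ in (0)..t, inner ℝ (LV τ + Nv τ) ((1 - ε) • φ - ε • l) := by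
      rw [eV φ l memV t ht]
      congr 1
      refine intervalIntegral_congr_ae_Icc ?_ ht
      filter_upwards [ae_restrict_mem measurableSet_Icc] with τ hτ
      rw [inner_add_left, inner_L2_eq (Nv τ)]
      congr 1
      refine integral_congr_ae ?_
      filter_upwards [hNv τ hτ, Lp.coeFn_sub ((1 - ε) • φ) (ε • l), Lp.coeFn_smul (1 - ε) φ,
        Lp.coeFn_smul ε l] with x k1 k2 k3 k4
      rw [k1, k2, Pi.sub_apply, k3, k4, Pi.smul_apply, Pi.smul_apply, smul_eq_mul, smul_eq_mul]
    have e2 : inner ℝ (u t) φ = inner ℝ (u 0) φ +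
        ∫ τ in (0)..t, inner ℝ (Lu τ + (Nu τ - (3 * C₀) • u τ)) φ := by
      rw [eu t ht, inner_add_left, inner_intervalIntegral iB _ ht]
    have hi : ∀ {F : ℝ → ℝ}, IntegrableOn F (Icc 0 T) → IntervalIntegrable F volume 0 t :=
      fun hF => (intervalIntegrable_iff_integrableOn_Icc_of_le ht.1).2
        (hF.mono_set (Icc_subset_Icc_right ht.2))
    rw [inner_sub_left, e1, e2, inner_sub_left]
    have e3 : ∫ τ in (0)..t, (inner ℝ ((1 - ε) • (LV τ + Nv τ) -
          (Lu τ + (Nu τ - (3 * C₀) • u τ))) φ + inner ℝ (-ε • (LV τ + Nv τ)) l) =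
        (∫ τ in (0)..t, inner ℝ (LV τ + Nv τ) ((1 - ε) • φ - ε • l)) -
          ∫ τ in (0)..t, inner ℝ (Lu τ + (Nu τ - (3 * C₀) • u τ)) φ := by
      rw [← intervalIntegral.integral_sub (hi (iA.inner_const _)) (hi (iB.inner_const _))]
      refine intervalIntegral.integral_congr fun τ _ => ?_
      simp only [inner_sub_left, inner_sub_right, real_inner_smul_left, real_inner_smul_right]
      ring
    rw [e3]
    ring
  have iM : IntegrableOn (fun τ =>
      inner ℝ ((1 - ε) • (LV τ + Nv τ) - (Lu τ + (Nu τ - (3 * C₀) • u τ))) φ +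
        inner ℝ (-ε • (LV τ + Nv τ)) l) (Icc 0 T) :=
    ((mF₁.integrable (by norm_num)).inner_const φ).add ((mF₂.integrable (by norm_num)).inner_const l)
  have hi : ∀ t ∈ Icc 0 T, IntervalIntegrable (fun τ =>
      inner ℝ ((1 - ε) • (LV τ + Nv τ) - (Lu τ + (Nu τ - (3 * C₀) • u τ))) φ +
        inner ℝ (-ε • (LV τ + Nv τ)) l) volume 0 t := fun t ht =>
    (intervalIntegrable_iff_integrableOn_Icc_of_le ht.1).2 (iM.mono_set (Icc_subset_Icc_right ht.2))
  have := intervalIntegral.integral_interval_sub_left (hi t ht) (hi r hr)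
  rw [← this, inner_sub_left, key t ht, key r hr]
  ring

end SpatialDomain

/-! ### Integration in time -/

theorem timeNorm_pow (T : ℝ) {k : ℕ} (hk : k ≠ 0) (N : ℝ → ℝ≥0∞) :
    timeNorm T k N ^ k = ∫⁻ t in Icc 0 T, N t ^ k := by
  have hk' : (k : ℝ) ≠ 0 := by exact_mod_cast hk
  rw [timeNorm, ← ENNReal.rpow_natCast, ← ENNReal.rpow_mul, one_div_mul_cancel hk',
      ENNReal.rpow_one]
  simp_rw [ENNReal.rpow_natCast]

theorem timeNorm_congr {T p : ℝ} {N N' : ℝ → ℝ≥0∞} (h : ∀ t ∈ Icc 0 T, N t = N' t) :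
    timeNorm T p N = timeNorm T p N' := by
  rw [timeNorm, timeNorm]
  congr 1
  exact setLIntegral_congr_fun measurableSet_Icc fun t ht => by simp only [h t ht]

/-- Hölder's inequality with exponents p/2 and its conjugate q. The condition 5q ≤ 6 is equivalent
to p ≥ 12, and then ν^{5q} ≤ ν⁶ because ν ≥ 1. This fixes the value of p₀. -/
theorem lintegral_weight_le {T p : ℝ} (hp : 12 ≤ p) {ν a : ℝ → ℝ≥0∞} (hν : ∀ t, 1 ≤ ν t)
    (mν : AEMeasurable ν (volume.restrict (Icc 0 T)))
    (ma : AEMeasurable a (volume.restrict (Icc 0 T))) :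
    ∫⁻ t in Icc 0 T, ν t ^ 5 * a t ^ 2 ≤
      (∫⁻ t in Icc 0 T, ν t ^ 6) ^ (1 / (p / 2).conjExponent) * timeNorm T p a ^ 2 := by
  have hp2 : 1 < p / 2 := by linarith
  have hc := (Real.HolderConjugate.conjExponent hp2).symm
  have hq0 : 0 < (p / 2).conjExponent := hc.pos
  have hq : 5 * (p / 2).conjExponent ≤ 6 := by
    rw [Real.conjExponent, ← mul_div_assoc, div_le_iff₀ (by linarith)]
    linarith
  refine (ENNReal.lintegral_mul_le_Lp_mul_Lq (volume.restrict (Icc 0 T)) hc (mν.pow_const 5)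
    (ma.pow_const 2)).trans ?_
  refine mul_le_mul' (ENNReal.rpow_le_rpow (lintegral_mono fun t => ?_) (by positivity))
    (le_of_eq ?_)
  · calc (ν t ^ 5) ^ (p / 2).conjExponent = ν t ^ (5 * (p / 2).conjExponent) := by
          rw [← ENNReal.rpow_natCast, ← ENNReal.rpow_mul]; norm_num
      _ ≤ ν t ^ (6 : ℝ) := ENNReal.rpow_le_rpow_of_exponent_le (hν t) hq
      _ = ν t ^ 6 := by rw [← ENNReal.rpow_natCast]; norm_num
  · have e : ∀ x : ℝ≥0∞, (x ^ 2) ^ (p / 2) = x ^ p := fun x => by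
      rw [← ENNReal.rpow_natCast, ← ENNReal.rpow_mul]
      congr 1
      push_cast; ring
    simp_rw [e]
    rw [timeNorm, ← ENNReal.rpow_natCast, ← ENNReal.rpow_mul]
    congr 1
    push_cast; field_simp

theorem integrable_and_integral_le {T c : ℝ} (hc : 0 ≤ c) {ρ : ℝ → ℝ} (h0 : ∀ t, 0 ≤ ρ t)
    (hm : AEMeasurable ρ (volume.restrict (Icc 0 T)))
    (h : ∫⁻ t in Icc 0 T, ENNReal.ofReal (ρ t) ≤ ENNReal.ofReal c) :
    IntegrableOn ρ (Icc 0 T) ∧ ∀ b ∈ Icc 0 T, ∫ s in (0)..b, ρ s ≤ c := by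
  have hi : IntegrableOn ρ (Icc 0 T) := by
    refine ⟨hm.aestronglyMeasurable, ?_⟩
    rw [hasFiniteIntegral_iff_ofReal (ae_of_all _ h0)]
    exact h.trans_lt ENNReal.ofReal_lt_top
  refine ⟨hi, fun b hb => ?_⟩
  rw [intervalIntegral.integral_of_le hb.1]
  calc ∫ s in Ioc 0 b, ρ s ≤ ∫ s in Icc 0 T, ρ s :=
        setIntegral_mono_set hi (ae_of_all _ h0)
          (Ioc_subset_Icc_self.trans (Icc_subset_Icc_right hb.2)).eventuallyLE
    _ ≤ c := by
        rw [integral_eq_lintegral_of_nonneg_ae (ae_of_all _ h0) hm.aestronglyMeasurable]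
        exact ENNReal.toReal_le_of_le_ofReal hc h

theorem intervalIntegral_mono_ae_Icc {T : ℝ} {f g : ℝ → ℝ} (hf : IntegrableOn f (Icc 0 T))
    (hg : IntegrableOn g (Icc 0 T)) (h : ∀ᵐ s ∂volume.restrict (Icc 0 T), f s ≤ g s) {b : ℝ}
    (hb : b ∈ Icc 0 T) : ∫ s in (0)..b, f s ≤ ∫ s in (0)..b, g s := by
  have hs : Ioc 0 b ⊆ Icc 0 T := Ioc_subset_Icc_self.trans (Icc_subset_Icc_right hb.2)
  rw [intervalIntegral.integral_of_le hb.1, intervalIntegral.integral_of_le hb.1]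
  exact setIntegral_mono_ae_restrict (hf.mono_set hs) (hg.mono_set hs)
    (ae_restrict_of_ae_restrict_of_subset hs h)

namespace SpatialDomain

variable {D : SpatialDomain}

theorem enorm_cube_eq {z₃ : D.L2} {z : Plane → ℝ} (h : z₃ =ᵐ[D.vol] fun x => z x ^ 3) :
    ‖z₃‖ₑ ^ 2 = eLpNorm z 6 D.vol ^ 6 := by
  rw [enorm_sq_L2_eq, eLpNorm_eq_lintegral_rpow_enorm_toReal (by norm_num) (by norm_num),
    ← ENNReal.rpow_natCast, ← ENNReal.rpow_mul]
  norm_num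
  refine lintegral_congr_ae ?_
  filter_upwards [h] with x hx
  rw [hx, enorm_pow, ← pow_mul]

/-- The forcing term of the energy estimate is small. -/
theorem exists_forcing_bound {T p : ℝ} (hp : 12 ≤ p) {n : ℝ → ℝ} (hn : ∀ t, 1 ≤ n t)
    (mn : AEMeasurable n (volume.restrict (Icc 0 T)))
    (hI : ∫⁻ t in Icc 0 T, ENNReal.ofReal (n t) ^ 6 ≠ ∞) : ∃ R : ℝ, 0 ≤ R ∧
    ∀ (e γ : ℝ), 0 < e → e ≤ 1 → e ≤ γ → ∀ Z ζ z₃ : ℝ → D.L2, ContinuousOn Z (Icc 0 T) →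
      ContinuousOn ζ (Icc 0 T) → ContinuousOn z₃ (Icc 0 T) →
      timeNorm T p (fun t => ENNReal.ofReal (negNorm (Z t))) ^ 2 ≤ ENNReal.ofReal γ →
      timeNorm T p (fun t => ENNReal.ofReal (negNorm (ζ t))) ^ 2 ≤ ENNReal.ofReal γ →
      ∫⁻ t in Icc 0 T, ENNReal.ofReal (negNorm (z₃ t)) ^ 2 ≤ ENNReal.ofReal γ →
      ENNReal.ofReal e * ∫⁻ t in Icc 0 T, ‖z₃ t‖ₑ ^ 2 ≤ ENNReal.ofReal γ →
      let ρ : ℝ → ℝ := fun t => n t ^ 5 * (negNorm (Z t) ^ 2 + negNorm (ζ t) ^ 2) +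
        negNorm (z₃ t) ^ 2 + e * n t ^ 6 + e ^ 2 * ‖z₃ t‖ ^ 2
      IntegrableOn ρ (Icc 0 T) ∧ ∀ b ∈ Icc 0 T, ∫ s in (0)..b, ρ s ≤ R * γ := by
  set ν : ℝ → ℝ≥0∞ := fun t => ENNReal.ofReal (n t) with hν
  set I := ∫⁻ t in Icc 0 T, ν t ^ 6 with hIdef
  set J := I ^ (1 / (p / 2).conjExponent) with hJ
  have hq : 0 ≤ 1 / (p / 2).conjExponent :=
    one_div_nonneg.2 (Real.HolderConjugate.conjExponent (by linarith : 1 < p / 2)).symm.pos.le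
  have hJt : J ≠ ∞ := ENNReal.rpow_ne_top_of_nonneg hq hI
  have hRt : 2 * J + 2 + I ≠ ∞ := by simp [ENNReal.mul_eq_top, hJt, hI]
  -- Two weighted H⁻¹ terms give 2J, the H⁻¹ norm of z³ and the term e²‖z³‖² give 1 each, and en⁶
  -- gives I because e ≤ γ.
  refine ⟨(2 * J + 2 + I).toReal, ENNReal.toReal_nonneg, ?_⟩
  intro e γ he he1 heγ Z ζ z₃ cZ cζ cz₃ h1 h2 h3 h4 ρ
  have hγ : 0 ≤ γ := he.le.trans heγ
  have mneg : ∀ {k : ℝ → D.L2}, ContinuousOn k (Icc 0 T) →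
      AEMeasurable (fun t => negNorm (k t)) (volume.restrict (Icc 0 T)) := fun hk =>
    (continuous_negNorm.comp_continuousOn hk).aemeasurable measurableSet_Icc
  have mnorm : AEMeasurable (fun t => ‖z₃ t‖) (volume.restrict (Icc 0 T)) :=
    cz₃.norm.aemeasurable measurableSet_Icc
  have mZ := mneg cZ
  have mζ := mneg cζ
  have mz := mneg cz₃
  have hn0 : ∀ t, 0 ≤ n t := fun t => zero_le_one.trans (hn t)
  have hν1 : ∀ t, 1 ≤ ν t := fun t => by
    rw [hν]; simp only; rw [← ENNReal.ofReal_one]; exact ENNReal.ofReal_le_ofReal (hn t)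
  have mν : AEMeasurable ν (volume.restrict (Icc 0 T)) := mn.ennreal_ofReal
  refine integrable_and_integral_le (mul_nonneg ENNReal.toReal_nonneg hγ) (fun t => ?_) ?_ ?_
  · have := hn0 t
    simp only [ρ]; positivity
  · simp only [ρ]; fun_prop
  · set a : ℝ → ℝ≥0∞ := fun t => ENNReal.ofReal (negNorm (Z t)) with ha
    set b : ℝ → ℝ≥0∞ := fun t => ENNReal.ofReal (negNorm (ζ t)) with hb
    set d : ℝ → ℝ≥0∞ := fun t => ENNReal.ofReal (negNorm (z₃ t)) with hd
    have e1 : ∀ t, ENNReal.ofReal (ρ t) = ν t ^ 5 * a t ^ 2 + (ν t ^ 5 * b t ^ 2 + (d t ^ 2 +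
        (ENNReal.ofReal e * ν t ^ 6 + ENNReal.ofReal e * (ENNReal.ofReal e * ‖z₃ t‖ₑ ^ 2)))) :=
      fun t => by
        have := hn0 t
        have k1 := negNorm_nonneg (Z t)
        have k2 := negNorm_nonneg (ζ t)
        have k3 := negNorm_nonneg (z₃ t)
        simp only [ρ, ha, hb, hd, hν]
        rw [← ofReal_norm, ← ENNReal.ofReal_pow this, ← ENNReal.ofReal_pow this,
          ← ENNReal.ofReal_pow k1, ← ENNReal.ofReal_pow k2, ← ENNReal.ofReal_pow k3,
          ← ENNReal.ofReal_pow (norm_nonneg _), ← ENNReal.ofReal_mul (by positivity),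
          ← ENNReal.ofReal_mul (by positivity), ← ENNReal.ofReal_mul he.le,
          ← ENNReal.ofReal_mul he.le, ← ENNReal.ofReal_mul he.le,
          ← ENNReal.ofReal_add (by positivity) (by positivity),
          ← ENNReal.ofReal_add (by positivity) (by positivity),
          ← ENNReal.ofReal_add (by positivity) (by positivity),
          ← ENNReal.ofReal_add (by positivity) (by positivity)]
        congr 1
        ring
    have ma : AEMeasurable a (volume.restrict (Icc 0 T)) := mZ.ennreal_ofReal
    have mb : AEMeasurable b (volume.restrict (Icc 0 T)) := mζ.ennreal_ofReal
    have md : AEMeasurable d (volume.restrict (Icc 0 T)) := mz.ennreal_ofReal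
    simp_rw [e1]
    have m1 : AEMeasurable (fun t => ν t ^ 5 * a t ^ 2) (volume.restrict (Icc 0 T)) :=
      (mν.pow_const 5).mul (ma.pow_const 2)
    have m2 : AEMeasurable (fun t => ν t ^ 5 * b t ^ 2) (volume.restrict (Icc 0 T)) :=
      (mν.pow_const 5).mul (mb.pow_const 2)
    have m3 : AEMeasurable (fun t => d t ^ 2) (volume.restrict (Icc 0 T)) := md.pow_const 2
    have m4 : AEMeasurable (fun t => ENNReal.ofReal e * ν t ^ 6) (volume.restrict (Icc 0 T)) :=
      (mν.pow_const 6).const_mul _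
    rw [lintegral_add_left' m1, lintegral_add_left' m2, lintegral_add_left' m3,
      lintegral_add_left' m4,
      lintegral_const_mul' _ _ ENNReal.ofReal_ne_top,
          lintegral_const_mul' _ _ ENNReal.ofReal_ne_top,
      lintegral_const_mul' _ _ ENNReal.ofReal_ne_top]
    have k1 := (lintegral_weight_le hp hν1 mν ma).trans (mul_le_mul' le_rfl h1)
    have k2 := (lintegral_weight_le hp hν1 mν mb).trans (mul_le_mul' le_rfl h2)
    have k3 : ENNReal.ofReal e ≤ ENNReal.ofReal γ := ENNReal.ofReal_le_ofReal heγ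
    have k4 : ENNReal.ofReal e ≤ 1 := by
      rw [← ENNReal.ofReal_one]; exact ENNReal.ofReal_le_ofReal he1
    calc _ ≤ J * ENNReal.ofReal γ + (J * ENNReal.ofReal γ + (ENNReal.ofReal γ +
            (ENNReal.ofReal γ * I + 1 * ENNReal.ofReal γ))) :=
          add_le_add k1 (add_le_add k2 (add_le_add h3 (add_le_add (mul_le_mul' k3 le_rfl)
            (mul_le_mul' k4 h4))))
      _ = (2 * J + 2 + I) * ENNReal.ofReal γ := by ring
      _ = _ := by rw [ENNReal.ofReal_mul ENNReal.toReal_nonneg, ENNReal.ofReal_toReal hRt]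

end SpatialDomain

/-! ### The pathwise estimate -/

namespace SpatialDomain

variable {D : SpatialDomain}

theorem abs_le_mul_of_cube_le {r C n A : ℝ} (hC : 0 ≤ C) (hn : 1 ≤ n) (hA : n ^ 3 = A)
    (h : |r| ^ 3 ≤ C * A) : |r| ≤ (C + 1) * n := by
  have hn0 : 0 ≤ n := by linarith
  refine le_of_pow_le_pow_left₀ three_ne_zero (by positivity) (h.trans ?_)
  rw [mul_pow, hA]
  have hA0 : 0 ≤ A := by rw [← hA]; positivity
  refine mul_le_mul_of_nonneg_right ?_ hA0
  nlinarith [sq_nonneg C, mul_nonneg hC (sq_nonneg C)]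

theorem continuousOn_cubic_comp {T : ℝ} {w : ℝ → Plane → ℝ}
    (hw : ContinuousOn (fun q : ℝ × Plane => w q.1 q.2) (Icc 0 T ×ˢ closure D.carrier)) :
    ContinuousOn (fun q : ℝ × Plane => cubic (w q.1 q.2)) (Icc 0 T ×ˢ closure D.carrier) := by
  unfold cubic
  exact hw.sub (hw.pow 3)

theorem mul_sq_le_of_normC0 {ε T : ℝ} (hε : 0 < ε) {z : ℝ → Plane → ℝ}
    (h : ENNReal.ofReal (ε ^ (1 / 4 : ℝ)) * ⨆ t ∈ Icc 0 T, D.normC0 (z t) ≤ 1 / 2) {t : ℝ}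
    (ht : t ∈ Icc 0 T) {x : Plane} (hx : x ∈ closure D.carrier) :
    ε ^ (1 / 2 : ℝ) * z t x ^ 2 ≤ 1 / 4 := by
  have h1 : ‖z t x‖ₑ ≤ ⨆ t ∈ Icc 0 T, D.normC0 (z t) :=
    (le_iSup₂_of_le (f := fun x (_ : x ∈ closure D.carrier) => ‖z t x‖ₑ) x hx le_rfl).trans
      (le_iSup₂_of_le (f := fun t (_ : t ∈ Icc 0 T) => D.normC0 (z t)) t ht le_rfl)
  have hp : 0 ≤ ε ^ (1 / 4 : ℝ) := Real.rpow_nonneg hε.le _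
  have h2 : ENNReal.ofReal (ε ^ (1 / 4 : ℝ) * |z t x|) ≤ ENNReal.ofReal (1 / 2) := by
    rw [ENNReal.ofReal_mul hp, ← Real.enorm_eq_ofReal_abs]
    refine (mul_le_mul' le_rfl h1).trans (h.trans (le_of_eq ?_))
    rw [ENNReal.ofReal_div_of_pos two_pos]
    simp
  have h3 := (ENNReal.ofReal_le_ofReal_iff (by norm_num)).1 h2
  have h4 : ε ^ (1 / 2 : ℝ) = (ε ^ (1 / 4 : ℝ)) ^ 2 := by
    rw [← Real.rpow_natCast, ← Real.rpow_mul hε.le]; norm_num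
  rw [h4, ← sq_abs (z t x), ← mul_pow]
  calc (ε ^ (1 / 4 : ℝ) * |z t x|) ^ 2 ≤ (1 / 2) ^ 2 :=
        pow_le_pow_left₀ (mul_nonneg hp (abs_nonneg _)) h3 2
    _ = 1 / 4 := by norm_num

/-- The deterministic core of the theorem: the slice estimate is inserted into the energy identity,
the forcing is integrated in time, and Gronwall's inequality concludes. The constant depends on u
only through its bounds in time and space. -/
theorem exists_pathwise_bound {C₀ T : ℝ} (hT : 0 < T) {u : ℝ → D.L2}
    (hu : D.IsLimitSolution C₀ T u) {p : ℝ} (hp : 12 ≤ p) : ∃ K : ℝ, 0 < K ∧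
    ∀ ε ∈ Ioo (0 : ℝ) (1 / 4000000), ∀ z v : ℝ → Plane → ℝ, D.ContTime T z →
      D.IsShiftedSolution ε T z v → ∀ γ : ℝ, ε ^ (1 / 2 : ℝ) ≤ γ →
      ENNReal.ofReal (ε ^ (1 / 4 : ℝ)) * (⨆ t ∈ Icc 0 T, D.normC0 (z t)) ≤ 1 / 2 →
      eLpNorm (fun x => v 0 x - u 0 x) 2 D.vol ^ 2 ≤ ENNReal.ofReal γ →
      timeNorm T p (fun t => D.normNegOne (fun x => z t x ^ 2 - C₀)) ^ 2 ≤ ENNReal.ofReal γ →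
      timeNorm T p (fun t => D.normNegOne (z t)) ^ 2 ≤ ENNReal.ofReal γ →
      timeNorm T 2 (fun t => D.normNegOne (fun x => z t x ^ 3)) ^ 2 ≤ ENNReal.ofReal γ →
      ENNReal.ofReal (ε ^ (1 / 2 : ℝ)) * timeNorm T 6 (fun t => eLpNorm (z t) 6 D.vol) ^ 6 ≤
        ENNReal.ofReal γ →
      ∀ t ∈ Icc 0 T, eLpNorm (fun x => v t x - u t x) 2 D.vol ^ 2 ≤ ENNReal.ofReal (K * γ) := by
  obtain ⟨cu, gu, hu', Nu, C, hC, Hu, lu, hNu, mNu, eu, hb⟩ := hu.exists_regular hT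
  obtain ⟨K, hK, slice⟩ := D.exists_slice_estimate (C + 1) C₀ (by linarith)
  set A : ℝ → ℝ := fun t => 1 + ∑ i, ∑ j, ‖hu' t i j‖ with hA
  have hA1 : ∀ t, 1 ≤ A t := fun t => le_add_of_nonneg_right
    (Finset.sum_nonneg fun _ _ => Finset.sum_nonneg fun _ _ => norm_nonneg _)
  have mA : MemLp A 2 (volume.restrict (Icc 0 T)) := Hu.memLp_hess
  -- With this choice n⁶ = A² is integrable in time, precisely because u lies in L²H².
  set n : ℝ → ℝ := fun t => A t ^ (1 / 3 : ℝ) with hn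
  have hn1 : ∀ t, 1 ≤ n t := fun t => Real.one_le_rpow (hA1 t) (by norm_num)
  have hn3 : ∀ t, n t ^ 3 = A t := fun t => by
    simp only [hn]
    rw [← Real.rpow_natCast, ← Real.rpow_mul (zero_le_one.trans (hA1 t))]
    norm_num
  have mn : AEMeasurable n (volume.restrict (Icc 0 T)) := mA.1.aemeasurable.pow_const _
  have hI : ∫⁻ t in Icc 0 T, ENNReal.ofReal (n t) ^ 6 ≠ ∞ := by
    have h2 := mA.2
    rw [eLpNorm_lt_top_iff_lintegral_rpow_enorm_lt_top (by simp) (by simp)] at h2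
    refine (lt_of_le_of_lt (lintegral_mono fun t => le_of_eq ?_) h2).ne
    have hA0 : 0 ≤ A t := zero_le_one.trans (hA1 t)
    have hn0 : 0 ≤ n t := zero_le_one.trans (hn1 t)
    rw [Real.enorm_of_nonneg hA0, ← hn3 t, ENNReal.ofReal_pow hn0]
    norm_num
    ring
  obtain ⟨R, hR, forcing⟩ := exists_forcing_bound (D := D) hp hn1 mn hI
  -- The initial error contributes 1 and the forcing 2KR. The rate 2(K+1) in place of 2K is strictly
  -- positive even if K = 0.
  refine ⟨(1 + 2 * K * R) * Real.exp (2 * (K + 1) * T), by positivity, ?_⟩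
  intro ε hε z v hz hv γ hγ hz0 hi h1 h2 h3 h4
  obtain ⟨hv, V, gV, hV, hVv, HV, lV, eV⟩ := hv
  set e := ε ^ (1 / 2 : ℝ) with he
  have he0 : 0 < e := Real.rpow_pos_of_pos hε.1 _
  have hee : e ^ 2 = ε := by
    rw [he, ← Real.rpow_natCast, ← Real.rpow_mul hε.1.le]; norm_num
  have he1 : e ≤ 1 / 2000 := by
    refine le_of_pow_le_pow_left₀ two_ne_zero (by norm_num) ?_
    rw [hee]; exact hε.2.le.trans (by norm_num)
  have hγ0 : 0 ≤ γ := he0.le.trans hγ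
  have cz := hz.continuousOn
  have cv := hv.continuousOn
  obtain ⟨Z, hZ, cZ⟩ := exists_path cz
  obtain ⟨ζ, hζ, cζ⟩ := exists_path (w := fun t x => z t x ^ 2 - C₀)
    ((cz.pow 2).sub continuousOn_const)
  obtain ⟨z₃, hz₃, cz₃⟩ := exists_path (w := fun t x => z t x ^ 3) (cz.pow 3)
  obtain ⟨Nv, hNv, cNv⟩ := exists_path (w := fun t x => cubic (v t x + z t x))
    (continuousOn_cubic_comp (w := fun t x => v t x + z t x) (cv.add cz))
  obtain ⟨V', hV', cV'⟩ := exists_path cv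
  -- Continuity in L² of the given path is inherited from the joint continuity of v in time and
  -- space.
  have cV : ContinuousOn V (Icc 0 T) := cV'.congr fun t ht =>
    Lp.ext ((hVv t ht).trans (hV' t ht).symm)
  obtain ⟨im, hid⟩ := energy_difference cV cu HV Hu lV lu (memLp_of_continuousOn cNv) mNu hNv eV eu
  set m : ℝ → ℝ := fun s =>
      inner ℝ ((1 - ε) • (∑ i, hV s i i + Nv s) - (∑ i, hu' s i i + (Nu s - (3 * C₀) • u s)))
        (V s - u s) + inner ℝ (-ε • (∑ i, hV s i i + Nv s)) (∑ i, hV s i i - ∑ i, hu' s i i) with hm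
  obtain ⟨iρ, hρ⟩ := forcing e γ he0 (he1.trans (by norm_num)) hγ Z ζ z₃ cZ cζ cz₃
    (by
      rw [timeNorm_congr (N' := fun t => D.normNegOne (z t)) fun t ht => by
        rw [ofReal_negNorm, normNegOne_congr (hZ t ht)]]
      exact h2)
    (by
      rw [timeNorm_congr (N' := fun t => D.normNegOne fun x => z t x ^ 2 - C₀) fun t ht => by
        rw [ofReal_negNorm, normNegOne_congr (hζ t ht)]]
      exact h1)
    (by
      have := timeNorm_pow T two_ne_zero (fun t => D.normNegOne fun x => z t x ^ 3)
      rw [Nat.cast_ofNat] at this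
      rw [this] at h3
      refine le_trans (le_of_eq ?_) h3
      refine setLIntegral_congr_fun measurableSet_Icc fun t ht => ?_
      rw [ofReal_negNorm, normNegOne_congr (hz₃ t ht)])
    (by
      have := timeNorm_pow T (k := 6) (by norm_num) (fun t => eLpNorm (z t) 6 D.vol)
      rw [Nat.cast_ofNat] at this
      rw [this] at h4
      refine le_trans (le_of_eq ?_) h4
      congr 1
      refine setLIntegral_congr_fun measurableSet_Icc fun t ht => ?_
      exact enorm_cube_eq (hz₃ t ht))
  set ρ : ℝ → ℝ := fun t => n t ^ 5 * (negNorm (Z t) ^ 2 + negNorm (ζ t) ^ 2) +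
        negNorm (z₃ t) ^ 2 + e * n t ^ 6 + e ^ 2 * ‖z₃ t‖ ^ 2 with hρd
  have cy : ContinuousOn (fun t => ‖V t - u t‖ ^ 2) (Icc 0 T) := (cV.sub cu).norm.pow 2
  have iy : IntegrableOn (fun t => ‖V t - u t‖ ^ 2) (Icc 0 T) := cy.integrableOn_Icc
  have hmle : ∀ᵐ s ∂volume.restrict (Icc 0 T), m s ≤ K * (‖V s - u s‖ ^ 2 + ρ s) := by
    filter_upwards [HV.1, Hu.1, lV, lu, hNu, hb, ae_restrict_mem measurableSet_Icc]
      with s k1 k2 k3 k4 k5 k6 hs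
    have hlu : ‖∑ i, hu' s i i‖ ≤ n s ^ 3 := by
      rw [hn3]
      refine (norm_sum_le _ _).trans ?_
      have : ∑ i, ‖hu' s i i‖ ≤ ∑ i, ∑ j, ‖hu' s i j‖ := Finset.sum_le_sum fun i _ =>
        Finset.single_le_sum (f := fun j => ‖hu' s i j‖) (fun _ _ => norm_nonneg _)
          (Finset.mem_univ i)
      simp only [hA]
      linarith
    have := slice e (n s) he0 he1 (hn1 s) (V s) (u s) (∑ i, hV s i i) (∑ i, hu' s i i) (Nv s) (Nu s)
      (Z s) (ζ s) (z₃ s) (gV s) (gu s) (hV s) (hu' s) k1 k2 k3 k4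
      (by
        filter_upwards [k6.2.1] with x hx
        exact abs_le_mul_of_cube_le hC (hn1 s) (hn3 s) hx)
      (fun i => by
        obtain ⟨R, hR, hRn⟩ := k6.2.2 i
        refine ⟨R, hR, hRn.trans ?_⟩
        rw [hn3]
        exact mul_le_mul_of_nonneg_right (by linarith) (zero_le_one.trans (hA1 s)))
      hlu
      (by
        filter_upwards [hNv s hs, hVv s hs, hZ s hs] with x q1 q2 q3
        rw [q1, q2, q3])
      k5
      (by
        filter_upwards [hζ s hs, hZ s hs] with x q1 q2
        rw [q1, q2])
      (by
        filter_upwards [hz₃ s hs, hZ s hs] with x q1 q2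
        rw [q1, q2])
      (by
        filter_upwards [hZ s hs, ae_restrict_mem D.measurableSet_carrier] with x q1 q2
        rw [q1]
        exact mul_sq_le_of_normC0 hε.1 hz0 hs (subset_closure q2))
    rw [hee] at this
    simp only [hm, hρd]
    rw [hee]
    refine this.trans (le_of_eq ?_)
    ring
  have hy0 : ‖V 0 - u 0‖ ^ 2 ≤ γ := by
    have e1 : ‖V 0 - u 0‖ₑ = eLpNorm (fun x => v 0 x - u 0 x) 2 D.vol := by
      rw [Lp.enorm_def]
      refine eLpNorm_congr_ae ?_
      filter_upwards [Lp.coeFn_sub (V 0) (u 0), hVv 0 ⟨le_rfl, hT.le⟩] with x q1 q2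
      rw [q1, Pi.sub_apply, q2]
    rw [← e1, ← ofReal_norm, ← ENNReal.ofReal_pow (norm_nonneg _)] at hi
    exact (ENNReal.ofReal_le_ofReal_iff hγ0).1 hi
  intro t ht
  have gron := integral_gronwall hT (K := 2 * (K + 1)) (B := (1 + 2 * K * R) * γ) (by positivity)
    (by positivity) cy (fun _ _ => sq_nonneg _) (fun b hb => by
      have hb' : b ∈ Icc 0 T := ⟨hb.1, hb.2.le⟩
      have iKρ : IntegrableOn (fun s => K * (‖V s - u s‖ ^ 2 + ρ s)) (Icc 0 T) :=
        (iy.add iρ).const_mul K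
      have hint : ∀ {F : ℝ → ℝ}, IntegrableOn F (Icc 0 T) → IntervalIntegrable F volume 0 b :=
        fun hF => (intervalIntegrable_iff_integrableOn_Icc_of_le hb.1).2
          (hF.mono_set (Icc_subset_Icc_right hb'.2))
      have q1 := intervalIntegral_mono_ae_Icc im iKρ hmle hb'
      rw [intervalIntegral.integral_const_mul,
          intervalIntegral.integral_add (hint iy) (hint iρ)] at q1
      have q2 := hid b hb
      have q3 := mul_le_mul_of_nonneg_left (hρ b hb') hK
      have q4 : 0 ≤ ∫ s in (0)..b, ‖V s - u s‖ ^ 2 :=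
        intervalIntegral.integral_nonneg hb.1 fun s _ => sq_nonneg _
      linarith only [q1, q2, q3, q4, hy0]) ht
  have e1 : ‖V t - u t‖ₑ = eLpNorm (fun x => v t x - u t x) 2 D.vol := by
    rw [Lp.enorm_def]
    refine eLpNorm_congr_ae ?_
    filter_upwards [Lp.coeFn_sub (V t) (u t), hVv t ht] with x q1 q2
    rw [q1, Pi.sub_apply, q2]
  rw [← e1, ← ofReal_norm, ← ENNReal.ofReal_pow (norm_nonneg _)]
  refine ENNReal.ofReal_le_ofReal (gron.trans (le_of_eq ?_))
  ring

end SpatialDomain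

/-! ### The stochastic convolution at time zero, and the main theorem -/

/-- At time 0 every increment in the Riemann sums vanishes, so the L² limit is zero. -/
theorem IsWienerIntegral.ae_eq_zero {Ω H : Type*} [MeasurableSpace Ω] [NormedAddCommGroup H]
    [InnerProductSpace ℝ H] {W : ℝ≥0 → H → Ω → ℝ} {P : Measure Ω} {g : ℝ≥0 → H} {I : Ω → ℝ}
    (h : IsWienerIntegral W P 0 g I) : I =ᵐ[P] 0 := by
  obtain ⟨hI, ht⟩ := h
  simp only [mul_zero, zero_div, sub_self, Finset.sum_const_zero, zero_sub] at ht
  have h0 := tendsto_nhds_unique ht tendsto_const_nhds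
  have hn : eLpNorm (fun ω => -I ω) 2 P = eLpNorm I 2 P := eLpNorm_neg I 2 P
  rw [hn] at h0
  exact (eLpNorm_eq_zero_iff hI.1 (by simp)).1 h0.symm

namespace SpatialDomain

variable {D : SpatialDomain}

/-- Needed because the initial event concerns u_ε(0), while the energy estimate starts from u_ε(0) -
Z(0). A countable dense set of test vectors yields one null set. -/
theorem IsStochasticConvolution.ae_zero {Ω : Type*} [MeasurableSpace Ω] {P : Measure Ω}
    {W : ℝ≥0 → D.L2 → Ω → ℝ} {ε σ T : ℝ} {Z : Ω → ℝ → Plane → ℝ} (hT : 0 < T)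
    (hZ : D.IsStochasticConvolution P W ε σ T Z) : ∀ᵐ ω ∂P, Z ω 0 =ᵐ[D.vol] 0 := by
  obtain ⟨hc, S, -, hI⟩ := hZ
  have : Fact ((2 : ℝ≥0∞) ≠ ∞) := ⟨by simp⟩
  have : SecondCountableTopology D.L2 := Lp.SecondCountableTopology
  obtain ⟨s, hs, hd⟩ := TopologicalSpace.exists_countable_dense D.L2
  have hall : ∀ᵐ ω ∂P, ∀ h ∈ s, ∫ x, Z ω 0 x * h x ∂D.vol = 0 := (ae_ball_iff hs).2 fun h _ => by
    have := (hI 0 (by simpa using hT.le) h).ae_eq_zero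
    filter_upwards [this] with ω hω
    simpa using hω
  filter_upwards [hc, hall] with ω h1 h2
  obtain ⟨Θ, hΘ, -⟩ := exists_path h1.continuousOn
  have h0 := hΘ 0 ⟨le_rfl, hT.le⟩
  have hz : ∀ h : D.L2, inner ℝ (Θ 0) h = 0 := by
    have hcl : IsClosed {h : D.L2 | inner ℝ (Θ 0) h = 0} := isClosed_eq (by fun_prop) (by fun_prop)
    have hsub : s ⊆ {h : D.L2 | inner ℝ (Θ 0) h = 0} := fun h hh => by
      rw [mem_ofPred_eq, inner_L2_eq]
      refine Eq.trans (integral_congr_ae ?_) (h2 h hh)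
      filter_upwards [h0] with x hx
      rw [hx]
    exact fun h => closure_minimal hsub hcl (hd h)
  have hΘ0 : Θ 0 = 0 := inner_self_eq_zero.1 (hz (Θ 0))
  filter_upwards [h0, Lp.coeFn_zero ℝ 2 D.vol] with x a b
  rw [← a, hΘ0, b]

end SpatialDomain

theorem mainTheorem2 (D : SpatialDomain) :
    ∃ ε₀ ∈ Ioo (0 : ℝ) 1, ∃ p₀ : ℝ, 2 < p₀ ∧
      ∀ (C₀ T : ℝ), 0 < T → ∀ u : ℝ → D.L2, D.IsLimitSolution C₀ T u →
      ∀ p : ℝ, p₀ ≤ p → ∃ K : ℝ, 0 < K ∧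
      ∀ ε ∈ Ioo 0 ε₀,
      ∀ (Ω : Type*) [MeasurableSpace Ω] (P : Measure Ω) [IsProbabilityMeasure P]
        (W : ℝ≥0 → D.L2 → Ω → ℝ), IsCylindricalWiener W P →
      ∀ (σ : ℝ) (Z : Ω → ℝ → Plane → ℝ), D.IsStochasticConvolution P W ε σ T Z →
      ∀ uε : Ω → ℝ → Plane → ℝ,
        (∀ᵐ ω ∂P, D.IsShiftedSolution ε T (Z ω) (fun t x => uε ω t x - Z ω t x)) →
      ∀ γ : ℝ, ε ^ (1 / 2 : ℝ) ≤ γ →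
        P {ω | ENNReal.ofReal (K * γ) <
            ⨆ t ∈ Icc 0 T, eLpNorm (fun x => uε ω t x - u t x - Z ω t x) 2 D.vol ^ 2} ≤
          P {ω | 1 / 2 < ENNReal.ofReal (ε ^ (1 / 4 : ℝ)) * ⨆ t ∈ Icc 0 T, D.normC0 (Z ω t)} +
          P {ω | ENNReal.ofReal γ < eLpNorm (fun x => u 0 x - uε ω 0 x) 2 D.vol ^ 2} +
          P {ω | ENNReal.ofReal γ <
            timeNorm T p (fun t => D.normNegOne (fun x => Z ω t x ^ 2 - C₀)) ^ 2} +
          P {ω | ENNReal.ofReal γ < timeNorm T p (fun t => D.normNegOne (Z ω t)) ^ 2} +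
          P {ω | ENNReal.ofReal γ <
            timeNorm T 2 (fun t => D.normNegOne (fun x => Z ω t x ^ 3)) ^ 2} +
          P {ω | ENNReal.ofReal γ < ENNReal.ofReal (ε ^ (1 / 2 : ℝ)) *
            timeNorm T 6 (fun t => eLpNorm (Z ω t) 6 D.vol) ^ 6} := by
  -- The bound on ε makes ε^{1/2} at most 1/2000, the threshold of the pointwise inequality; 12 is
  -- the Hölder threshold.
  refine ⟨1 / 4000000, ⟨by norm_num, by norm_num⟩, 12, by norm_num, ?_⟩
  intro C₀ T hT u hu p hp
  obtain ⟨K, hK, H⟩ := SpatialDomain.exists_pathwise_bound hT hu hp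
  refine ⟨K, hK, ?_⟩
  intro ε hε Ω _ P _ W _ σ Z hZ uε huε γ hγ
  have hsum : ∀ A B C D E F : Set Ω,
      P (A ∪ B ∪ C ∪ D ∪ E ∪ F) ≤ P A + P B + P C + P D + P E + P F :=
    fun A B C D E F =>
      (measure_union_le _ _).trans (add_le_add_left ((measure_union_le _ _).trans
        (add_le_add_left ((measure_union_le _ _).trans (add_le_add_left ((measure_union_le _ _).trans
          (add_le_add_left (measure_union_le _ _) _)) _)) _)) _)
  -- An inclusion up to a null set and subadditivity suffice, so none of the events has to be shown
  -- measurable.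
  refine le_trans (measure_mono_ae ?_) (hsum _ _ _ _ _ _)
  filter_upwards [hZ.1, hZ.ae_zero hT, huε] with ω h1 h2 h3
  intro hω
  by_contra hn
  replace hn : ω ∉ (_ ∪ _ : Set Ω) := hn
  simp only [mem_union, mem_ofPred_eq, not_or, not_lt] at hn
  obtain ⟨⟨⟨⟨⟨n1, n2⟩, n3⟩, n4⟩, n5⟩, n6⟩ := hn
  have n2' : eLpNorm (fun x => uε ω 0 x - Z ω 0 x - u 0 x) 2 D.vol ^ 2 ≤ ENNReal.ofReal γ := by
    refine le_trans (le_of_eq ?_) n2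
    congr 1
    refine eLpNorm_congr_norm_ae ?_
    filter_upwards [h2] with x hx
    rw [hx, Pi.zero_apply, sub_zero, norm_sub_rev]
  have key := H ε hε (Z ω) _ h1 h3 γ hγ n1 n2' n3 n4 n5 n6
  refine absurd hω (not_lt.2 (iSup₂_le fun t ht => ?_))
  refine le_trans (le_of_eq ?_) (key t ht)
  congr 2
  funext x
  ring
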